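/- Let $(M,g)$ be either a compact Riemannian manifold (smooth, without boundary) or the Euclidean space $\mathbb R^n$, let $f\in C^2(M)$, $d\mu=e^{-f}dv$ with $dv$ the Riemannian volume, and let $c\in(0,\infty)$, $\gamma>1$. Write $\nabla_\mu^*X=-e^{f}\,\nabla\cdot(e^{-f}X)$, $L=-\nabla_\mu^*\nabla=\Delta-\nabla f\cdot\nabla$ for the Witten Laplacian and $\mathrm{Ric}(L)=\mathrm{Ric}+\nabla^2f$. Let $J\subset\mathbb R$ be an interval with more than one point and let $(\rho,\phi)$, $\rho>0$, be a $C^\infty$ solution on $J\times M$ of $$\partial_t\rho-\nabla_\mu^*(\rho\nabla\phi)=0,\qquad c^2\Big(\partial_t\phi+\tfrac12|\nabla\phi|^2\Big)=-\phi+\frac{\gamma\rho^{\gamma-1}}{\gamma-1}.$$ If $M=\mathbb R^n$, assume in addition that each of the functions $$|\nabla\phi|^2\rho,\quad |\nabla\phi|^3\rho,\quad \rho^\gamma,\quad \rho^{2\gamma-1},\quad \frac{|\nabla\rho^\gamma|^2}{\rho},\quad |\nabla\phi|^2\rho^\gamma,\quad \|\nabla^2\phi\|_{\mathrm{HS}}^2\rho^\gamma,\quad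 (L\phi)^2\rho^\gamma,\quad \mathrm{Ric}(L)(\nabla\phi,\nabla\phi)\rho^\gamma$$ is, on each compact time interval contained in $J$, bounded in absolute value by a $\mu$-integrable function of $x$ that does not depend on $t$. Put $$\mathcal H(t)=\frac{c^2}{2}\int_M|\nabla\phi|^2\rho\,d\mu-\frac1{\gamma-1}\int_M\rho^\gamma d\mu,\qquad \mathcal L(t)=\frac{c^2}{2}\int_M|\nabla\phi|^2\rho\,d\mu+\frac1{\gamma-1}\int_M\rho^\gamma d\mu.$$ Then all the integrals above and below converge, $\mathcal H$ is differentiable and $\mathcal L$ twice differentiable on $J$ (one-sidedly at endpoints belonging to $J$), and for every $t\in J$ $$\mathcal H'(t)=-\int_M|\nabla\phi|^2\rho\,d\mu,$$ $$\mathcal L''(t)=2\int_M c^{-2}\big|\nabla\phi-\gamma\rho^{\gamma-2}\nabla\rho\big|^2\rho\,d\mu+2\int_M\Big[\|\nabla^2\phi\|_{\mathrm{HS}}^2+\mathrm{Ric}(L)(\nabla\phi,\nabla\phi)+(\gamma-1)(L\phi)^2\Big]\rho^\gamma d\mu.$$ In particular $\mathcal H$ is nonincreasing on $J$, and if the CD$(0,\infty)$-condition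 $\mathrm{Ric}(L)\ge0$ holds, then $\mathcal L$ is convex on $J$. -/

import Mathlib

open MeasureTheory Set Bundle
open scoped Manifold ContDiff

noncomputable section

namespace LangevinRenyi

universe u

/-- A `C^∞` Riemannian metric on an `n`-dimensional smooth manifold without boundary. -/
abbrev SmoothMetric (n : ℕ) (M : Type u) [TopologicalSpace M]
    [ChartedSpace (EuclideanSpace ℝ (Fin n)) M] [IsManifold (𝓡 n) ∞ M] : Type u :=
  ContMDiffRiemannianMetric (𝓡 n) ∞ (EuclideanSpace ℝ (Fin n))
    (fun x : M => TangentSpace (𝓡 n) x)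

section Coordinates

variable {n : ℕ} {M : Type u} [TopologicalSpace M]
  [ChartedSpace (EuclideanSpace ℝ (Fin n)) M] [IsManifold (𝓡 n) ∞ M]

/-- The partial derivative `∂F/∂uⁱ` of a function of the coordinates. -/
def pd (i : Fin n) (F : EuclideanSpace ℝ (Fin n) → ℝ) (u : EuclideanSpace ℝ (Fin n)) : ℝ :=
  fderiv ℝ F u (EuclideanSpace.single i 1)

variable (M) in
/-- The coordinates of the point `x` in the chart at `x`. -/
def coord (x : M) : EuclideanSpace ℝ (Fin n) := extChartAt (𝓡 n) x x

/-- A function on `M`, written in the coordinates of the chart at `x`. -/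
def inChart (x : M) (h : M → ℝ) (u : EuclideanSpace ℝ (Fin n)) : ℝ :=
  h ((extChartAt (𝓡 n) x).symm u)

/-- The coordinate vector field `∂/∂uⁱ` of the chart at `x`, at the point with coordinates `u`. -/
def coordField (x : M) (i : Fin n) (u : EuclideanSpace ℝ (Fin n)) :
    TangentSpace (𝓡 n) ((extChartAt (𝓡 n) x).symm u) :=
  mfderiv 𝓘(ℝ, EuclideanSpace ℝ (Fin n)) (𝓡 n) (extChartAt (𝓡 n) x).symm u
    (EuclideanSpace.single i (1 : ℝ) : EuclideanSpace ℝ (Fin n))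

/-- The `i`-th component, in the chart at `x`, of a tangent vector `v` at the point `y`. -/
def component (x y : M) (v : TangentSpace (𝓡 n) y) (i : Fin n) : ℝ :=
  (mvfderiv (𝓡 n) (extChartAt (𝓡 n) x) y v) i

/-- The matrix `(g_{ij})` of the metric in the chart at `x`. -/
def metricMatrix (g : SmoothMetric n M) (x : M) (u : EuclideanSpace ℝ (Fin n)) :
    Matrix (Fin n) (Fin n) ℝ :=
  Matrix.of fun i j =>
    g.inner ((extChartAt (𝓡 n) x).symm u) (coordField x i u) (coordField x j u)

/-- The volume density `√det (g_{ij})` in the chart at `x`. -/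
def volDensity (g : SmoothMetric n M) (x : M) (u : EuclideanSpace ℝ (Fin n)) : ℝ :=
  Real.sqrt (metricMatrix g x u).det

/-- The Christoffel symbols `Γ^k_{ij}` of the Levi-Civita connection in the chart at `x`. -/
def christoffel (g : SmoothMetric n M) (x : M) (k i j : Fin n) (u : EuclideanSpace ℝ (Fin n)) : ℝ :=
  (1 / 2) * ∑ l, (metricMatrix g x u)⁻¹ k l *
    (pd i (fun w => metricMatrix g x w j l) u + pd j (fun w => metricMatrix g x w i l) u
      - pd l (fun w => metricMatrix g x w i j) u)

/-- The components `(∇²h)_{ij}` of the Hessian of `h` at `x`, in the chart at `x`. -/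
def hessianCoord (g : SmoothMetric n M) (h : M → ℝ) (x : M) (i j : Fin n) : ℝ :=
  pd i (fun u => pd j (inChart x h) u) (coord M x)
    - ∑ k, christoffel g x k i j (coord M x) * pd k (inChart x h) (coord M x)

/-- The components `Ric_{ij}` of the Ricci tensor at `x`, in the chart at `x`. -/
def ricciCoord (g : SmoothMetric n M) (x : M) (i j : Fin n) : ℝ :=
  (∑ k, pd k (christoffel g x k i j) (coord M x))
    - (∑ k, pd j (christoffel g x k i k) (coord M x))
    + ∑ k, ∑ l, (christoffel g x k k l (coord M x) * christoffel g x l i j (coord M x)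
        - christoffel g x k j l (coord M x) * christoffel g x l i k (coord M x))

end Coordinates

section Geometry

variable {n : ℕ} {M : Type u} [TopologicalSpace M]
  [ChartedSpace (EuclideanSpace ℝ (Fin n)) M] [IsManifold (𝓡 n) ∞ M]

/-- `|v|²` for the metric `g`. -/
def normSq (g : SmoothMetric n M) {x : M} (v : TangentSpace (𝓡 n) x) : ℝ := g.inner x v v

/-- The Riemannian gradient `∇h`: the vector that represents `dh` through the metric
(see `inner_grad`). -/
def grad (g : SmoothMetric n M) (h : M → ℝ) (x : M) : TangentSpace (𝓡 n) x :=
  (g.inner x).inverse (mvfderiv (𝓡 n) h x)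

/-- The defining property of the gradient. -/
theorem inner_grad (g : SmoothMetric n M) (h : M → ℝ) (x : M) (v : TangentSpace (𝓡 n) x) :
    g.inner x (grad g h x) v = mvfderiv (𝓡 n) h x v := by
  have : FiniteDimensional ℝ (TangentSpace (𝓡 n) x) :=
    inferInstanceAs (FiniteDimensional ℝ (EuclideanSpace ℝ (Fin n)))
  have : T2Space (TangentSpace (𝓡 n) x) := inferInstanceAs (T2Space (EuclideanSpace ℝ (Fin n)))
  have hinj : Function.Injective (g.inner x) := by
    rw [injective_iff_map_eq_zero]
    intro w hw
    by_contra h0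
    have := g.pos x w h0
    simp [hw] at this
  have hdim : Module.finrank ℝ (TangentSpace (𝓡 n) x)
      = Module.finrank ℝ (TangentSpace (𝓡 n) x →L[ℝ] ℝ) := by
    rw [← (LinearMap.toContinuousLinearMap (𝕜 := ℝ) (E := TangentSpace (𝓡 n) x)
      (F' := ℝ)).finrank_eq]
    exact Subspace.dual_finrank_eq.symm
  let e : TangentSpace (𝓡 n) x ≃ₗ[ℝ] (TangentSpace (𝓡 n) x →L[ℝ] ℝ) :=
    LinearEquiv.ofInjectiveOfFinrankEq (g.inner x : _ →ₗ[ℝ] _) hinj hdim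
  have hinv : (g.inner x).IsInvertible :=
    ⟨e.toContinuousLinearEquiv, by ext; rfl⟩
  unfold grad
  rw [hinv.self_apply_inverse]

/-- The squared Hilbert–Schmidt norm `‖∇²h‖²` of the Hessian at `x`. -/
def hessianHSSq (g : SmoothMetric n M) (h : M → ℝ) (x : M) : ℝ :=
  ∑ i, ∑ j, ∑ k, ∑ l, (metricMatrix g x (coord M x))⁻¹ i k *
    (metricMatrix g x (coord M x))⁻¹ j l * hessianCoord g h x i j * hessianCoord g h x k l

/-- The Bakry–Emery Ricci curvature `Ric(L)(v, v) = Ric(v, v) + ∇²f(v, v)`. -/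
def bakryEmery (g : SmoothMetric n M) (f : M → ℝ) (x : M) (v : TangentSpace (𝓡 n) x) : ℝ :=
  ∑ i, ∑ j, (ricciCoord g x i j + hessianCoord g f x i j) *
    component x x v i * component x x v j

/-- The condition CD`(0, ∞)`: `Ric(L) ≥ 0`. -/
def CDZeroInfty (g : SmoothMetric n M) (f : M → ℝ) : Prop :=
  ∀ (x : M) (v : TangentSpace (𝓡 n) x), 0 ≤ bakryEmery g f x v

/-- The Riemannian divergence `∇·X = (1/√det g) ∑ᵢ ∂ᵢ(√det g Xⁱ)`. -/
def divergence (g : SmoothMetric n M) (X : Π x : M, TangentSpace (𝓡 n) x) (x : M) : ℝ :=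
  (volDensity g x (coord M x))⁻¹ *
    ∑ i, pd i (fun u => volDensity g x u *
      component x ((extChartAt (𝓡 n) x).symm u) (X ((extChartAt (𝓡 n) x).symm u)) i) (coord M x)

/-- `∇_μ^* X = e^f ∇^*(e^{-f} X)`, where `∇^* = -∇·` and `dμ = e^{-f} dv`. -/
def nablaMuStar (g : SmoothMetric n M) (f : M → ℝ) (X : Π x : M, TangentSpace (𝓡 n) x) (x : M) : ℝ :=
  Real.exp (f x) * -divergence g (fun y => Real.exp (-f y) • X y) x

/-- The Witten Laplacian `L = -∇_μ^* ∇`. -/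
def wittenLaplacian (g : SmoothMetric n M) (f : M → ℝ) (h : M → ℝ) (x : M) : ℝ :=
  -nablaMuStar g f (grad g h) x

variable [MeasurableSpace M]

/-- The measure `√det (g_{ij}) du` on the domain of the chart at `x`. -/
def chartVolume (g : SmoothMetric n M) (x : M) : Measure M :=
  (((volume : Measure (EuclideanSpace ℝ (Fin n))).withDensity
    fun u => ENNReal.ofReal (volDensity g x u)).restrict (extChartAt (𝓡 n) x).target).map
      (extChartAt (𝓡 n) x).symm

open Classical in
/-- The Riemannian volume measure `dv = √det g dx`: cover `M` by the domains of a sequence of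
charts, make the domains disjoint, and add up the measures `√det g dx` of the pieces. (The result
does not depend on the sequence; a nonempty second countable manifold has such a sequence.) -/
def riemannianVolume (g : SmoothMetric n M) : Measure M :=
  if h : ∃ s : ℕ → M, ⋃ k, (extChartAt (𝓡 n) (s k)).source = univ then
    Measure.sum fun k => (chartVolume g (h.choose k)).restrict
      (disjointed (fun j => (extChartAt (𝓡 n) (h.choose j)).source) k)
  else 0

/-- The weighted volume measure `dμ = e^{-f} dv`. -/
def weightedMeasure (g : SmoothMetric n M) (f : M → ℝ) : Measure M :=
  (riemannianVolume g).withDensity fun x => ENNReal.ofReal (Real.exp (-f x))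

/-- The Hamiltonian `H(ρ, φ) = (c²/2) ∫ |∇φ|² ρ dμ - (1/(γ-1)) ∫ ρ^γ dμ`. -/
def hamiltonian (g : SmoothMetric n M) (f : M → ℝ) (c γ : ℝ) (ρ φ : M → ℝ) : ℝ :=
  c ^ 2 / 2 * ∫ x, normSq g (grad g φ x) * ρ x ∂(weightedMeasure g f)
    - 1 / (γ - 1) * ∫ x, ρ x ^ γ ∂(weightedMeasure g f)

/-- The Lagrangian `L(ρ, φ) = (c²/2) ∫ |∇φ|² ρ dμ + (1/(γ-1)) ∫ ρ^γ dμ`. -/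
def lagrangian (g : SmoothMetric n M) (f : M → ℝ) (c γ : ℝ) (ρ φ : M → ℝ) : ℝ :=
  c ^ 2 / 2 * ∫ x, normSq g (grad g φ x) * ρ x ∂(weightedMeasure g f)
    + 1 / (γ - 1) * ∫ x, ρ x ^ γ ∂(weightedMeasure g f)

end Geometry

section Solutions

variable {n : ℕ} {M : Type u} [TopologicalSpace M]
  [ChartedSpace (EuclideanSpace ℝ (Fin n)) M] [IsManifold (𝓡 n) ∞ M]

/-- `(ρ, φ)` is a smooth solution, on the time interval `J`, of the Langevin deformation with
potential `-Ent_γ`, the density `ρ` being positive. At an endpoint of `J` that belongs to `J`,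
smoothness and time derivatives are one-sided. -/
structure IsSmoothLangevinSolution (g : SmoothMetric n M) (f : M → ℝ) (c γ : ℝ) (J : Set ℝ)
    (ρ φ : ℝ → M → ℝ) : Prop where
  smooth_density : ContMDiffOn (𝓘(ℝ, ℝ).prod (𝓡 n)) 𝓘(ℝ, ℝ) ∞
    (fun p : ℝ × M => ρ p.1 p.2) (J ×ˢ univ)
  smooth_potential : ContMDiffOn (𝓘(ℝ, ℝ).prod (𝓡 n)) 𝓘(ℝ, ℝ) ∞
    (fun p : ℝ × M => φ p.1 p.2) (J ×ˢ univ)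
  density_pos : ∀ t ∈ J, ∀ x, 0 < ρ t x
  continuity_eq : ∀ t ∈ J, ∀ x,
    derivWithin (fun s => ρ s x) J t
      - nablaMuStar g f (fun y => ρ t y • grad g (φ t) y) x = 0
  hamilton_jacobi_eq : ∀ t ∈ J, ∀ x,
    c ^ 2 * (derivWithin (fun s => φ s x) J t + 1 / 2 * normSq g (grad g (φ t) x))
      = -φ t x + γ * ρ t x ^ (γ - 1) / (γ - 1)

/-- `(M, g)` is the Euclidean space `ℝⁿ`, up to an isometry. -/
def IsEuclidean (g : SmoothMetric n M) : Prop :=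
  ∃ Ψ : M ≃ₘ⟮𝓡 n, 𝓡 n⟯ (EuclideanSpace ℝ (Fin n)), ∀ (x : M) (v w : TangentSpace (𝓡 n) x),
    inner ℝ (mvfderiv (𝓡 n) Ψ x v) (mvfderiv (𝓡 n) Ψ x w) = g.inner x v w

variable [MeasurableSpace M]

/-- The functions `F t`, `t ∈ J`, are integrable, locally uniformly in time: on each compact
subinterval of `J` they have a common integrable bound. -/
def LocallyUniformlyIntegrable (μ : Measure M) (J : Set ℝ) (F : ℝ → M → ℝ) : Prop :=
  ∀ a ∈ J, ∀ b ∈ J, ∃ G : M → ℝ, Integrable G μ ∧ ∀ t ∈ Icc a b, ∀ x, |F t x| ≤ G x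

/-- The integrability (growth) condition at infinity, for a solution on a noncompact space. -/
structure GrowthCondition (g : SmoothMetric n M) (f : M → ℝ) (γ : ℝ) (J : Set ℝ)
    (ρ φ : ℝ → M → ℝ) : Prop where
  kinetic : LocallyUniformlyIntegrable (weightedMeasure g f) J
    fun t x => normSq g (grad g (φ t) x) * ρ t x
  kinetic_flux : LocallyUniformlyIntegrable (weightedMeasure g f) J
    fun t x => Real.sqrt (normSq g (grad g (φ t) x)) ^ 3 * ρ t x
  entropy : LocallyUniformlyIntegrable (weightedMeasure g f) J fun t x => ρ t x ^ γ
  entropy_sq : LocallyUniformlyIntegrable (weightedMeasure g f) J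
    fun t x => ρ t x ^ (2 * γ - 1)
  fisher : LocallyUniformlyIntegrable (weightedMeasure g f) J
    fun t x => normSq g (grad g (fun y => ρ t y ^ γ) x) / ρ t x
  gradient : LocallyUniformlyIntegrable (weightedMeasure g f) J
    fun t x => normSq g (grad g (φ t) x) * ρ t x ^ γ
  hessian : LocallyUniformlyIntegrable (weightedMeasure g f) J
    fun t x => hessianHSSq g (φ t) x * ρ t x ^ γ
  laplacian : LocallyUniformlyIntegrable (weightedMeasure g f) J
    fun t x => wittenLaplacian g f (φ t) x ^ 2 * ρ t x ^ γ
  curvature : LocallyUniformlyIntegrable (weightedMeasure g f) J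
    fun t x => bakryEmery g f x (grad g (φ t) x) * ρ t x ^ γ

end Solutions

end LangevinRenyi

end

open LangevinRenyi

/-! Write K = ∫|∇φ|²ρ dμ, E = ∫ρ^γ dμ, Q = ∫⟨∇ρ^γ, ∇φ⟩ dμ and F = ∫|∇ρ^γ|²/ρ dμ. The continuity
equation says ∂ₜρ = -(ρ Lφ + ⟨∇ρ, ∇φ⟩), a weighted divergence. Together with the Hamilton–Jacobi
equation it gives, pointwise up to divergences and hence exactly after integration, E' = (γ-1)Q and
K' = 2c⁻²(Q - K) (`hasDerivWithinAt_power`, `hasDerivWithinAt_kinetic`). In the Hamiltonian the two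
contributions of Q cancel and -K is left; in the Lagrangian they add up to the first derivative 2Q -
K.

The second derivative requires Q'. Integration by parts turns Q into -∫ρ^γ Lφ dμ (`integral_cross`).
Differentiating this brings in L∂ₜφ, which contains L(½|∇φ|²), and the Bochner formula L(½|∇φ|²) -
⟨∇φ, ∇Lφ⟩ = ‖∇²φ‖² + Ric(L)(∇φ, ∇φ) produces the curvature terms. Up to divergences
(`divTerm_decomposition`) this gives Q' = S - c⁻²Q + c⁻²F, where S = ∫[‖∇²φ‖² + Ric(L)(∇φ, ∇φ) +
(γ-1)(Lφ)²]ρ^γ dμ. Therefore 2Q' - K' = 2S + 2c⁻²(K - 2Q + F). Since ∇ρ^γ = ρ·γρ^(γ-2)∇ρ, the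
bracket K - 2Q + F is the integral of |∇φ - γρ^(γ-2)∇ρ|²ρ (`discrepancy_eq`). Every term is
nonnegative under CD(0, ∞), whence convexity.

Two points need care. The operators are defined at each point in the chart belonging to that point,
so differentiating or integrating them requires independence of the chart. For the volume this is
the change of variables formula. For L it follows by duality: against test functions, each chart
expression is represented by the chart-free integral -∫⟨∇η, ∇h⟩ dμ.

On ℝⁿ the divergences are discarded by cutoffs χ_k with |∇χ_k| ≤ ε_k → 0, the growth conditions
making the fluxes integrable. No integrable bound on the time derivatives of the integrands is
assumed. The cut-off integrals are therefore differentiated first, by compactness, and the limit k →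
∞ is taken in a mean value inequality that is uniform in time
(`hasDerivWithinAt_integral_of_cutoff`). On a compact manifold the same scheme runs with χ_k = 1. -/

noncomputable section

namespace LangevinRenyi

universe u

set_option linter.unusedSectionVars false

/-! ### Calculus of partial derivatives in coordinates. -/

section PartialDerivatives

open Topology

variable {n : ℕ} {U : Set (EuclideanSpace ℝ (Fin n))} {u : EuclideanSpace ℝ (Fin n)}
  {F K : EuclideanSpace ℝ (Fin n) → ℝ}

theorem pd_mul (i : Fin n) (hF : DifferentiableAt ℝ F u) (hK : DifferentiableAt ℝ K u) :
    pd i (fun v => F v * K v) u = pd i F u * K u + F u * pd i K u := by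
  simp only [pd]
  rw [fderiv_fun_mul hF hK]
  simp
  ring

theorem pd_add (i : Fin n) (hF : DifferentiableAt ℝ F u) (hK : DifferentiableAt ℝ K u) :
    pd i (fun v => F v + K v) u = pd i F u + pd i K u := by
  simp only [pd]
  rw [fderiv_fun_add hF hK]
  simp

theorem pd_sub (i : Fin n) (hF : DifferentiableAt ℝ F u) (hK : DifferentiableAt ℝ K u) :
    pd i (fun v => F v - K v) u = pd i F u - pd i K u := by
  simp only [pd]
  rw [fderiv_fun_sub hF hK]
  simp

theorem pd_const_mul (i : Fin n) (a : ℝ) (hF : DifferentiableAt ℝ F u) :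
    pd i (fun v => a * F v) u = a * pd i F u := by
  simp only [pd]
  rw [fderiv_const_mul hF]
  simp

theorem pd_sum {ι : Type*} (s : Finset ι) {A : ι → EuclideanSpace ℝ (Fin n) → ℝ} (i : Fin n)
    (hA : ∀ a ∈ s, DifferentiableAt ℝ (A a) u) :
    pd i (fun v => ∑ a ∈ s, A a v) u = ∑ a ∈ s, pd i (A a) u := by
  simp only [pd]
  rw [fderiv_fun_sum hA]
  simp

theorem pd_congr (i : Fin n) (hU : IsOpen U) (hu : u ∈ U) (h : ∀ v ∈ U, F v = K v) :
    pd i F u = pd i K u := by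
  simp only [pd]
  rw [Filter.EventuallyEq.fderiv_eq (Filter.eventuallyEq_of_mem (hU.mem_nhds hu) h)]

theorem contDiffOn_pd {k m : WithTop ℕ∞} (hU : IsOpen U) (hF : ContDiffOn ℝ k F U)
    (hm : m + 1 ≤ k) (i : Fin n) : ContDiffOn ℝ m (pd i F) U :=
  (hF.fderiv_of_isOpen hU hm).clm_apply contDiffOn_const

theorem _root_.ContDiffOn.diffAt {k : WithTop ℕ∞} (hF : ContDiffOn ℝ k F U) (hU : IsOpen U)
    (hk : k ≠ 0) (hu : u ∈ U) : DifferentiableAt ℝ F u :=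
  (hF.contDiffAt (hU.mem_nhds hu)).differentiableAt hk

theorem pd_comm (hU : IsOpen U) (hF : ContDiffOn ℝ 2 F U) (hu : u ∈ U) (i j : Fin n) :
    pd i (pd j F) u = pd j (pd i F) u := by
  have h1 : ContDiffAt ℝ 2 F u := hF.contDiffAt (hU.mem_nhds hu)
  have h2 : DifferentiableAt ℝ (fderiv ℝ F) u :=
    (h1.fderiv_right (m := 1) (by norm_num)).differentiableAt (by norm_num)
  have h3 : ∀ a b : Fin n, pd a (pd b F) u
      = fderiv ℝ (fderiv ℝ F) u (EuclideanSpace.single a 1) (EuclideanSpace.single b 1) := by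
    intro a b
    change fderiv ℝ (fun v => fderiv ℝ F v (EuclideanSpace.single b 1)) u _ = _
    rw [fderiv_clm_apply h2 (differentiableAt_const _)]
    simp
  rw [h3, h3]
  exact (h1.isSymmSndFDerivAt (by simp)) _ _

/-- Jacobi's formula for the partial derivatives of a determinant. -/
theorem pd_det {G : EuclideanSpace ℝ (Fin n) → Matrix (Fin n) (Fin n) ℝ}
    (hG : ∀ a b, DifferentiableAt ℝ (fun v => G v a b) u) (hdet : (G u).det ≠ 0) (i : Fin n) :
    pd i (fun v => (G v).det) u
      = (G u).det * ∑ a, ∑ b, (G u)⁻¹ a b * pd i (fun v => G v b a) u := by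
  have hp : ∀ σ : Equiv.Perm (Fin n),
      HasFDerivAt (fun v => ∏ j, G v (σ j) j)
        (∑ j, (∏ l ∈ Finset.univ.erase j, G u (σ l) l) • fderiv ℝ (fun v => G v (σ j) j) u) u :=
    fun σ => HasFDerivAt.finsetProd fun j _ => (hG (σ j) j).hasFDerivAt
  -- Differentiating the Leibniz expansion replaces one column at a time by its derivative; Cramer's
  -- rule then expresses each resulting determinant through the adjugate, that is, through `det G`
  -- times the inverse.
  have h1 : pd i (fun v => (G v).det) u = ∑ j, ((G u).updateCol j
      fun b => pd i (fun v => G v b j) u).det := by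
    have h2 : HasFDerivAt (fun v => (G v).det) (∑ σ : Equiv.Perm (Fin n),
        (Equiv.Perm.sign σ : ℤ) • (∑ j, (∏ l ∈ Finset.univ.erase j, G u (σ l) l) •
          fderiv ℝ (fun v => G v (σ j) j) u)) u := by
      simp only [Matrix.det_apply]
      exact HasFDerivAt.fun_sum fun σ _ => (hp σ).const_smul (Equiv.Perm.sign σ : ℤ)
    simp only [pd]
    rw [h2.fderiv]
    simp only [Matrix.det_apply, sum_apply, smul_apply,
      Finset.smul_sum]
    rw [Finset.sum_comm]
    refine Finset.sum_congr rfl fun j _ => Finset.sum_congr rfl fun σ _ => ?_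
    rw [← Finset.mul_prod_erase _ _ (Finset.mem_univ j)]
    rw [Matrix.updateCol_self]
    have : ∏ l ∈ Finset.univ.erase j, (G u).updateCol j
        (fun b => (fderiv ℝ (fun v => G v b j) u) (EuclideanSpace.single i 1)) (σ l) l
        = ∏ l ∈ Finset.univ.erase j, G u (σ l) l :=
      Finset.prod_congr rfl fun l hl => Matrix.updateCol_ne (Finset.ne_of_mem_erase hl)
    rw [this, smul_eq_mul, mul_comm]
    rfl
  rw [h1, Finset.mul_sum]
  refine Finset.sum_congr rfl fun j _ => ?_
  have h3 : ((G u).updateCol j fun b => pd i (fun v => G v b j) u).det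
      = ((G u).adjugate.mulVec fun b => pd i (fun v => G v b j) u) j := by
    rw [← Matrix.cramer_eq_adjugate_mulVec, Matrix.cramer_apply]
  rw [h3, Matrix.mulVec, dotProduct, Finset.mul_sum]
  refine Finset.sum_congr rfl fun b _ => ?_
  rw [Matrix.inv_def, Matrix.smul_apply, Ring.inverse_eq_inv', smul_eq_mul]
  field_simp

end PartialDerivatives

/-! ### The algebra of the Bochner formula. -/

section BochnerAlgebra

variable {n : ℕ}

theorem sum_comm_inner (F : Fin n → Fin n → Fin n → ℝ) :
    ∑ i, ∑ k, ∑ l, F i k l = ∑ k, ∑ l, ∑ i, F i k l := by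
  rw [Finset.sum_comm]
  exact Finset.sum_congr rfl fun k _ => Finset.sum_comm

theorem sum_comm_inner₄ (F : Fin n → Fin n → Fin n → Fin n → ℝ) :
    ∑ i, ∑ k, ∑ l, ∑ j, F i k l j = ∑ k, ∑ l, ∑ j, ∑ i, F i k l j := by
  rw [Finset.sum_comm]
  exact Finset.sum_congr rfl fun k _ => sum_comm_inner _

theorem sum_comm_inner₆ (F : Fin n → Fin n → Fin n → Fin n → Fin n → Fin n → ℝ) :
    ∑ i, ∑ j, ∑ k, ∑ l, ∑ a, ∑ b, F i j k l a b
      = ∑ a, ∑ b, ∑ i, ∑ j, ∑ k, ∑ l, F i j k l a b := by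
  have e1 : ∀ i j k, ∑ l, ∑ a, ∑ b, F i j k l a b = ∑ a, ∑ b, ∑ l, F i j k l a b :=
    fun _ _ _ => sum_comm_inner _
  have e2 : ∀ i j, ∑ k, ∑ a, ∑ b, ∑ l, F i j k l a b = ∑ a, ∑ b, ∑ k, ∑ l, F i j k l a b :=
    fun _ _ => sum_comm_inner _
  have e3 : ∀ i, ∑ j, ∑ a, ∑ b, ∑ k, ∑ l, F i j k l a b
      = ∑ a, ∑ b, ∑ j, ∑ k, ∑ l, F i j k l a b := fun _ => sum_comm_inner _
  simp only [e1, e2, e3]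
  exact sum_comm_inner _

/-- The finite-sum identity behind the Bochner formula for a torsion-free connection `Γ` and a
vector field with components `x`, first derivatives `dx` and second derivatives `ddx`. -/
theorem bochner_sum_identity (x p : Fin n → ℝ) (dx pp : Fin n → Fin n → ℝ)
    (ddx Γ : Fin n → Fin n → Fin n → ℝ) (dΓ : Fin n → Fin n → Fin n → Fin n → ℝ)
    (hΓ : ∀ i k l, Γ i k l = Γ i l k) (hddx : ∀ i k j, ddx i k j = ddx k i j) :
    (∑ i, ∑ k, ((ddx i k i + ∑ l, (dΓ i i k l * x l + Γ i k l * dx i l)) * x k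
        + (dx k i + ∑ l, Γ i k l * x l) * dx i k)
      + ∑ i, ((∑ j, Γ j i j) - p i) * ∑ k, (dx k i + ∑ l, Γ i k l * x l) * x k)
      - ∑ k, x k * (∑ i, ddx k i i + ∑ i, (((∑ j, dΓ k j i j) - pp k i) * x i
          + ((∑ j, Γ j i j) - p i) * dx k i))
    = ∑ i, ∑ k, (dx k i + ∑ l, Γ i k l * x l) * (dx i k + ∑ m, Γ k i m * x m)
      + ∑ i, ∑ j, (((∑ k, dΓ k k i j) - (∑ k, dΓ j k i k)
          + ∑ k, ∑ l, (Γ k k l * Γ l i j - Γ k j l * Γ l i k))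
          + (pp j i - ∑ k, Γ k i j * p k)) * x i * x j := by
  simp only [add_mul, mul_add, sub_mul, mul_sub, Finset.sum_add_distrib, Finset.sum_sub_distrib,
    Finset.sum_mul, Finset.mul_sum]
  -- The terms of the expanded identity are matched in groups: `e1`, `e6` and `e7` cancel the second
  -- derivatives of `x` and the first-order terms in the drift; `e3` supplies a mixed term of the
  -- squared covariant derivative; `e2`, `e4`, `e9` and `e10` assemble the Ricci tensor; `e5` and
  -- `e8` the Hessian of the weight.
  have e1 : ∑ i, ∑ k, ddx i k i * x k = ∑ k, ∑ i, x k * ddx k i i := by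
    rw [Finset.sum_comm]
    refine Finset.sum_congr rfl fun k _ => Finset.sum_congr rfl fun i _ => ?_
    rw [hddx, mul_comm]
  have e2 : ∑ i, ∑ k, ∑ l, dΓ i i k l * x l * x k = ∑ i, ∑ j, ∑ k, dΓ k k i j * x i * x j := by
    rw [Finset.sum_comm]
    refine Finset.sum_congr rfl fun k _ => ?_
    rw [Finset.sum_comm]
    refine Finset.sum_congr rfl fun l _ => Finset.sum_congr rfl fun i _ => ?_
    ring
  have e3 : ∑ i, ∑ k, ∑ l, Γ i k l * dx i l * x k
      = ∑ i, ∑ k, ∑ m, dx k i * (Γ k i m * x m) := by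
    rw [← sum_comm_inner]
    refine Finset.sum_congr rfl fun i _ => Finset.sum_congr rfl fun k _ =>
      Finset.sum_congr rfl fun m _ => ?_
    rw [hΓ k m i]
    ring
  have e4 : ∑ k, ∑ i, ∑ j, x k * (dΓ k j i j * x i) = ∑ i, ∑ j, ∑ k, dΓ j k i k * x i * x j := by
    rw [Finset.sum_comm]
    refine Finset.sum_congr rfl fun i _ => Finset.sum_congr rfl fun k _ =>
      Finset.sum_congr rfl fun j _ => ?_
    ring
  have e5 : ∑ k, ∑ i, x k * (pp k i * x i) = ∑ i, ∑ j, pp j i * x i * x j := by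
    rw [Finset.sum_comm]
    refine Finset.sum_congr rfl fun i _ => Finset.sum_congr rfl fun k _ => ?_
    ring
  have e6 : ∑ i, ∑ k, ∑ j, Γ j i j * (dx k i * x k) = ∑ k, ∑ i, ∑ j, x k * (Γ j i j * dx k i) := by
    rw [Finset.sum_comm]
    refine Finset.sum_congr rfl fun i _ => Finset.sum_congr rfl fun k _ =>
      Finset.sum_congr rfl fun j _ => ?_
    ring
  have e7 : ∑ i, ∑ k, p i * (dx k i * x k) = ∑ k, ∑ i, x k * (p i * dx k i) := by
    rw [Finset.sum_comm]
    refine Finset.sum_congr rfl fun i _ => Finset.sum_congr rfl fun k _ => ?_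
    ring
  have e8 : ∑ i, ∑ k, ∑ l, p i * (Γ i k l * x l * x k)
      = ∑ i, ∑ j, ∑ k, Γ k i j * p k * x i * x j := by
    rw [Finset.sum_comm]
    refine Finset.sum_congr rfl fun k _ => ?_
    rw [Finset.sum_comm]
    refine Finset.sum_congr rfl fun l _ => Finset.sum_congr rfl fun i _ => ?_
    ring
  have e9 : ∑ i, ∑ k, ∑ l, ∑ j, Γ j i j * (Γ i k l * x l * x k)
      = ∑ i, ∑ j, ∑ k, ∑ l, Γ k k l * Γ l i j * x i * x j := by
    rw [sum_comm_inner₄]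
    refine Finset.sum_congr rfl fun k _ => Finset.sum_congr rfl fun l _ =>
      Finset.sum_congr rfl fun j _ => Finset.sum_congr rfl fun i _ => ?_
    rw [hΓ j i j]
    ring
  have e10 : ∑ i, ∑ k, ∑ m, ∑ l, Γ i k l * x l * (Γ k i m * x m)
      = ∑ i, ∑ j, ∑ k, ∑ l, Γ k j l * Γ l i k * x i * x j := by
    rw [sum_comm_inner₄, sum_comm_inner₄]
    refine Finset.sum_congr rfl fun m _ => Finset.sum_congr rfl fun l _ =>
      Finset.sum_congr rfl fun i _ => Finset.sum_congr rfl fun k _ => ?_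
    rw [hΓ i l k, hΓ k m i]
    ring
  rw [e1, e2, e3, e4, e5, e6, e7, e8, e9, e10]
  ring

end BochnerAlgebra

/-! ### Riemannian geometry of a metric matrix on an open set. -/

section CoordinateMetric

variable {n : ℕ}

/-- `G` is the matrix of a smooth Riemannian metric on the open set `U` of coordinates. -/
structure IsMetricOn (G : EuclideanSpace ℝ (Fin n) → Matrix (Fin n) (Fin n) ℝ)
    (U : Set (EuclideanSpace ℝ (Fin n))) : Prop where
  isOpen : IsOpen U
  smooth : ∀ i j, ContDiffOn ℝ ∞ (fun v => G v i j) U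
  posDef : ∀ v ∈ U, (G v).PosDef

/-- The Christoffel symbols of a matrix-valued function. -/
def christoffelOf (G : EuclideanSpace ℝ (Fin n) → Matrix (Fin n) (Fin n) ℝ) (k i j : Fin n)
    (u : EuclideanSpace ℝ (Fin n)) : ℝ :=
  (1 / 2) * ∑ l, (G u)⁻¹ k l *
    (pd i (fun w => G w j l) u + pd j (fun w => G w i l) u - pd l (fun w => G w i j) u)

/-- The components of the gradient in coordinates. -/
def gradOf (G : EuclideanSpace ℝ (Fin n) → Matrix (Fin n) (Fin n) ℝ)
    (h : EuclideanSpace ℝ (Fin n) → ℝ) (i : Fin n) (v : EuclideanSpace ℝ (Fin n)) : ℝ :=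
  ∑ j, (G v)⁻¹ i j * pd j h v

/-- The inner product of two gradients in coordinates. -/
def carreOf (G : EuclideanSpace ℝ (Fin n) → Matrix (Fin n) (Fin n) ℝ)
    (h k : EuclideanSpace ℝ (Fin n) → ℝ) (v : EuclideanSpace ℝ (Fin n)) : ℝ :=
  ∑ i, gradOf G h i v * pd i k v

/-- The components of the Hessian in coordinates. -/
def hessOf (G : EuclideanSpace ℝ (Fin n) → Matrix (Fin n) (Fin n) ℝ)
    (h : EuclideanSpace ℝ (Fin n) → ℝ) (i j : Fin n) (u : EuclideanSpace ℝ (Fin n)) : ℝ :=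
  pd i (fun v => pd j h v) u - ∑ k, christoffelOf G k i j u * pd k h u

/-- The components of the Ricci tensor in coordinates. -/
def ricciOf (G : EuclideanSpace ℝ (Fin n) → Matrix (Fin n) (Fin n) ℝ) (i j : Fin n)
    (u : EuclideanSpace ℝ (Fin n)) : ℝ :=
  (∑ k, pd k (christoffelOf G k i j) u) - (∑ k, pd j (christoffelOf G k i k) u)
    + ∑ k, ∑ l, (christoffelOf G k k l u * christoffelOf G l i j u
        - christoffelOf G k j l u * christoffelOf G l i k u)

/-- The density of the weighted volume in coordinates. -/
def densOf (G : EuclideanSpace ℝ (Fin n) → Matrix (Fin n) (Fin n) ℝ)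
    (ψ : EuclideanSpace ℝ (Fin n) → ℝ) (v : EuclideanSpace ℝ (Fin n)) : ℝ :=
  Real.sqrt (G v).det * Real.exp (-ψ v)

/-- The divergence with respect to the density `W`. -/
def divOf (W : EuclideanSpace ℝ (Fin n) → ℝ) (Y : Fin n → EuclideanSpace ℝ (Fin n) → ℝ)
    (u : EuclideanSpace ℝ (Fin n)) : ℝ :=
  (W u)⁻¹ * ∑ i, pd i (fun v => W v * Y i v) u

/-- The weighted Laplacian in coordinates. -/
def lapOf (G : EuclideanSpace ℝ (Fin n) → Matrix (Fin n) (Fin n) ℝ)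
    (ψ h : EuclideanSpace ℝ (Fin n) → ℝ) : EuclideanSpace ℝ (Fin n) → ℝ :=
  divOf (densOf G ψ) (gradOf G h)

theorem contDiffOn_det {k : WithTop ℕ∞}
    {G : EuclideanSpace ℝ (Fin n) → Matrix (Fin n) (Fin n) ℝ} {U : Set (EuclideanSpace ℝ (Fin n))}
    (hG : ∀ i j, ContDiffOn ℝ k (fun v => G v i j) U) :
    ContDiffOn ℝ k (fun v => (G v).det) U := by
  simp only [Matrix.det_apply]
  refine ContDiffOn.sum fun σ _ => ?_
  have : ContDiffOn ℝ k (fun v => ∏ i, G v (σ i) i) U := contDiffOn_prod fun i _ => hG _ _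
  exact (contDiffOn_const (c := (((Equiv.Perm.sign σ : ℤˣ) : ℤ) : ℝ))).mul this |>.congr
    fun v _ => by simp [Units.smul_def]

namespace IsMetricOn

variable {G : EuclideanSpace ℝ (Fin n) → Matrix (Fin n) (Fin n) ℝ}
  {U : Set (EuclideanSpace ℝ (Fin n))} {u : EuclideanSpace ℝ (Fin n)}
  {h ψ : EuclideanSpace ℝ (Fin n) → ℝ}

theorem symm (hG : IsMetricOn G U) (hu : u ∈ U) (i j : Fin n) : G u i j = G u j i := by
  have := (hG.posDef u hu).isHermitian.apply i j
  simpa using this.symm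

theorem symm_inv (hG : IsMetricOn G U) (hu : u ∈ U) (i j : Fin n) :
    (G u)⁻¹ i j = (G u)⁻¹ j i := by
  have := (hG.posDef u hu).isHermitian.inv.apply i j
  simpa using this.symm

theorem det_pos (hG : IsMetricOn G U) (hu : u ∈ U) : 0 < (G u).det := (hG.posDef u hu).det_pos

theorem mul_inv (hG : IsMetricOn G U) (hu : u ∈ U) : G u * (G u)⁻¹ = 1 :=
  Matrix.mul_nonsing_inv _ (isUnit_iff_ne_zero.2 (hG.det_pos hu).ne')

theorem inv_mul (hG : IsMetricOn G U) (hu : u ∈ U) : (G u)⁻¹ * G u = 1 :=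
  Matrix.nonsing_inv_mul _ (isUnit_iff_ne_zero.2 (hG.det_pos hu).ne')

/-- By Cramer's rule an entry of the inverse is a determinant with smooth entries divided by the
nonvanishing `det G`. -/
theorem contDiffOn_inv (hG : IsMetricOn G U) (i j : Fin n) :
    ContDiffOn ℝ ∞ (fun v => (G v)⁻¹ i j) U := by
  have h1 : ContDiffOn ℝ ∞ (fun v => (G v).adjugate i j) U := by
    simp only [Matrix.adjugate_apply]
    refine contDiffOn_det fun a b => ?_
    by_cases hab : a = j
    · subst hab
      simpa using contDiffOn_const
    · simpa [Matrix.updateRow_apply, hab] using hG.smooth a b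
  refine (((contDiffOn_det hG.smooth).inv fun v hv => (hG.det_pos hv).ne').mul h1).congr ?_
  intro v _
  rw [Matrix.inv_def, Matrix.smul_apply, Ring.inverse_eq_inv', smul_eq_mul]
  rfl

theorem contDiffOn_sqrt_det (hG : IsMetricOn G U) :
    ContDiffOn ℝ ∞ (fun v => Real.sqrt (G v).det) U :=
  (contDiffOn_det hG.smooth).sqrt fun _ hv => (hG.det_pos hv).ne'

theorem contDiffOn_dens {k : WithTop ℕ∞} (hG : IsMetricOn G U) (hk : k ≤ ∞)
    (hψ : ContDiffOn ℝ k ψ U) : ContDiffOn ℝ k (densOf G ψ) U :=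
  (hG.contDiffOn_sqrt_det.of_le hk).mul hψ.neg.exp

theorem dens_pos (hG : IsMetricOn G U) (hu : u ∈ U) : 0 < densOf G ψ u :=
  mul_pos (Real.sqrt_pos.2 (hG.det_pos hu)) (Real.exp_pos _)

theorem contDiffOn_grad {k m : WithTop ℕ∞} (hG : IsMetricOn G U) (hh : ContDiffOn ℝ k h U)
    (hm : m + 1 ≤ k) (hm' : m ≤ ∞) (i : Fin n) : ContDiffOn ℝ m (gradOf G h i) U :=
  ContDiffOn.sum fun j _ => ((hG.contDiffOn_inv i j).of_le hm').mul
    (contDiffOn_pd hG.isOpen hh hm j)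

theorem contDiffOn_carre {k m : WithTop ℕ∞} {l : EuclideanSpace ℝ (Fin n) → ℝ}
    (hG : IsMetricOn G U) (hh : ContDiffOn ℝ k h U) (hl : ContDiffOn ℝ k l U)
    (hm : m + 1 ≤ k) (hm' : m ≤ ∞) : ContDiffOn ℝ m (carreOf G h l) U :=
  ContDiffOn.sum fun i _ => (hG.contDiffOn_grad hh hm hm' i).mul (contDiffOn_pd hG.isOpen hl hm i)

theorem contDiffOn_christoffel (hG : IsMetricOn G U) (k i j : Fin n) :
    ContDiffOn ℝ ∞ (christoffelOf G k i j) U :=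
  contDiffOn_const.mul (ContDiffOn.sum fun l _ => (hG.contDiffOn_inv k l).mul
    (((contDiffOn_pd hG.isOpen (hG.smooth j l) (by simp) i).add
      (contDiffOn_pd hG.isOpen (hG.smooth i l) (by simp) j)).sub
      (contDiffOn_pd hG.isOpen (hG.smooth i j) (by simp) l)))

theorem pd_symm (hG : IsMetricOn G U) (hu : u ∈ U) (m i j : Fin n) :
    pd m (fun w => G w i j) u = pd m (fun w => G w j i) u :=
  pd_congr m hG.isOpen hu fun _ hv => hG.symm hv i j

theorem christoffel_symm (hG : IsMetricOn G U) (hu : u ∈ U) (k i j : Fin n) :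
    christoffelOf G k i j u = christoffelOf G k j i u := by
  unfold christoffelOf
  congr 1
  refine Finset.sum_congr rfl fun l _ => ?_
  rw [hG.pd_symm hu l i j]
  ring

theorem sum_mul_sum_inv (hG : IsMetricOn G U) (hu : u ∈ U) (m : Fin n) (y : Fin n → ℝ) :
    ∑ k, G u m k * ∑ l, (G u)⁻¹ k l * y l = y m := by
  have : (G u).mulVec ((G u)⁻¹.mulVec y) = y := by
    rw [Matrix.mulVec_mulVec, hG.mul_inv hu, Matrix.one_mulVec]
  simpa [Matrix.mulVec, dotProduct] using congrFun this m

theorem sum_inv_mul_sum (hG : IsMetricOn G U) (hu : u ∈ U) (m : Fin n) (y : Fin n → ℝ) :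
    ∑ k, (G u)⁻¹ m k * ∑ l, G u k l * y l = y m := by
  have : (G u)⁻¹.mulVec ((G u).mulVec y) = y := by
    rw [Matrix.mulVec_mulVec, hG.inv_mul hu, Matrix.one_mulVec]
  simpa [Matrix.mulVec, dotProduct] using congrFun this m

/-- The Christoffel symbols with the first index lowered. -/
theorem sum_metric_mul_christoffel (hG : IsMetricOn G U) (hu : u ∈ U) (m i j : Fin n) :
    ∑ k, G u m k * christoffelOf G k i j u = (1 / 2) * (pd i (fun w => G w j m) u
      + pd j (fun w => G w i m) u - pd m (fun w => G w i j) u) := by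
  rw [← hG.sum_mul_sum_inv hu m fun m => pd i (fun w => G w j m) u
      + pd j (fun w => G w i m) u - pd m (fun w => G w i j) u, Finset.mul_sum]
  refine Finset.sum_congr rfl fun k _ => ?_
  unfold christoffelOf
  ring

theorem sum_metric_mul_grad (hG : IsMetricOn G U) (hu : u ∈ U) (i : Fin n) :
    ∑ j, G u i j * gradOf G h j u = pd i h u :=
  hG.sum_mul_sum_inv hu i fun j => pd j h u

/-- The trace of the Christoffel symbols is the logarithmic derivative of `√det G`. -/
theorem pd_dens (hG : IsMetricOn G U) (hu : u ∈ U) (hψ : DifferentiableAt ℝ ψ u) (i : Fin n) :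
    pd i (densOf G ψ) u
      = densOf G ψ u * ((∑ j, christoffelOf G j i j u) - pd i ψ u) := by
  have hdet : DifferentiableAt ℝ (fun v => (G v).det) u :=
    (contDiffOn_det hG.smooth).diffAt hG.isOpen (by simp) hu
  have h1 : ∑ j, christoffelOf G j i j u
      = (1 / 2) * ∑ a, ∑ b, (G u)⁻¹ a b * pd i (fun v => G v b a) u := by
    -- In the trace of the Christoffel symbols two of the three derivatives of the metric cancel,
    -- because the inverse matrix is symmetric. What remains is the expression in Jacobi's formula.
    have h2 : ∑ a, ∑ b, (G u)⁻¹ a b * pd a (fun w => G w i b) u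
        = ∑ a, ∑ b, (G u)⁻¹ a b * pd b (fun w => G w i a) u := by
      rw [Finset.sum_comm]
      refine Finset.sum_congr rfl fun a _ => Finset.sum_congr rfl fun b _ => ?_
      rw [hG.symm_inv hu]
    simp only [christoffelOf, ← Finset.mul_sum, mul_sub, mul_add, Finset.sum_add_distrib,
      Finset.sum_sub_distrib]
    rw [h2, add_sub_cancel_right]
    congr 1
    refine Finset.sum_congr rfl fun a _ => Finset.sum_congr rfl fun b _ => ?_
    rw [hG.pd_symm hu]
  have h3 : pd i (fun v => Real.sqrt (G v).det) u
      = Real.sqrt (G u).det * ∑ j, christoffelOf G j i j u := by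
    have h4 : pd i (fun v => Real.sqrt (G v).det) u
        = (1 / (2 * Real.sqrt (G u).det)) * pd i (fun v => (G v).det) u := by
      simp only [pd]
      rw [fderiv_sqrt hdet (hG.det_pos hu).ne']
      simp
    rw [h4, pd_det (fun a b => (hG.smooth a b).diffAt hG.isOpen (by simp) hu)
      (hG.det_pos hu).ne', h1]
    have h5 := Real.mul_self_sqrt (hG.det_pos hu).le
    have h6 := (Real.sqrt_pos.2 (hG.det_pos hu)).ne'
    field_simp
    rw [sq, h5]
  have h7 : pd i (fun v => Real.exp (-ψ v)) u = Real.exp (-ψ u) * (-pd i ψ u) := by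
    simp only [pd]
    rw [fderiv_exp hψ.fun_neg, fderiv_fun_neg]
    simp
  unfold densOf
  rw [pd_mul i (hG.contDiffOn_sqrt_det.diffAt hG.isOpen (by simp) hu) hψ.fun_neg.exp, h3, h7]
  ring

/-- By `pd_dens`, the logarithmic derivative of the density is a trace of Christoffel symbols minus
`∂ψ`. The determinant disappears, and in this form the divergence can be differentiated once more.
-/
theorem divOf_eq (hG : IsMetricOn G U) (hu : u ∈ U) (hψ : ContDiffOn ℝ 1 ψ U)
    {Y : Fin n → EuclideanSpace ℝ (Fin n) → ℝ} (hY : ∀ i, DifferentiableAt ℝ (Y i) u) :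
    divOf (densOf G ψ) Y u
      = ∑ i, pd i (Y i) u + ∑ i, ((∑ j, christoffelOf G j i j u) - pd i ψ u) * Y i u := by
  have hW := hG.dens_pos (ψ := ψ) hu
  unfold divOf
  rw [Finset.mul_sum, ← Finset.sum_add_distrib]
  refine Finset.sum_congr rfl fun i _ => ?_
  rw [pd_mul i ((hG.contDiffOn_dens (by simp) hψ).diffAt hG.isOpen (by simp) hu) (hY i),
    hG.pd_dens hu (hψ.diffAt hG.isOpen (by simp) hu)]
  field_simp
  ring

/-- The second derivatives of a function in terms of its gradient. -/
theorem pd_pd_eq (hG : IsMetricOn G U) (hu : u ∈ U) (hh : ContDiffOn ℝ 2 h U) (l i : Fin n) :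
    pd l (pd i h) u = ∑ j, (pd l (fun w => G w i j) u * gradOf G h j u
      + G u i j * pd l (gradOf G h j) u) := by
  have hX : ∀ j, DifferentiableAt ℝ (gradOf G h j) u := fun j =>
    (hG.contDiffOn_grad (m := 1) hh (by norm_num) (by simp) j).diffAt hG.isOpen (by simp) hu
  have hg : ∀ a b, DifferentiableAt ℝ (fun v => G v a b) u := fun a b =>
    (hG.smooth a b).diffAt hG.isOpen (by simp) hu
  rw [pd_congr (K := fun v => ∑ j, G v i j * gradOf G h j v) l hG.isOpen hu
    fun v hv => (hG.sum_metric_mul_grad hv i).symm,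
    pd_sum (A := fun j v => G v i j * gradOf G h j v) _ _ fun j _ => (hg i j).mul (hX j)]
  exact Finset.sum_congr rfl fun j _ => pd_mul _ (hg i j) (hX j)

/-- The covariant derivative `∇_k X^i` of the gradient field `X` of `h`. -/
def covGrad (G : EuclideanSpace ℝ (Fin n) → Matrix (Fin n) (Fin n) ℝ)
    (h : EuclideanSpace ℝ (Fin n) → ℝ) (i k : Fin n) (u : EuclideanSpace ℝ (Fin n)) : ℝ :=
  pd k (gradOf G h i) u + ∑ l, christoffelOf G i k l u * gradOf G h l u

/-- The Hessian is the covariant derivative of the gradient field with its upper index lowered. Both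
sides are expressed by `X`, `∂X` and `∂G`; the terms in `∂G` agree once the index of the Christoffel
symbols is lowered. -/
theorem hess_eq (hG : IsMetricOn G U) (hu : u ∈ U) (hh : ContDiffOn ℝ 2 h U) (i j : Fin n) :
    hessOf G h i j u = ∑ k, G u j k * covGrad G h k i u := by
  unfold hessOf covGrad
  rw [hG.pd_pd_eq hu hh]
  have h1 : ∑ k, christoffelOf G k i j u * pd k h u
      = ∑ l, (1 / 2) * (pd i (fun w => G w j l) u
      + pd j (fun w => G w i l) u - pd l (fun w => G w i j) u) * gradOf G h l u := by
    have : ∀ k, christoffelOf G k i j u * pd k h u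
        = ∑ l, G u l k * christoffelOf G k i j u * gradOf G h l u := by
      intro k
      rw [← hG.sum_metric_mul_grad hu k, Finset.mul_sum]
      refine Finset.sum_congr rfl fun l _ => ?_
      rw [hG.symm hu k l]
      ring
    simp only [this]
    rw [Finset.sum_comm]
    refine Finset.sum_congr rfl fun l _ => ?_
    rw [← Finset.sum_mul, hG.sum_metric_mul_christoffel hu]
  have h2 : ∑ k, G u j k * ∑ l, christoffelOf G k i l u * gradOf G h l u
      = ∑ l, (1 / 2) * (pd i (fun w => G w l j) u
      + pd l (fun w => G w i j) u - pd j (fun w => G w i l) u) * gradOf G h l u := by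
    simp only [Finset.mul_sum, ← mul_assoc]
    rw [Finset.sum_comm]
    refine Finset.sum_congr rfl fun l _ => ?_
    rw [← Finset.sum_mul, hG.sum_metric_mul_christoffel hu]
  simp only [mul_add, Finset.sum_add_distrib]
  rw [h1, h2]
  rw [add_sub_right_comm, add_comm, ← Finset.sum_sub_distrib]
  congr 1
  refine Finset.sum_congr rfl fun l _ => ?_
  rw [hG.pd_symm hu i l j]
  ring

theorem hess_symm (hG : IsMetricOn G U) (hu : u ∈ U) (hh : ContDiffOn ℝ 2 h U) (i j : Fin n) :
    hessOf G h i j u = hessOf G h j i u := by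
  unfold hessOf
  rw [show pd i (fun v => pd j h v) u = pd j (fun v => pd i h v) u from pd_comm hG.isOpen hh hu i j]
  congr 1
  exact Finset.sum_congr rfl fun k _ => by rw [hG.christoffel_symm hu]

/-- Raising an index of the Hessian gives the endomorphism `∇X` (`h1`), so the double contraction is
the trace of its square. This is the shape in which the Bochner computation produces it. -/
theorem hess_sq_eq (hG : IsMetricOn G U) (hu : u ∈ U) (hh : ContDiffOn ℝ 2 h U) :
    ∑ i, ∑ j, ∑ k, ∑ l, (G u)⁻¹ i k * (G u)⁻¹ j l * hessOf G h i j u * hessOf G h k l u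
      = ∑ i, ∑ k, covGrad G h i k u * covGrad G h k i u := by
  have h1 : ∀ a b, ∑ k, (G u)⁻¹ a k * hessOf G h k b u = covGrad G h a b u := by
    intro a b
    rw [← hG.sum_inv_mul_sum hu a fun c => covGrad G h c b u]
    exact Finset.sum_congr rfl fun k _ => by rw [hG.hess_symm hu hh, hG.hess_eq hu hh]
  refine Finset.sum_congr rfl fun i _ => ?_
  have h2 : ∀ j, ∑ k, ∑ l, (G u)⁻¹ i k * (G u)⁻¹ j l * hessOf G h i j u * hessOf G h k l u
      = ∑ l, covGrad G h i l u * ((G u)⁻¹ l j * hessOf G h j i u) := by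
    intro j
    rw [Finset.sum_comm]
    refine Finset.sum_congr rfl fun l _ => ?_
    rw [← h1 i l, Finset.sum_mul, hG.symm_inv hu l j, hG.hess_symm hu hh j i]
    exact Finset.sum_congr rfl fun k _ => by ring
  simp only [h2]
  rw [Finset.sum_comm]
  refine Finset.sum_congr rfl fun l _ => ?_
  rw [← Finset.mul_sum, h1]

/-- The Hessian gives the derivative of the squared norm of the gradient. -/
theorem pd_half_carre (hG : IsMetricOn G U) (hu : u ∈ U) (hh : ContDiffOn ℝ 2 h U) (m : Fin n) :
    pd m (fun v => 1 / 2 * carreOf G h h v) u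
      = ∑ i, G u m i * ∑ k, covGrad G h i k u * gradOf G h k u := by
  have hX : ∀ j, DifferentiableAt ℝ (gradOf G h j) u := fun j =>
    (hG.contDiffOn_grad (m := 1) hh (by norm_num) (by simp) j).diffAt hG.isOpen (by simp) hu
  have hp : ∀ j, DifferentiableAt ℝ (pd j h) u := fun j =>
    (contDiffOn_pd (m := 1) hG.isOpen hh (by norm_num) j).diffAt hG.isOpen (by simp) hu
  have h1 : pd m (fun v => 1 / 2 * carreOf G h h v) u
      = 1 / 2 * ∑ i, (pd m (gradOf G h i) u * pd i h u + gradOf G h i u * pd m (pd i h) u) := by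
    unfold carreOf
    rw [pd_const_mul _ _ (by
      exact DifferentiableAt.fun_sum fun i _ => (hX i).mul (hp i)), 
      pd_sum (A := fun i v => gradOf G h i v * pd i h v) _ _ fun i _ => (hX i).mul (hp i)]
    congr 1
    exact Finset.sum_congr rfl fun i _ => pd_mul _ (hX i) (hp i)
  have h2 : ∑ i, G u m i * ∑ k, covGrad G h i k u * gradOf G h k u
      = ∑ k, hessOf G h k m u * gradOf G h k u := by
    simp only [Finset.mul_sum, hG.hess_eq hu hh, Finset.sum_mul]
    rw [Finset.sum_comm]
    refine Finset.sum_congr rfl fun k _ => Finset.sum_congr rfl fun i _ => ?_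
    ring
  have h3 : ∑ k, ∑ l, (∑ j, G u k j * christoffelOf G j m l u) * gradOf G h l u * gradOf G h k u
      = 1 / 2 * ∑ k, ∑ l, pd m (fun w => G w k l) u * gradOf G h l u * gradOf G h k u := by
    -- Two of the terms of the lowered Christoffel symbol are together antisymmetric in `k, l`, so
    -- contraction with the symmetric `XᵏXˡ` leaves only the derivative of the metric in direction
    -- `m`.
    have h4 : ∑ k, ∑ l, pd l (fun w => G w m k) u * gradOf G h l u * gradOf G h k u
        = ∑ k, ∑ l, pd k (fun w => G w m l) u * gradOf G h l u * gradOf G h k u := by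
      rw [Finset.sum_comm]
      exact Finset.sum_congr rfl fun k _ => Finset.sum_congr rfl fun l _ => by ring
    have h5 : ∀ k l, (∑ j, G u k j * christoffelOf G j m l u) * gradOf G h l u * gradOf G h k u
        = 1 / 2 * (pd m (fun w => G w k l) u * gradOf G h l u * gradOf G h k u)
          + 1 / 2 * (pd l (fun w => G w m k) u * gradOf G h l u * gradOf G h k u)
          - 1 / 2 * (pd k (fun w => G w m l) u * gradOf G h l u * gradOf G h k u) := by
      intro k l
      rw [hG.sum_metric_mul_christoffel hu, hG.pd_symm hu m l k]
      ring
    simp only [h5, Finset.sum_add_distrib, Finset.sum_sub_distrib, ← Finset.mul_sum]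
    rw [h4]
    ring
  have h6 : ∑ k, hessOf G h k m u * gradOf G h k u
      = ∑ k, ∑ j, G u k j * pd m (gradOf G h j) u * gradOf G h k u
        + 1 / 2 * ∑ k, ∑ l, pd m (fun w => G w k l) u * gradOf G h l u * gradOf G h k u := by
    rw [← h3, ← Finset.sum_add_distrib]
    refine Finset.sum_congr rfl fun k _ => ?_
    rw [hG.hess_symm hu hh, hG.hess_eq hu hh]
    simp only [covGrad, mul_add, Finset.sum_add_distrib, add_mul, Finset.sum_mul, Finset.mul_sum]
    congr 1
    rw [Finset.sum_comm]
    exact Finset.sum_congr rfl fun l _ => Finset.sum_congr rfl fun j _ => by ring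
  have h7 : ∑ i, pd m (gradOf G h i) u * pd i h u
      = ∑ k, ∑ j, G u k j * pd m (gradOf G h j) u * gradOf G h k u := by
    rw [Finset.sum_comm]
    refine Finset.sum_congr rfl fun i _ => ?_
    rw [← hG.sum_metric_mul_grad hu i, Finset.mul_sum]
    refine Finset.sum_congr rfl fun j _ => ?_
    rw [hG.symm hu i j]
    ring
  have h8 : ∑ i, gradOf G h i u * pd m (pd i h) u
      = ∑ k, ∑ j, G u k j * pd m (gradOf G h j) u * gradOf G h k u
        + ∑ k, ∑ l, pd m (fun w => G w k l) u * gradOf G h l u * gradOf G h k u := by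
    rw [← Finset.sum_add_distrib]
    refine Finset.sum_congr rfl fun i _ => ?_
    rw [hG.pd_pd_eq hu hh, ← Finset.sum_add_distrib, Finset.mul_sum]
    exact Finset.sum_congr rfl fun j _ => by ring
  rw [h1, h2, h6, Finset.sum_add_distrib, h7, h8]
  ring

theorem contDiffOn_covGrad {k m : WithTop ℕ∞} (hG : IsMetricOn G U) (hh : ContDiffOn ℝ k h U)
    (hm : m + 1 + 1 ≤ k) (hm' : m + 1 ≤ ∞) (i j : Fin n) :
    ContDiffOn ℝ m (covGrad G h i j) U :=
  (contDiffOn_pd hG.isOpen (hG.contDiffOn_grad hh hm hm' i) le_rfl j).add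
    (ContDiffOn.sum fun l _ => ((hG.contDiffOn_christoffel i j l).of_le (le_self_add.trans hm')).mul
      ((hG.contDiffOn_grad hh hm hm' l).of_le le_self_add))

/-- Raises the index in `pd_half_carre`. The right-hand side is the field `∇_X X`, whose weighted
divergence is the starting point of the Bochner computation. -/
theorem grad_half_carre (hG : IsMetricOn G U) (hu : u ∈ U) (hh : ContDiffOn ℝ 2 h U) (i : Fin n) :
    gradOf G (fun v => 1 / 2 * carreOf G h h v) i u
      = ∑ k, covGrad G h i k u * gradOf G h k u := by
  rw [← hG.sum_inv_mul_sum hu i fun i => ∑ k, covGrad G h i k u * gradOf G h k u]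
  exact Finset.sum_congr rfl fun j _ => by rw [hG.pd_half_carre hu hh]

theorem lapOf_eq (hG : IsMetricOn G U) (hu : u ∈ U) (hψ : ContDiffOn ℝ 1 ψ U)
    (hh : ContDiffOn ℝ 2 h U) :
    lapOf G ψ h u = ∑ i, pd i (gradOf G h i) u
      + ∑ i, ((∑ j, christoffelOf G j i j u) - pd i ψ u) * gradOf G h i u :=
  hG.divOf_eq hu hψ fun i =>
    (hG.contDiffOn_grad (m := 1) hh (by norm_num) (by simp) i).diffAt hG.isOpen (by simp) hu

theorem lapOf_congr {h' : EuclideanSpace ℝ (Fin n) → ℝ} (hU : IsOpen U) (hu : u ∈ U)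
    (hh : ∀ v ∈ U, h v = h' v) : lapOf G ψ h u = lapOf G ψ h' u := by
  unfold lapOf divOf
  congr 1
  refine Finset.sum_congr rfl fun i _ => pd_congr i hU hu fun v hv => ?_
  congr 1
  exact Finset.sum_congr rfl fun j _ => by rw [pd_congr j hU hv hh]

/-- The Bochner formula in coordinates. -/
theorem bochner (hG : IsMetricOn G U) (hu : u ∈ U) (hψ : ContDiffOn ℝ 2 ψ U)
    (hh : ContDiffOn ℝ ∞ h U) :
    lapOf G ψ (fun v => 1 / 2 * carreOf G h h v) u
        - ∑ k, gradOf G h k u * pd k (lapOf G ψ h) u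
      = ∑ i, ∑ j, ∑ k, ∑ l, (G u)⁻¹ i k * (G u)⁻¹ j l * hessOf G h i j u * hessOf G h k l u
        + ∑ i, ∑ j, (ricciOf G i j u + hessOf G ψ i j u) * gradOf G h i u * gradOf G h j u := by
  have hh2 : ContDiffOn ℝ 2 h U := hh.of_le ENat.LEInfty.out
  have hψ1 : ContDiffOn ℝ 1 ψ U := hψ.of_le (by norm_num)
  have hXs : ∀ i, ContDiffOn ℝ ∞ (gradOf G h i) U := fun i =>
    hG.contDiffOn_grad hh (by simp) le_rfl i
  have hX : ∀ i, DifferentiableAt ℝ (gradOf G h i) u := fun i =>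
    (hXs i).diffAt hG.isOpen (by simp) hu
  have hdX : ∀ i j, DifferentiableAt ℝ (pd j (gradOf G h i)) u := fun i j =>
    (contDiffOn_pd (m := ∞) hG.isOpen (hXs i) (by simp) j).diffAt hG.isOpen (by simp) hu
  have hΓ : ∀ i j k, DifferentiableAt ℝ (christoffelOf G i j k) u := fun i j k =>
    (hG.contDiffOn_christoffel i j k).diffAt hG.isOpen (by simp) hu
  have hdψ : ∀ i, DifferentiableAt ℝ (pd i ψ) u := fun i =>
    (contDiffOn_pd (m := 1) hG.isOpen hψ (by norm_num) i).diffAt hG.isOpen (by simp) hu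
  have hcov : ∀ i k, DifferentiableAt ℝ (covGrad G h i k) u := fun i k =>
    (hG.contDiffOn_covGrad (m := ∞) hh (by simp) (by simp) i k).diffAt hG.isOpen (by simp) hu
  have hdcov : ∀ m i k, pd m (covGrad G h i k) u = pd m (pd k (gradOf G h i)) u
      + ∑ l, (pd m (christoffelOf G i k l) u * gradOf G h l u
        + christoffelOf G i k l u * pd m (gradOf G h l) u) := by
    intro m i k
    unfold covGrad
    rw [pd_add m (hdX i k) (DifferentiableAt.fun_sum fun l _ => (hΓ i k l).fun_mul (hX l)),
      pd_sum (A := fun l v => christoffelOf G i k l v * gradOf G h l v) _ _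
        fun l _ => (hΓ i k l).mul (hX l)]
    congr 1
    exact Finset.sum_congr rfl fun l _ => pd_mul m (hΓ i k l) (hX l)
  -- The Laplacian of `½|∇h|²` is the weighted divergence of `∇_X X`, expanded with the product
  -- rule.
  have h1 : lapOf G ψ (fun v => 1 / 2 * carreOf G h h v) u
      = ∑ i, ∑ k, (pd i (covGrad G h i k) u * gradOf G h k u
          + covGrad G h i k u * pd i (gradOf G h k) u)
        + ∑ i, ((∑ j, christoffelOf G j i j u) - pd i ψ u)
          * ∑ k, covGrad G h i k u * gradOf G h k u := by
    have hc : ContDiffOn ℝ 2 (fun v => 1 / 2 * carreOf G h h v) U :=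
      contDiffOn_const.mul ((hG.contDiffOn_carre (m := ∞) hh hh (by simp) le_rfl).of_le
        ENat.LEInfty.out)
    rw [hG.lapOf_eq hu hψ1 hc]
    congr 1
    · refine Finset.sum_congr rfl fun i _ => ?_
      rw [pd_congr i hG.isOpen hu fun v hv => hG.grad_half_carre hv hh2 i,
        pd_sum (A := fun k v => covGrad G h i k v * gradOf G h k v) _ _
          fun k _ => (hcov i k).mul (hX k)]
      exact Finset.sum_congr rfl fun k _ => pd_mul i (hcov i k) (hX k)
    · exact Finset.sum_congr rfl fun i _ => by rw [hG.grad_half_carre hu hh2]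
  have hb : ∀ i, DifferentiableAt ℝ
      (fun v => (∑ j, christoffelOf G j i j v) - pd i ψ v) u := fun i =>
    (DifferentiableAt.fun_sum fun j _ => hΓ j i j).sub (hdψ i)
  have h2 : ∀ k, pd k (lapOf G ψ h) u = ∑ i, pd k (pd i (gradOf G h i)) u
      + ∑ i, (((∑ j, pd k (christoffelOf G j i j) u) - pd i (pd k ψ) u) * gradOf G h i u
        + ((∑ j, christoffelOf G j i j u) - pd i ψ u) * pd k (gradOf G h i) u) := by
    intro k
    rw [pd_congr k hG.isOpen hu fun v hv => hG.lapOf_eq hv hψ1 hh2,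
      pd_add k (DifferentiableAt.fun_sum fun i _ => hdX i i)
        (DifferentiableAt.fun_sum fun i _ => (hb i).fun_mul (hX i)),
      pd_sum (A := fun i v => pd i (gradOf G h i) v) _ _ fun i _ => hdX i i,
      pd_sum (A := fun i v => ((∑ j, christoffelOf G j i j v) - pd i ψ v) * gradOf G h i v) _ _
        fun i _ => (hb i).mul (hX i)]
    congr 1
    refine Finset.sum_congr rfl fun i _ => ?_
    rw [pd_mul k (hb i) (hX i), pd_sub k (DifferentiableAt.fun_sum fun j _ => hΓ j i j) (hdψ i),
      pd_sum _ _ fun j _ => hΓ j i j, pd_comm hG.isOpen hψ hu k i]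
  rw [h1]
  simp only [h2, hdcov, hG.hess_sq_eq hu hh2]
  -- What remains is an identity between numbers at `u`; the only facts it needs are the symmetry of
  -- `Γ` in its lower indices and of the second derivatives of `X`.
  exact bochner_sum_identity (fun i => gradOf G h i u) (fun i => pd i ψ u)
    (fun k i => pd k (gradOf G h i) u) (fun k i => pd i (pd k ψ) u)
    (fun m k i => pd m (pd k (gradOf G h i)) u) (fun i k l => christoffelOf G i k l u)
    (fun m i k l => pd m (christoffelOf G i k l) u)
    (fun i k l => hG.christoffel_symm hu i k l)
    (fun i k j => pd_comm hG.isOpen ((hXs j).of_le ENat.LEInfty.out) hu i k)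

/-- The squared Hilbert–Schmidt norm of a symmetric bilinear form is nonnegative. -/
theorem hess_sq_nonneg (hG : IsMetricOn G U) (hu : u ∈ U) :
    0 ≤ ∑ i, ∑ j, ∑ k, ∑ l,
      (G u)⁻¹ i k * (G u)⁻¹ j l * hessOf G h i j u * hessOf G h k l u := by
  -- With `G⁻¹ = Bᵀ B` the contraction becomes the sum of the squared entries of `B (∇²h) Bᵀ`.
  obtain ⟨B, hB⟩ : ∃ B : Matrix (Fin n) (Fin n) ℝ, (G u)⁻¹ = B.conjTranspose * B := by
    open scoped MatrixOrder Matrix.Norms.L2Operator in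
    exact CStarAlgebra.nonneg_iff_eq_star_mul_self.1 (hG.posDef u hu).inv.posSemidef.nonneg
  have hB' : ∀ i k, (G u)⁻¹ i k = ∑ a, B a i * B a k := by
    intro i k
    rw [hB]
    simp [Matrix.mul_apply]
  have h1 : ∑ i, ∑ j, ∑ k, ∑ l, (G u)⁻¹ i k * (G u)⁻¹ j l * hessOf G h i j u * hessOf G h k l u
      = ∑ a, ∑ b, (∑ i, ∑ j, B a i * B b j * hessOf G h i j u) ^ 2 := by
    have h2 : ∀ i j k l, (G u)⁻¹ i k * (G u)⁻¹ j l * hessOf G h i j u * hessOf G h k l u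
        = ∑ a, ∑ b, (B a i * B b j * hessOf G h i j u) * (B a k * B b l * hessOf G h k l u) := by
      intro i j k l
      rw [hB', hB']
      simp only [Finset.sum_mul, Finset.mul_sum]
      rw [Finset.sum_comm]
      refine Finset.sum_congr rfl fun a _ => Finset.sum_congr rfl fun b _ => ?_
      ring
    simp only [h2]
    rw [sum_comm_inner₆]
    refine Finset.sum_congr rfl fun a _ => Finset.sum_congr rfl fun b _ => ?_
    simp only [sq, Finset.sum_mul, Finset.mul_sum]
    exact Finset.sum_congr rfl fun i _ => Finset.sum_congr rfl fun j _ =>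
      Finset.sum_congr rfl fun k _ => Finset.sum_congr rfl fun l _ => mul_comm _ _
  rw [h1]
  positivity

end IsMetricOn

end CoordinateMetric

/-! ### Tangent vectors, metric and gradient in a chart. -/

section Charts

variable {n : ℕ} {M : Type u} [TopologicalSpace M]
  [ChartedSpace (EuclideanSpace ℝ (Fin n)) M] [IsManifold (𝓡 n) ∞ M]

theorem isManifold_one : IsManifold (𝓡 n) 1 M := IsManifold.of_le (n := ∞) ENat.LEInfty.out

theorem mdifferentiableAt_chart {x y : M} (hy : y ∈ (extChartAt (𝓡 n) x).source) :
    MDifferentiableAt (𝓡 n) 𝓘(ℝ, EuclideanSpace ℝ (Fin n)) (extChartAt (𝓡 n) x) y := by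
  have := isManifold_one (n := n) (M := M)
  exact mdifferentiableAt_extChartAt (by simpa using hy)

theorem mdifferentiableAt_chart_symm {x : M} {u : EuclideanSpace ℝ (Fin n)}
    (hu : u ∈ (extChartAt (𝓡 n) x).target) :
    MDifferentiableAt 𝓘(ℝ, EuclideanSpace ℝ (Fin n)) (𝓡 n) (extChartAt (𝓡 n) x).symm u := by
  have := isManifold_one (n := n) (M := M)
  have h := mdifferentiableWithinAt_extChartAt_symm hu
  rwa [ModelWithCorners.range_eq_univ, mdifferentiableWithinAt_univ] at h

/-- The derivative of the inverse of the chart at `x`. -/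
def chartSymmDeriv (x : M) (u : EuclideanSpace ℝ (Fin n)) :
    EuclideanSpace ℝ (Fin n) →L[ℝ] TangentSpace (𝓡 n) ((extChartAt (𝓡 n) x).symm u) :=
  mfderiv 𝓘(ℝ, EuclideanSpace ℝ (Fin n)) (𝓡 n) (extChartAt (𝓡 n) x).symm u

theorem coordField_eq (x : M) (i : Fin n) (u : EuclideanSpace ℝ (Fin n)) :
    coordField x i u = chartSymmDeriv x u (EuclideanSpace.single i 1) := rfl

theorem chartSymmDeriv_mvfderiv {x : M} {u : EuclideanSpace ℝ (Fin n)}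
    (hu : u ∈ (extChartAt (𝓡 n) x).target)
    (v : TangentSpace (𝓡 n) ((extChartAt (𝓡 n) x).symm u)) :
    chartSymmDeriv x u (mvfderiv (𝓡 n) (extChartAt (𝓡 n) x) ((extChartAt (𝓡 n) x).symm u) v)
      = v := by
  have := isManifold_one (n := n) (M := M)
  have h := mfderivWithin_extChartAt_symm_comp_mfderiv_extChartAt (I := 𝓡 n) hu
  rw [ModelWithCorners.range_eq_univ, mfderivWithin_univ] at h
  exact congrArg (fun L => L v) h

theorem mvfderiv_chartSymmDeriv {x : M} {u : EuclideanSpace ℝ (Fin n)}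
    (hu : u ∈ (extChartAt (𝓡 n) x).target) (w : EuclideanSpace ℝ (Fin n)) :
    mvfderiv (𝓡 n) (extChartAt (𝓡 n) x) ((extChartAt (𝓡 n) x).symm u) (chartSymmDeriv x u w)
      = w := by
  have := isManifold_one (n := n) (M := M)
  have h := mfderiv_extChartAt_comp_mfderivWithin_extChartAt_symm (I := 𝓡 n) hu
  rw [ModelWithCorners.range_eq_univ, mfderivWithin_univ] at h
  exact congrArg (fun L => L w) h

/-- The inverse trivialization of the tangent bundle is smooth; through this identification the
coordinate fields, and then the metric matrix, are seen to be smooth. -/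
theorem chartSymmDeriv_apply_eq_symm {x : M} {u : EuclideanSpace ℝ (Fin n)}
    (hu : u ∈ (extChartAt (𝓡 n) x).target) (w : EuclideanSpace ℝ (Fin n)) :
    chartSymmDeriv x u w = (trivializationAt (EuclideanSpace ℝ (Fin n))
      (fun y : M => TangentSpace (𝓡 n) y) x).symm ((extChartAt (𝓡 n) x).symm u) w := by
  have := isManifold_one (n := n) (M := M)
  have hs : (extChartAt (𝓡 n) x).symm u ∈ (chartAt (EuclideanSpace ℝ (Fin n)) x).source := by
    rw [← extChartAt_source (𝓡 n)]
    exact (extChartAt (𝓡 n) x).map_target hu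
  have h := TangentBundle.symmL_trivializationAt (I := 𝓡 n) hs
  rw [(extChartAt (𝓡 n) x).right_inv hu, ModelWithCorners.range_eq_univ,
    mfderivWithin_univ] at h
  have h2 := congrArg (fun L => L w) h
  refine h2.symm.trans (Bundle.Trivialization.symmL_apply _ ?_ _)
  rwa [TangentBundle.trivializationAt_baseSet]

theorem contMDiffOn_coordField (x : M) (i : Fin n) :
    ContMDiffOn 𝓘(ℝ, EuclideanSpace ℝ (Fin n)) ((𝓡 n).prod 𝓘(ℝ, EuclideanSpace ℝ (Fin n))) ∞
      (fun u => TotalSpace.mk' (EuclideanSpace ℝ (Fin n)) (E := fun y : M => TangentSpace (𝓡 n) y)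
        ((extChartAt (𝓡 n) x).symm u) (coordField x i u)) (extChartAt (𝓡 n) x).target := by
  set e := trivializationAt (EuclideanSpace ℝ (Fin n)) (fun y : M => TangentSpace (𝓡 n) y) x
  have h1 : ContMDiffOn 𝓘(ℝ, EuclideanSpace ℝ (Fin n))
      ((𝓡 n).prod 𝓘(ℝ, EuclideanSpace ℝ (Fin n))) ∞
      (fun u => ((extChartAt (𝓡 n) x).symm u, EuclideanSpace.single i (1 : ℝ)))
      (extChartAt (𝓡 n) x).target :=
    (contMDiffOn_extChartAt_symm x).prodMk contMDiffOn_const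
  have h2 : ContMDiffOn ((𝓡 n).prod 𝓘(ℝ, EuclideanSpace ℝ (Fin n)))
      ((𝓡 n).prod 𝓘(ℝ, EuclideanSpace ℝ (Fin n))) ∞ e.toOpenPartialHomeomorph.symm e.target :=
    e.contMDiffOn_symm
  have hs : ∀ u ∈ (extChartAt (𝓡 n) x).target, (extChartAt (𝓡 n) x).symm u ∈ e.baseSet := by
    intro u hu
    rw [TangentBundle.trivializationAt_baseSet, ← extChartAt_source (𝓡 n)]
    exact (extChartAt (𝓡 n) x).map_target hu
  refine (h2.comp h1 fun u hu => ?_).congr fun u hu => ?_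
  · rw [mem_preimage, e.mem_target]
    exact hs u hu
  · rw [coordField_eq, chartSymmDeriv_apply_eq_symm hu]
    exact e.mk_symm (hs u hu) _

theorem euclidean_eq_sum (w : EuclideanSpace ℝ (Fin n)) :
    w = ∑ i, w i • EuclideanSpace.single i (1 : ℝ) := by
  ext j
  simp [Pi.single_apply]

theorem chartSymmDeriv_eq_sum (x : M) (u w : EuclideanSpace ℝ (Fin n)) :
    chartSymmDeriv x u w = ∑ i, w i • coordField x i u := by
  simp only [coordField_eq]
  conv_lhs => rw [euclidean_eq_sum w]
  rw [map_sum]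
  simp only [map_smul]

theorem eq_sum_component {x : M} {u : EuclideanSpace ℝ (Fin n)}
    (hu : u ∈ (extChartAt (𝓡 n) x).target)
    (v : TangentSpace (𝓡 n) ((extChartAt (𝓡 n) x).symm u)) :
    v = ∑ i, component x ((extChartAt (𝓡 n) x).symm u) v i • coordField x i u := by
  conv_lhs => rw [← chartSymmDeriv_mvfderiv hu v, chartSymmDeriv_eq_sum]
  rfl

theorem chartSymmDeriv_injective {x : M} {u : EuclideanSpace ℝ (Fin n)}
    (hu : u ∈ (extChartAt (𝓡 n) x).target) : Function.Injective (chartSymmDeriv x u) :=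
  Function.LeftInverse.injective (mvfderiv_chartSymmDeriv hu)

theorem metricMatrix_apply (g : SmoothMetric n M) (x : M) (u : EuclideanSpace ℝ (Fin n))
    (i j : Fin n) : metricMatrix g x u i j
      = g.inner ((extChartAt (𝓡 n) x).symm u) (coordField x i u) (coordField x j u) := rfl

theorem sum_metricMatrix (g : SmoothMetric n M) (x : M) (u v w : EuclideanSpace ℝ (Fin n)) :
    g.inner ((extChartAt (𝓡 n) x).symm u) (chartSymmDeriv x u v) (chartSymmDeriv x u w)
      = ∑ i, ∑ j, v i * w j * metricMatrix g x u i j := by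
  rw [chartSymmDeriv_eq_sum, chartSymmDeriv_eq_sum, map_sum, Finset.sum_comm]
  refine Finset.sum_congr rfl fun j _ => ?_
  rw [map_sum, sum_apply]
  refine Finset.sum_congr rfl fun i _ => ?_
  rw [metricMatrix_apply, map_smul, map_smul, smul_apply, smul_eq_mul, smul_eq_mul]
  ring

theorem isMetricOn_metricMatrix (g : SmoothMetric n M) (x : M) :
    IsMetricOn (metricMatrix g x) (extChartAt (𝓡 n) x).target where
  isOpen := isOpen_extChartAt_target x
  smooth i j := by
    rw [← contMDiffOn_iff_contDiffOn]
    have hg : ContMDiffOn 𝓘(ℝ, EuclideanSpace ℝ (Fin n))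
        ((𝓡 n).prod 𝓘(ℝ, EuclideanSpace ℝ (Fin n) →L[ℝ] EuclideanSpace ℝ (Fin n) →L[ℝ] ℝ)) ∞
        (fun u => TotalSpace.mk' (EuclideanSpace ℝ (Fin n) →L[ℝ] EuclideanSpace ℝ (Fin n) →L[ℝ] ℝ)
          (E := fun y : M => TangentSpace (𝓡 n) y →L[ℝ] TangentSpace (𝓡 n) y →L[ℝ] ℝ)
          ((extChartAt (𝓡 n) x).symm u) (g.inner ((extChartAt (𝓡 n) x).symm u)))
        (extChartAt (𝓡 n) x).target :=
      g.contMDiff.comp_contMDiffOn (contMDiffOn_extChartAt_symm x)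
    have h : ContMDiffOn 𝓘(ℝ, EuclideanSpace ℝ (Fin n)) ((𝓡 n).prod 𝓘(ℝ)) ∞
      (fun u => TotalSpace.mk' ℝ (E := Bundle.Trivial M ℝ) ((extChartAt (𝓡 n) x).symm u)
        (g.inner ((extChartAt (𝓡 n) x).symm u) (coordField x i u) (coordField x j u)))
        (extChartAt (𝓡 n) x).target :=
      ContMDiffOn.clm_bundle_apply₂ (F₁ := EuclideanSpace ℝ (Fin n))
        (F₂ := EuclideanSpace ℝ (Fin n)) hg (contMDiffOn_coordField x i)
        (contMDiffOn_coordField x j)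
    intro u hu
    have h2 := h u hu
    simp only [Bundle.contMDiffWithinAt_totalSpace] at h2
    exact h2.2
  posDef u hu := by
    refine Matrix.PosDef.of_dotProduct_mulVec_pos ?_ ?_
    · ext i j
      simp only [Matrix.conjTranspose_apply, metricMatrix_apply, star_trivial]
      exact g.symm _ _ _
    · intro y hy
      set w : EuclideanSpace ℝ (Fin n) := WithLp.toLp 2 y with hw
      have hw0 : chartSymmDeriv x u w ≠ 0 := by
        intro h0
        apply hy
        have : w = 0 := chartSymmDeriv_injective hu (by rw [h0, map_zero])
        simpa [hw] using this
      have := g.pos _ _ hw0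
      rw [sum_metricMatrix] at this
      refine this.trans_eq ?_
      simp only [dotProduct, Matrix.mulVec, Finset.mul_sum, star_trivial, hw]
      exact Finset.sum_congr rfl fun i _ => Finset.sum_congr rfl fun j _ => by ring

theorem mvfderiv_coordField {x : M} {u : EuclideanSpace ℝ (Fin n)}
    (hu : u ∈ (extChartAt (𝓡 n) x).target) {h : M → ℝ}
    (hh : MDifferentiableAt (𝓡 n) 𝓘(ℝ, ℝ) h ((extChartAt (𝓡 n) x).symm u)) (i : Fin n) :
    mvfderiv (𝓡 n) h ((extChartAt (𝓡 n) x).symm u) (coordField x i u) = pd i (inChart x h) u := by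
  have h1 := mfderiv_comp u hh (mdifferentiableAt_chart_symm hu)
  rw [mfderiv_eq_fderiv] at h1
  exact (congrArg (fun L => L (EuclideanSpace.single i (1 : ℝ))) h1).symm

/-- Pairing the gradient with the coordinate fields turns its defining property into the linear
system `G X = ∂h`, which is solved by the inverse matrix. -/
theorem component_grad (g : SmoothMetric n M) {x : M} {u : EuclideanSpace ℝ (Fin n)}
    (hu : u ∈ (extChartAt (𝓡 n) x).target) {h : M → ℝ}
    (hh : MDifferentiableAt (𝓡 n) 𝓘(ℝ, ℝ) h ((extChartAt (𝓡 n) x).symm u)) (i : Fin n) :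
    component x ((extChartAt (𝓡 n) x).symm u) (grad g h ((extChartAt (𝓡 n) x).symm u)) i
      = gradOf (metricMatrix g x) (inChart x h) i u := by
  have hG := isMetricOn_metricMatrix g x
  unfold gradOf
  rw [← hG.sum_inv_mul_sum hu i fun i =>
    component x ((extChartAt (𝓡 n) x).symm u) (grad g h ((extChartAt (𝓡 n) x).symm u)) i]
  refine Finset.sum_congr rfl fun j _ => ?_
  congr 1
  rw [← mvfderiv_coordField hu hh, ← inner_grad g]
  conv_rhs => rw [eq_sum_component hu (grad g h ((extChartAt (𝓡 n) x).symm u))]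
  rw [map_sum, sum_apply]
  refine Finset.sum_congr rfl fun k _ => ?_
  rw [map_smul, smul_apply, smul_eq_mul, ← metricMatrix_apply, hG.symm hu, mul_comm]

/-- The inner product of the gradients of two functions. -/
def carre (g : SmoothMetric n M) (h k : M → ℝ) (y : M) : ℝ := g.inner y (grad g h y) (grad g k y)

theorem carre_eq_mvfderiv (g : SmoothMetric n M) (h k : M → ℝ) (y : M) :
    carre g h k y = mvfderiv (𝓡 n) k y (grad g h y) := by
  unfold carre
  rw [g.symm, inner_grad]

theorem carre_symm (g : SmoothMetric n M) (h k : M → ℝ) (y : M) :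
    carre g h k y = carre g k h y := g.symm _ _ _

/-- The left-hand side refers to no chart, so this pairing of gradients is the intrinsic quantity
through which expressions in different charts are compared. -/
theorem carre_symm_chart (g : SmoothMetric n M) {x : M} {u : EuclideanSpace ℝ (Fin n)}
    (hu : u ∈ (extChartAt (𝓡 n) x).target) {h k : M → ℝ}
    (hh : MDifferentiableAt (𝓡 n) 𝓘(ℝ, ℝ) h ((extChartAt (𝓡 n) x).symm u))
    (hk : MDifferentiableAt (𝓡 n) 𝓘(ℝ, ℝ) k ((extChartAt (𝓡 n) x).symm u)) :
    carre g h k ((extChartAt (𝓡 n) x).symm u)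
      = carreOf (metricMatrix g x) (inChart x h) (inChart x k) u := by
  rw [carre_eq_mvfderiv]
  conv_lhs => rw [eq_sum_component hu (grad g h ((extChartAt (𝓡 n) x).symm u))]
  rw [map_sum]
  unfold carreOf
  refine Finset.sum_congr rfl fun i _ => ?_
  rw [map_smul, mvfderiv_coordField hu hk, component_grad g hu hh, smul_eq_mul]

end Charts

/-! ### The differential operators at the centre of a chart. -/

section Operators

variable {n : ℕ} {M : Type u} [TopologicalSpace M]
  [ChartedSpace (EuclideanSpace ℝ (Fin n)) M] [IsManifold (𝓡 n) ∞ M]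

theorem coord_mem (x : M) : coord M x ∈ (extChartAt (𝓡 n) x).target := mem_extChartAt_target x

theorem contDiffOn_inChart {k : WithTop ℕ∞} {h : M → ℝ} (hh : ContMDiff (𝓡 n) 𝓘(ℝ, ℝ) k h)
    (hk : k ≤ ∞) (x : M) : ContDiffOn ℝ k (inChart x h) (extChartAt (𝓡 n) x).target := by
  rw [← contMDiffOn_iff_contDiffOn]
  have : IsManifold (𝓡 n) k M := IsManifold.of_le hk
  exact hh.comp_contMDiffOn (contMDiffOn_extChartAt_symm x)

theorem inChart_chart {x y : M} (hy : y ∈ (extChartAt (𝓡 n) x).source) (h : M → ℝ) :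
    inChart x h (extChartAt (𝓡 n) x y) = h y := by
  unfold inChart
  rw [(extChartAt (𝓡 n) x).left_inv hy]

theorem inChart_coord (x : M) (h : M → ℝ) : inChart (n := n) x h (coord M x) = h x :=
  inChart_chart (n := n) (mem_extChartAt_source x) h

theorem contMDiff_of_inChart {k : WithTop ℕ∞} {h : M → ℝ} (hk : k ≤ ∞)
    (hh : ∀ x, ContDiffOn ℝ k (inChart x h) (extChartAt (𝓡 n) x).target) :
    ContMDiff (𝓡 n) 𝓘(ℝ, ℝ) k h := by
  have : IsManifold (𝓡 n) k M := IsManifold.of_le hk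
  intro x
  have h1 : ContMDiffAt (𝓡 n) 𝓘(ℝ, EuclideanSpace ℝ (Fin n)) k (extChartAt (𝓡 n) x) x :=
    contMDiffAt_extChartAt
  have h2 : ContMDiffAt 𝓘(ℝ, EuclideanSpace ℝ (Fin n)) 𝓘(ℝ, ℝ) k (inChart x h)
      (extChartAt (𝓡 n) x x) :=
    ((hh x).contDiffAt (extChartAt_target_mem_nhds x)).contMDiffAt
  refine (h2.comp x h1).congr_of_eventuallyEq ?_
  filter_upwards [extChartAt_source_mem_nhds (I := 𝓡 n) x] with y hy
  exact (inChart_chart hy h).symm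

theorem component_smul (x y : M) (a : ℝ) (v : TangentSpace (𝓡 n) y) (i : Fin n) :
    component x y (a • v) i = a * component x y v i := by
  unfold component
  rw [map_smul]
  rfl

theorem component_grad_of_mem (g : SmoothMetric n M) {x y : M}
    (hy : y ∈ (extChartAt (𝓡 n) x).source) {h : M → ℝ}
    (hh : MDifferentiableAt (𝓡 n) 𝓘(ℝ, ℝ) h y) (i : Fin n) :
    component x y (grad g h y) i
      = gradOf (metricMatrix g x) (inChart x h) i (extChartAt (𝓡 n) x y) := by
  have hu := (extChartAt (𝓡 n) x).map_source hy
  obtain ⟨u, hu', rfl⟩ : ∃ u ∈ (extChartAt (𝓡 n) x).target, (extChartAt (𝓡 n) x).symm u = y :=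
    ⟨_, hu, (extChartAt (𝓡 n) x).left_inv hy⟩
  rw [(extChartAt (𝓡 n) x).right_inv hu', component_grad g hu' hh]

theorem carre_chart (g : SmoothMetric n M) {x y : M}
    (hy : y ∈ (extChartAt (𝓡 n) x).source) {h k : M → ℝ}
    (hh : MDifferentiableAt (𝓡 n) 𝓘(ℝ, ℝ) h y) (hk : MDifferentiableAt (𝓡 n) 𝓘(ℝ, ℝ) k y) :
    carre g h k y
      = carreOf (metricMatrix g x) (inChart x h) (inChart x k) (extChartAt (𝓡 n) x y) := by
  have hu := (extChartAt (𝓡 n) x).map_source hy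
  rw [← carre_symm_chart g hu, (extChartAt (𝓡 n) x).left_inv hy]
  all_goals rwa [(extChartAt (𝓡 n) x).left_inv hy]

theorem normSq_grad (g : SmoothMetric n M) (h : M → ℝ) (x : M) :
    normSq g (grad g h x) = carre g h h x := rfl

theorem hessianHSSq_eq (g : SmoothMetric n M) (h : M → ℝ) (x : M) :
    hessianHSSq g h x = ∑ i, ∑ j, ∑ k, ∑ l, (metricMatrix g x (coord M x))⁻¹ i k *
      (metricMatrix g x (coord M x))⁻¹ j l *
        hessOf (metricMatrix g x) (inChart x h) i j (coord M x) *
        hessOf (metricMatrix g x) (inChart x h) k l (coord M x) := rfl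

theorem hessianHSSq_nonneg (g : SmoothMetric n M) (h : M → ℝ) (x : M) :
    0 ≤ hessianHSSq g h x :=
  (isMetricOn_metricMatrix g x).hess_sq_nonneg (coord_mem x)

theorem bakryEmery_grad (g : SmoothMetric n M) (f : M → ℝ) {h : M → ℝ} {x : M}
    (hh : MDifferentiableAt (𝓡 n) 𝓘(ℝ, ℝ) h x) :
    bakryEmery g f x (grad g h x) = ∑ i, ∑ j,
      (ricciOf (metricMatrix g x) i j (coord M x)
        + hessOf (metricMatrix g x) (inChart x f) i j (coord M x))
      * gradOf (metricMatrix g x) (inChart x h) i (coord M x)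
      * gradOf (metricMatrix g x) (inChart x h) j (coord M x) := by
  unfold bakryEmery
  simp only [component_grad_of_mem g (mem_extChartAt_source x) hh]
  rfl

/-- The inner factor `e^{-f}` merges with the volume density into the density of `μ`, and the outer
`e^f` with its inverse. -/
theorem nablaMuStar_eq (g : SmoothMetric n M) (f : M → ℝ) (X : Π x : M, TangentSpace (𝓡 n) x)
    (x : M) : nablaMuStar g f X x = -divOf (densOf (metricMatrix g x) (inChart x f))
      (fun i u => component x ((extChartAt (𝓡 n) x).symm u) (X ((extChartAt (𝓡 n) x).symm u)) i)
      (coord M x) := by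
  unfold nablaMuStar divergence divOf densOf
  simp only [component_smul, inChart_coord, mul_inv, Real.exp_neg, inv_inv]
  rw [mul_neg, ← mul_assoc, mul_comm (Real.exp (f x))]
  congr 2
  refine Finset.sum_congr rfl fun i _ => ?_
  congr 1
  ext u
  rw [← mul_assoc]
  rfl

/-- This holds only at the centre of the chart, since the definition uses a different chart at each
point. The extension to the whole chart domain is `wittenLaplacian_chart`. -/
theorem wittenLaplacian_eq (g : SmoothMetric n M) (f : M → ℝ) {h : M → ℝ}
    (hh : ContMDiff (𝓡 n) 𝓘(ℝ, ℝ) 1 h) (x : M) :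
    wittenLaplacian g f h x
      = lapOf (metricMatrix g x) (inChart x f) (inChart x h) (coord M x) := by
  unfold wittenLaplacian lapOf
  rw [nablaMuStar_eq, neg_neg]
  unfold divOf
  congr 1
  refine Finset.sum_congr rfl fun i _ => ?_
  refine pd_congr i (isOpen_extChartAt_target x) (coord_mem x) fun v hv => ?_
  beta_reduce
  rw [component_grad g hv (hh.mdifferentiable one_ne_zero _)]

/-- The Leibniz rule for the weighted divergence; it brings the continuity equation into the form
`∂ₜρ = -(ρ Lφ + ⟨∇ρ, ∇φ⟩)`. -/
theorem nablaMuStar_smul_grad (g : SmoothMetric n M) {f : M → ℝ}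
    (hf : ContMDiff (𝓡 n) 𝓘(ℝ, ℝ) 1 f) {r h : M → ℝ}
    (hr : ContMDiff (𝓡 n) 𝓘(ℝ, ℝ) 1 r) (hh : ContMDiff (𝓡 n) 𝓘(ℝ, ℝ) 2 h) (x : M) :
    nablaMuStar g f (fun y => r y • grad g h y) x
      = -(r x * wittenLaplacian g f h x + carre g r h x) := by
  have hG := isMetricOn_metricMatrix g x
  have hh1 : ContMDiff (𝓡 n) 𝓘(ℝ, ℝ) 1 h := hh.of_le (by norm_num)
  have hrd := (contDiffOn_inChart hr ENat.LEInfty.out x).diffAt hG.isOpen one_ne_zero (coord_mem x)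
  have hWd := (hG.contDiffOn_dens ENat.LEInfty.out
    (contDiffOn_inChart hf ENat.LEInfty.out x)).diffAt hG.isOpen one_ne_zero (coord_mem x)
  have hXd : ∀ i, DifferentiableAt ℝ (gradOf (metricMatrix g x) (inChart x h) i) (coord M x) :=
    fun i => (hG.contDiffOn_grad (m := 1) (contDiffOn_inChart hh ENat.LEInfty.out x)
      (by norm_num) ENat.LEInfty.out i).diffAt hG.isOpen one_ne_zero (coord_mem x)
  have hW := hG.dens_pos (ψ := inChart x f) (coord_mem x)
  rw [nablaMuStar_eq, wittenLaplacian_eq g f hh1, carre_symm,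
    carre_chart g (mem_extChartAt_source x) (hh1.mdifferentiable one_ne_zero _)
      (hr.mdifferentiable one_ne_zero _)]
  congr 1
  unfold lapOf divOf carreOf
  change _ = _ + ∑ i, gradOf (metricMatrix g x) (inChart x h) i (coord M x)
    * pd i (inChart x r) (coord M x)
  rw [Finset.mul_sum, Finset.mul_sum, Finset.mul_sum, ← Finset.sum_add_distrib]
  refine Finset.sum_congr rfl fun i _ => ?_
  rw [pd_congr (K := fun v => inChart x r v * (densOf (metricMatrix g x) (inChart x f) v
      * gradOf (metricMatrix g x) (inChart x h) i v)) i hG.isOpen (coord_mem x) fun v hv => by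
      beta_reduce
      rw [component_smul, component_grad g hv (hh1.mdifferentiable one_ne_zero _)]
      unfold inChart
      ring,
    pd_mul i hrd (hWd.fun_mul (hXd i)), inChart_coord]
  field_simp
  ring

end Operators

/-! ### Change of coordinates. -/

section ChartTransition

variable {n : ℕ} {M : Type u} [TopologicalSpace M]
  [ChartedSpace (EuclideanSpace ℝ (Fin n)) M] [IsManifold (𝓡 n) ∞ M]

/-- The metric in terms of the components of vectors in an arbitrary chart. -/
theorem inner_eq_sum_component (g : SmoothMetric n M) {y p : M}
    (hp : p ∈ (extChartAt (𝓡 n) y).source) (v w : TangentSpace (𝓡 n) p) :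
    g.inner p v w = ∑ a, ∑ b, component y p v a * component y p w b
      * metricMatrix g y (extChartAt (𝓡 n) y p) a b := by
  have hu := (extChartAt (𝓡 n) y).map_source hp
  obtain ⟨u, hu', rfl⟩ : ∃ u ∈ (extChartAt (𝓡 n) y).target, (extChartAt (𝓡 n) y).symm u = p :=
    ⟨_, hu, (extChartAt (𝓡 n) y).left_inv hp⟩
  rw [(extChartAt (𝓡 n) y).right_inv hu']
  conv_lhs => rw [← chartSymmDeriv_mvfderiv hu' v, ← chartSymmDeriv_mvfderiv hu' w]
  rw [sum_metricMatrix]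
  rfl

/-- The derivative of the coordinate change from the chart at `x` to the chart at `y`. -/
def transitionDeriv (x y : M) (u : EuclideanSpace ℝ (Fin n)) :
    EuclideanSpace ℝ (Fin n) →L[ℝ] EuclideanSpace ℝ (Fin n) :=
  (mvfderiv (𝓡 n) (extChartAt (𝓡 n) y) ((extChartAt (𝓡 n) x).symm u)).comp (chartSymmDeriv x u)

theorem hasFDerivAt_transition {x y : M} {u : EuclideanSpace ℝ (Fin n)}
    (hu : u ∈ (extChartAt (𝓡 n) x).target)
    (hy : (extChartAt (𝓡 n) x).symm u ∈ (extChartAt (𝓡 n) y).source) :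
    HasFDerivAt (fun v => extChartAt (𝓡 n) y ((extChartAt (𝓡 n) x).symm v))
      (transitionDeriv x y u) u := by
  have h := ((mdifferentiableAt_chart hy).hasMFDerivAt).comp u
    (mdifferentiableAt_chart_symm hu).hasMFDerivAt
  exact h.hasFDerivAt

/-- The Gram matrices satisfy `G_x = Dᵀ G_y D` with `D` the Jacobian matrix of the coordinate
change; taking determinants and square roots gives the factor `|det D|`. -/
theorem volDensity_transition (g : SmoothMetric n M) {x y : M} {u : EuclideanSpace ℝ (Fin n)}
    (hy : (extChartAt (𝓡 n) x).symm u ∈ (extChartAt (𝓡 n) y).source) :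
    volDensity g x u = |(transitionDeriv x y u).det|
      * volDensity g y (extChartAt (𝓡 n) y ((extChartAt (𝓡 n) x).symm u)) := by
  set D : Matrix (Fin n) (Fin n) ℝ := LinearMap.toMatrix
    (EuclideanSpace.basisFun (Fin n) ℝ).toBasis (EuclideanSpace.basisFun (Fin n) ℝ).toBasis
    (transitionDeriv x y u : EuclideanSpace ℝ (Fin n) →ₗ[ℝ] EuclideanSpace ℝ (Fin n)) with hD
  have hDa : ∀ a i, D a i
      = component y ((extChartAt (𝓡 n) x).symm u) (coordField x i u) a := by
    intro a i
    rw [hD, LinearMap.toMatrix_apply]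
    simp only [OrthonormalBasis.coe_toBasis, EuclideanSpace.basisFun_apply,
      OrthonormalBasis.coe_toBasis_repr_apply, EuclideanSpace.basisFun_repr]
    rfl
  have hdet : (transitionDeriv x y u).det = D.det := (LinearMap.det_toMatrix _ _).symm
  have hmat : metricMatrix g x u = D.transpose
      * metricMatrix g y (extChartAt (𝓡 n) y ((extChartAt (𝓡 n) x).symm u)) * D := by
    ext i j
    rw [metricMatrix_apply, inner_eq_sum_component g hy]
    simp only [Matrix.mul_apply, Matrix.transpose_apply, ← hDa, Finset.sum_mul]
    rw [Finset.sum_comm]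
    refine Finset.sum_congr rfl fun b _ => Finset.sum_congr rfl fun a _ => ?_
    ring
  unfold volDensity
  rw [hmat, Matrix.det_mul, Matrix.det_mul, Matrix.det_transpose, hdet, mul_right_comm,
    Real.sqrt_mul (mul_self_nonneg _), Real.sqrt_mul_self_eq_abs]

end ChartTransition

/-! ### The Riemannian volume does not depend on the charts. -/

section Volume

variable {n : ℕ} {M : Type u} [TopologicalSpace M]
  [ChartedSpace (EuclideanSpace ℝ (Fin n)) M] [IsManifold (𝓡 n) ∞ M]
  [MeasurableSpace M] [BorelSpace M]

theorem aemeasurable_symm (x : M) (ν : Measure (EuclideanSpace ℝ (Fin n))) :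
    AEMeasurable (extChartAt (𝓡 n) x).symm (ν.restrict (extChartAt (𝓡 n) x).target) :=
  (continuousOn_extChartAt_symm x).aemeasurable (isOpen_extChartAt_target x).measurableSet

theorem measurableSet_preimage_symm (x : M) {A : Set M} (hA : MeasurableSet A) :
    MeasurableSet ((extChartAt (𝓡 n) x).symm ⁻¹' A ∩ (extChartAt (𝓡 n) x).target) := by
  classical
  have hT : MeasurableSet (extChartAt (𝓡 n) x).target := (isOpen_extChartAt_target x).measurableSet
  have h : Measurable ((extChartAt (𝓡 n) x).target.piecewise (extChartAt (𝓡 n) x).symm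
      (fun _ => x)) :=
    ContinuousOn.measurable_piecewise (continuousOn_extChartAt_symm x) continuousOn_const hT
  convert (h hA).inter hT using 1
  ext u
  simp only [mem_inter_iff, mem_preimage]
  constructor
  · rintro ⟨h1, h2⟩
    exact ⟨by rwa [piecewise_eq_of_mem _ _ _ h2], h2⟩
  · rintro ⟨h1, h2⟩
    exact ⟨by rwa [piecewise_eq_of_mem _ _ _ h2] at h1, h2⟩

theorem chartVolume_apply (g : SmoothMetric n M) (x : M) {A : Set M} (hA : MeasurableSet A) :
    chartVolume g x A = ∫⁻ u in (extChartAt (𝓡 n) x).symm ⁻¹' A ∩ (extChartAt (𝓡 n) x).target,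
      ENNReal.ofReal (volDensity g x u) := by
  unfold chartVolume
  rw [Measure.map_apply_of_aemeasurable (aemeasurable_symm x _) hA,
    Measure.restrict_apply' (isOpen_extChartAt_target x).measurableSet, withDensity_apply']

theorem chartVolume_compl_source (g : SmoothMetric n M) (x : M) :
    chartVolume g x (extChartAt (𝓡 n) x).sourceᶜ = 0 := by
  rw [chartVolume_apply g x (isOpen_extChartAt_source x).measurableSet.compl]
  have : (extChartAt (𝓡 n) x).symm ⁻¹' (extChartAt (𝓡 n) x).sourceᶜ ∩ (extChartAt (𝓡 n) x).target
      = ∅ := by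
    ext u
    simp only [mem_inter_iff, mem_preimage, mem_compl_iff, mem_empty_iff_false, iff_false, not_and]
    exact fun h1 h2 => h1 ((extChartAt (𝓡 n) x).map_target h2)
  rw [this]
  simp

/-- The Riemannian volume computed in two different charts is the same. -/
theorem chartVolume_eq (g : SmoothMetric n M) (x y : M) {A : Set M} (hA : MeasurableSet A)
    (hx : A ⊆ (extChartAt (𝓡 n) x).source) (hy : A ⊆ (extChartAt (𝓡 n) y).source) :
    chartVolume g x A = chartVolume g y A := by
  rw [chartVolume_apply g x hA, chartVolume_apply g y hA]
  set S := (extChartAt (𝓡 n) x).symm ⁻¹' A ∩ (extChartAt (𝓡 n) x).target with hS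
  set τ := fun v => extChartAt (𝓡 n) y ((extChartAt (𝓡 n) x).symm v) with hτ
  have himage : (extChartAt (𝓡 n) y).symm ⁻¹' A ∩ (extChartAt (𝓡 n) y).target = τ '' S := by
    ext w
    constructor
    · rintro ⟨h1, h2⟩
      refine ⟨extChartAt (𝓡 n) x ((extChartAt (𝓡 n) y).symm w), ⟨?_, ?_⟩, ?_⟩
      · rw [mem_preimage, (extChartAt (𝓡 n) x).left_inv (hx h1)]
        exact h1
      · exact (extChartAt (𝓡 n) x).map_source (hx h1)
      · simp only [hτ]
        rw [(extChartAt (𝓡 n) x).left_inv (hx h1), (extChartAt (𝓡 n) y).right_inv h2]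
    · rintro ⟨v, ⟨h1, h2⟩, rfl⟩
      refine ⟨?_, (extChartAt (𝓡 n) y).map_source (hy h1)⟩
      simp only [hτ, mem_preimage]
      rw [(extChartAt (𝓡 n) y).left_inv (hy h1)]
      exact h1
  have hinj : InjOn τ S := by
    intro v hv w hw hvw
    have := (extChartAt (𝓡 n) y).injOn (hy hv.1) (hy hw.1) hvw
    exact (extChartAt (𝓡 n) x).symm.injOn hv.2 hw.2 this
  -- Change of variables along the coordinate change `τ`; its Jacobian factor is exactly the one
  -- between the two volume densities.
  rw [himage, lintegral_image_eq_lintegral_abs_det_fderiv_mul volume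
    (measurableSet_preimage_symm x hA)
    (fun v hv => (hasFDerivAt_transition hv.2 (hy hv.1)).hasFDerivWithinAt) hinj]
  refine setLIntegral_congr_fun (measurableSet_preimage_symm x hA) fun v hv => ?_
  rw [volDensity_transition g (hy hv.1), ENNReal.ofReal_mul (abs_nonneg _)]

variable [SecondCountableTopology M]

/-- Second countability extracts a countable cover from the cover by all chart domains; the point
`x` makes it nonempty, so that a sequence can enumerate it. -/
theorem exists_chart_sequence (x : M) :
    ∃ s : ℕ → M, ⋃ k, (extChartAt (𝓡 n) (s k)).source = univ := by
  obtain ⟨c, hc, hU⟩ := TopologicalSpace.countable_cover_nhds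
    (fun y : M => extChartAt_source_mem_nhds (I := 𝓡 n) y)
  have hne : c.Nonempty := by
    by_contra h
    rw [not_nonempty_iff_eq_empty] at h
    have : x ∈ (univ : Set M) := mem_univ x
    rw [← hU, h] at this
    simp at this
  obtain ⟨s, rfl⟩ := hc.exists_eq_range hne
  refine ⟨s, ?_⟩
  rw [← hU]
  simp

/-- On each disjoint piece the chosen chart may be replaced by the chart at `x`, by
`chartVolume_eq`, and the pieces of `A` add up again. Thus the choice made in the definition is
immaterial. -/
theorem riemannianVolume_apply (g : SmoothMetric n M) (x : M) {A : Set M} (hA : MeasurableSet A)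
    (hx : A ⊆ (extChartAt (𝓡 n) x).source) : riemannianVolume g A = chartVolume g x A := by
  have hex := exists_chart_sequence (n := n) x
  unfold riemannianVolume
  rw [dif_pos hex]
  set s := hex.choose
  set S := fun j => (extChartAt (𝓡 n) (s j)).source with hSdef
  have hS : ∀ j, MeasurableSet (S j) := fun j => (isOpen_extChartAt_source _).measurableSet
  have hd : ∀ k, MeasurableSet (disjointed S k) := MeasurableSet.disjointed hS
  rw [Measure.sum_apply _ hA]
  have h1 : ∀ k, (chartVolume g (s k)).restrict (disjointed S k) A
      = chartVolume g x (A ∩ disjointed S k) := by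
    intro k
    rw [Measure.restrict_apply hA]
    exact chartVolume_eq g _ _ (hA.inter (hd k))
      (inter_subset_right.trans (disjointed_subset S k)) (inter_subset_left.trans hx)
  refine (tsum_congr h1).trans ?_
  rw [← measure_iUnion _ fun k => hA.inter (hd k)]
  · rw [← inter_iUnion, iUnion_disjointed, hex.choose_spec, inter_univ]
  · intro i j hij
    exact (disjoint_disjointed S hij).mono inter_subset_right inter_subset_right

theorem riemannianVolume_restrict (g : SmoothMetric n M) (x : M) :
    (riemannianVolume g).restrict (extChartAt (𝓡 n) x).source = chartVolume g x := by
  have hS : MeasurableSet (extChartAt (𝓡 n) x).source :=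
    (isOpen_extChartAt_source (I := 𝓡 n) x).measurableSet
  ext A hA
  rw [Measure.restrict_apply hA, riemannianVolume_apply g x (hA.inter hS) inter_subset_right,
    measure_inter_conull (chartVolume_compl_source g x)]

end Volume

/-! ### Integration by parts in coordinates. -/

section CoordinateIntegration

variable {n : ℕ} {T K : Set (EuclideanSpace ℝ (Fin n))} {k V : EuclideanSpace ℝ (Fin n) → ℝ}

theorem integrableOn_of_zero_off_compact (hT : IsOpen T) (hK : IsCompact K) (hKT : K ⊆ T)
    (hk : ContinuousOn k T) (h0 : ∀ u ∈ T, u ∉ K → k u = 0) : IntegrableOn k T := by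
  have h1 : IntegrableOn k K := (hk.mono hKT).integrableOn_compact hK
  refine h1.of_forall_sdiff_eq_zero hT.measurableSet fun u hu => h0 u hu.1 hu.2

/-- Integration by parts on an open set for a function with compact support in this set. -/
theorem setIntegral_mul_pd (hT : IsOpen T) (hK : IsCompact K) (hKT : K ⊆ T)
    (hk : ContDiffOn ℝ 1 k T) (h0 : ∀ u ∈ T, u ∉ K → k u = 0) (hV : ContDiffOn ℝ 1 V T)
    (i : Fin n) :
    IntegrableOn (fun u => k u * pd i V u) T ∧ IntegrableOn (fun u => pd i k u * V u) T ∧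
      ∫ u in T, k u * pd i V u = -∫ u in T, pd i k u * V u := by
  have hpk : ContinuousOn (pd i k) T := (contDiffOn_pd (m := 0) hT hk (by norm_num) i).continuousOn
  have hpV : ContinuousOn (pd i V) T := (contDiffOn_pd (m := 0) hT hV (by norm_num) i).continuousOn
  have hpk0 : ∀ u ∈ T, u ∉ K → pd i k u = 0 := by
    intro u hu huK
    rw [pd_congr (K := fun _ => 0) i (hT.sdiff hK.isClosed) ⟨hu, huK⟩ fun v hv => h0 v hv.1 hv.2]
    simp [pd]
  have hi1 : IntegrableOn (fun u => k u * pd i V u) T :=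
    integrableOn_of_zero_off_compact hT hK hKT (hk.continuousOn.mul hpV)
      fun u hu huK => by rw [h0 u hu huK, zero_mul]
  have hi2 : IntegrableOn (fun u => pd i k u * V u) T :=
    integrableOn_of_zero_off_compact hT hK hKT (hpk.mul hV.continuousOn)
      fun u hu huK => by rw [hpk0 u hu huK, zero_mul]
  have hi3 : IntegrableOn (fun u => k u * V u) T :=
    integrableOn_of_zero_off_compact hT hK hKT (hk.continuousOn.mul hV.continuousOn)
      fun u hu huK => by rw [h0 u hu huK, zero_mul]
  refine ⟨hi1, hi2, ?_⟩
  -- The extension by zero is differentiable on the whole space: near a point of `T` it is `k`, and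
  -- off the compact `K` it vanishes. The function `V` needs to be differentiable only on the closed
  -- support of `κ`, which lies in `T`.
  set κ := T.indicator k with hκ
  have hκT : ∀ u ∈ T, κ u = k u := fun u hu => indicator_of_mem hu k
  have hκK : ∀ u ∉ K, κ u = 0 := by
    intro u hu
    by_cases huT : u ∈ T
    · rw [hκT u huT, h0 u huT hu]
    · exact indicator_of_notMem huT k
  have hpκT : ∀ u ∈ T, pd i κ u = pd i k u := fun u hu => pd_congr i hT hu hκT
  have hpκK : ∀ u ∉ K, pd i κ u = 0 := by
    intro u hu
    rw [pd_congr (K := fun _ => 0) i hK.isClosed.isOpen_compl hu hκK]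
    simp [pd]
  have hdiff : Differentiable ℝ κ := by
    intro u
    by_cases hu : u ∈ T
    · exact (hk.diffAt hT one_ne_zero hu).congr_of_eventuallyEq
        (Filter.eventuallyEq_of_mem (hT.mem_nhds hu) hκT)
    · have huK : u ∈ Kᶜ := fun h => hu (hKT h)
      exact (differentiableAt_const 0).congr_of_eventuallyEq
        (Filter.eventuallyEq_of_mem (hK.isClosed.isOpen_compl.mem_nhds huK) hκK)
  have hsuppK : Function.support κ ⊆ K := fun u hu => by_contra fun h => hu (hκK u h)
  have hsupp : tsupport κ ⊆ T := (closure_minimal hsuppK hK.isClosed).trans hKT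
  have key : ∀ {a b : EuclideanSpace ℝ (Fin n) → ℝ}, (∀ u ∈ T, a u = b u) → (∀ u ∉ T, a u = 0) →
      IntegrableOn b T → Integrable a ∧ ∫ u, a u = ∫ u in T, b u := by
    intro a b hab ha hb
    have h1 : IntegrableOn a T := hb.congr_fun (fun u hu => (hab u hu).symm) hT.measurableSet
    refine ⟨(integrableOn_iff_integrable_of_support_subset
      fun u hu => by_contra fun h => hu (ha u h)).1 h1, ?_⟩
    rw [← setIntegral_eq_integral_of_forall_compl_eq_zero ha]
    exact setIntegral_congr_fun hT.measurableSet hab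
  have k1 := key (a := fun u => κ u * pd i V u) (fun u hu => by rw [hκT u hu])
    (fun u hu => by rw [hκK u fun h => hu (hKT h), zero_mul]) hi1
  have k2 := key (a := fun u => pd i κ u * V u) (fun u hu => by rw [hpκT u hu])
    (fun u hu => by rw [hpκK u fun h => hu (hKT h), zero_mul]) hi2
  have k3 := key (a := fun u => κ u * V u) (fun u hu => by rw [hκT u hu])
    (fun u hu => by rw [hκK u fun h => hu (hKT h), zero_mul]) hi3
  rw [← k1.2, ← k2.2]
  exact integral_mul_fderiv_eq_neg_fderiv_mul_of_integrable k2.1 k1.1 k3.1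
    (fun u _ => hdiff u) (fun u hu => hV.diffAt hT one_ne_zero (hsupp hu))

end CoordinateIntegration

/-! ### The weighted measure in a chart. -/

section WeightedMeasure

open Topology

variable {n : ℕ} {M : Type u} [TopologicalSpace M]
  [ChartedSpace (EuclideanSpace ℝ (Fin n)) M] [IsManifold (𝓡 n) ∞ M]
  {g : SmoothMetric n M} {f : M → ℝ}

/-- The density of the weighted volume in the chart at `x`. -/
def chartDensity (g : SmoothMetric n M) (f : M → ℝ) (x : M) : EuclideanSpace ℝ (Fin n) → ℝ :=
  densOf (metricMatrix g x) (inChart x f)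

theorem continuousOn_chartDensity (hf : Continuous f) (x : M) :
    ContinuousOn (chartDensity g f x) (extChartAt (𝓡 n) x).target :=
  (isMetricOn_metricMatrix g x).contDiffOn_sqrt_det.continuousOn.mul
    (hf.comp_continuousOn (continuousOn_extChartAt_symm x)).neg.rexp

theorem chartDensity_pos {x : M} {u : EuclideanSpace ℝ (Fin n)}
    (hu : u ∈ (extChartAt (𝓡 n) x).target) : 0 < chartDensity g f x u :=
  (isMetricOn_metricMatrix g x).dens_pos hu

theorem aemeasurable_chartDensity (hf : Continuous f) (x : M) :
    AEMeasurable (fun u => ENNReal.ofReal (chartDensity g f x u))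
      (volume.restrict (extChartAt (𝓡 n) x).target) :=
  ((continuousOn_chartDensity hf x).aemeasurable
    (isOpen_extChartAt_target x).measurableSet).ennreal_ofReal

variable [MeasurableSpace M] [BorelSpace M] [SecondCountableTopology M]

/-- The weight `e^{-f}` is pulled back through the chart and multiplied with the volume density.
Integrals and null sets of `μ` are computed from this local description. -/
theorem weightedMeasure_restrict (hf : Continuous f) (x : M) :
    (weightedMeasure g f).restrict (extChartAt (𝓡 n) x).source
      = Measure.map (extChartAt (𝓡 n) x).symm
        ((volume.restrict (extChartAt (𝓡 n) x).target).withDensity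
          fun u => ENNReal.ofReal (chartDensity g f x u)) := by
  have hT : MeasurableSet (extChartAt (𝓡 n) x).target := (isOpen_extChartAt_target x).measurableSet
  have hS : MeasurableSet (extChartAt (𝓡 n) x).source :=
    (isOpen_extChartAt_source (I := 𝓡 n) x).measurableSet
  have hd : Measurable fun y => ENNReal.ofReal (Real.exp (-f y)) :=
    (Real.continuous_exp.comp hf.neg).measurable.ennreal_ofReal
  have hsm := (continuousOn_extChartAt_symm (I := 𝓡 n) x).aemeasurable (μ := volume) hT
  have hw : AEMeasurable (fun u => ENNReal.ofReal (volDensity g x u))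
      (volume.restrict (extChartAt (𝓡 n) x).target) :=
    ((isMetricOn_metricMatrix g x).contDiffOn_sqrt_det.continuousOn.aemeasurable hT).ennreal_ofReal
  have hac := withDensity_absolutelyContinuous (volume.restrict (extChartAt (𝓡 n) x).target)
    fun u => ENNReal.ofReal (chartDensity g f x u)
  have hac' := withDensity_absolutelyContinuous (volume.restrict (extChartAt (𝓡 n) x).target)
    fun u => ENNReal.ofReal (volDensity g x u)
  unfold weightedMeasure
  rw [restrict_withDensity hS, riemannianVolume_restrict, chartVolume, restrict_withDensity hT]
  refine Measure.ext fun A hA => ?_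
  rw [withDensity_apply _ hA, ← lintegral_indicator hA,
    lintegral_map' (hd.indicator hA).aemeasurable (hsm.mono_ac hac'),
    lintegral_withDensity_eq_lintegral_mul₀ hw
      (show AEMeasurable (fun u => A.indicator (fun y => ENNReal.ofReal (Real.exp (-f y)))
        ((extChartAt (𝓡 n) x).symm u)) _ from (hd.indicator hA).comp_aemeasurable hsm),
    ← lintegral_indicator_one hA,
    lintegral_map' (measurable_one.indicator hA).aemeasurable (hsm.mono_ac hac),
    lintegral_withDensity_eq_lintegral_mul₀ (aemeasurable_chartDensity hf x)
      (show AEMeasurable (fun u => A.indicator 1 ((extChartAt (𝓡 n) x).symm u)) _ from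
        (measurable_one.indicator hA).comp_aemeasurable hsm)]
  refine lintegral_congr fun u => ?_
  simp only [Pi.mul_apply, chartDensity, densOf, indicator]
  split_ifs
  · rw [Pi.one_apply, mul_one, ENNReal.ofReal_mul (Real.sqrt_nonneg _)]
    rfl
  · simp

theorem setIntegral_weightedMeasure (hf : Continuous f) (x : M) {F : M → ℝ}
    (hF : ContinuousOn F (extChartAt (𝓡 n) x).source) :
    ∫ y in (extChartAt (𝓡 n) x).source, F y ∂(weightedMeasure g f)
      = ∫ u in (extChartAt (𝓡 n) x).target, inChart x F u * chartDensity g f x u := by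
  have hT : MeasurableSet (extChartAt (𝓡 n) x).target := (isOpen_extChartAt_target x).measurableSet
  have hS : MeasurableSet (extChartAt (𝓡 n) x).source :=
    (isOpen_extChartAt_source (I := 𝓡 n) x).measurableSet
  have hFm : AEStronglyMeasurable F
      ((weightedMeasure g f).restrict (extChartAt (𝓡 n) x).source) := hF.aestronglyMeasurable hS
  have hac := withDensity_absolutelyContinuous (volume.restrict (extChartAt (𝓡 n) x).target)
    fun u => ENNReal.ofReal (chartDensity g f x u)
  rw [weightedMeasure_restrict hf] at hFm ⊢
  rw [integral_map ((aemeasurable_symm x _).mono_ac hac) hFm,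
    integral_withDensity_eq_integral_toReal_smul₀ (aemeasurable_chartDensity hf x)
      (Filter.Eventually.of_forall fun _ => ENNReal.ofReal_lt_top)]
  refine setIntegral_congr_fun hT fun u hu => ?_
  rw [ENNReal.toReal_ofReal (chartDensity_pos hu).le, smul_eq_mul, mul_comm]
  rfl

theorem weightedMeasure_apply (hf : Continuous f) (x : M) {A : Set M} (hA : MeasurableSet A)
    (hx : A ⊆ (extChartAt (𝓡 n) x).source) :
    weightedMeasure g f A
      = ∫⁻ u in (extChartAt (𝓡 n) x).symm ⁻¹' A ∩ (extChartAt (𝓡 n) x).target,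
        ENNReal.ofReal (chartDensity g f x u) := by
  have hac := withDensity_absolutelyContinuous (volume.restrict (extChartAt (𝓡 n) x).target)
    fun u => ENNReal.ofReal (chartDensity g f x u)
  rw [← Measure.restrict_eq_self _ hx, weightedMeasure_restrict hf,
    Measure.map_apply_of_aemeasurable ((aemeasurable_symm x _).mono_ac hac) hA, withDensity_apply',
    Measure.restrict_restrict' (isOpen_extChartAt_target x).measurableSet]

/-- A neighbourhood whose coordinates stay in a compact subset of the target has finite measure, the
density being bounded there. Continuous functions with compact support are then integrable. -/
theorem isLocallyFiniteMeasure_weightedMeasure (hf : Continuous f) :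
    IsLocallyFiniteMeasure (weightedMeasure g f) := by
  refine ⟨fun x => ?_⟩
  obtain ⟨K, hK, hKT, hKc⟩ := exists_compact_subset (isOpen_extChartAt_target (I := 𝓡 n) x)
    (mem_extChartAt_target x)
  have hVo : IsOpen ((extChartAt (𝓡 n) x).source ∩ extChartAt (𝓡 n) x ⁻¹' interior K) :=
    (continuousOn_extChartAt x).isOpen_inter_preimage (isOpen_extChartAt_source x) isOpen_interior
  refine ⟨_, hVo.mem_nhds ⟨mem_extChartAt_source x, hKT⟩, ?_⟩
  rw [weightedMeasure_apply hf x hVo.measurableSet inter_subset_left]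
  have hi : IntegrableOn (chartDensity g f x) K :=
    ((continuousOn_chartDensity hf x).mono hKc).integrableOn_compact hK
  refine lt_of_le_of_lt (lintegral_mono_set ?_) hi.lintegral_lt_top
  rintro u ⟨⟨_, h1⟩, h2⟩
  rw [mem_preimage, (extChartAt (𝓡 n) x).right_inv h2] at h1
  exact interior_subset h1

/-- The density is strictly positive, so a null open set would be Lebesgue null in a chart. This
upgrades almost everywhere equality of continuous functions to equality. -/
theorem isOpenPosMeasure_weightedMeasure (hf : Continuous f) :
    (weightedMeasure g f).IsOpenPosMeasure := by
  refine ⟨fun U hU hne h0 => ?_⟩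
  obtain ⟨x, hx⟩ := hne
  have hS := isOpen_extChartAt_source (I := 𝓡 n) x
  have h1 : weightedMeasure g f (U ∩ (extChartAt (𝓡 n) x).source) = 0 :=
    measure_mono_null inter_subset_left h0
  rw [weightedMeasure_apply hf x (hU.inter hS).measurableSet inter_subset_right] at h1
  set O := (extChartAt (𝓡 n) x).symm ⁻¹' (U ∩ (extChartAt (𝓡 n) x).source)
    ∩ (extChartAt (𝓡 n) x).target with hO
  have hOo : IsOpen O := by
    rw [hO, inter_comm]
    exact (continuousOn_extChartAt_symm x).isOpen_inter_preimage (isOpen_extChartAt_target x)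
      (hU.inter hS)
  have hOne : O.Nonempty := by
    refine ⟨extChartAt (𝓡 n) x x, ?_, mem_extChartAt_target x⟩
    rw [mem_preimage, extChartAt_to_inv]
    exact ⟨hx, mem_extChartAt_source x⟩
  rw [lintegral_eq_zero_iff' ((aemeasurable_chartDensity hf x).mono_set inter_subset_right)] at h1
  have h2 : ∀ᵐ u ∂(volume.restrict O), False := by
    filter_upwards [h1, ae_restrict_mem hOo.measurableSet] with u hu huO
    have := chartDensity_pos (g := g) (f := f) huO.2
    simp only [Pi.zero_apply, ENNReal.ofReal_eq_zero] at hu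
    linarith
  rw [Filter.eventually_false_iff_eq_bot, ae_eq_bot, Measure.restrict_eq_zero] at h2
  exact (hOo.measure_pos volume hOne).ne' h2

end WeightedMeasure

/-! ### Integration by parts and the Bochner formula on the manifold. -/

section IntegrationByParts

open Topology

variable {n : ℕ} {M : Type u} [TopologicalSpace M]
  [ChartedSpace (EuclideanSpace ℝ (Fin n)) M] [IsManifold (𝓡 n) ∞ M]

theorem grad_eq_zero_of_notMem_tsupport (g : SmoothMetric n M) {k : M → ℝ} {y : M}
    (hy : y ∉ tsupport k) : grad g k y = 0 := by
  have h : k =ᶠ[𝓝 y] fun _ => 0 := notMem_tsupport_iff_eventuallyEq.1 hy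
  have h2 : mvfderiv (𝓡 n) k y = 0 := by
    unfold mvfderiv
    rw [h.mfderiv_eq, mfderiv_const]
    rfl
  unfold grad
  rw [h2, map_zero]

theorem carre_eq_zero_of_notMem_tsupport (g : SmoothMetric n M) {k : M → ℝ} (h : M → ℝ) {y : M}
    (hy : y ∉ tsupport k) : carre g k h y = 0 := by
  unfold carre
  rw [grad_eq_zero_of_notMem_tsupport g hy, map_zero]
  rfl

/-- The weighted Laplacian computed in the chart at `x`. -/
def chartLaplacian (g : SmoothMetric n M) (f : M → ℝ) (x : M) (h : M → ℝ) (y : M) : ℝ :=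
  lapOf (metricMatrix g x) (inChart x f) (inChart x h) (extChartAt (𝓡 n) x y)

variable {g : SmoothMetric n M} {f k h : M → ℝ}

theorem inChart_chartLaplacian (x : M) {u : EuclideanSpace ℝ (Fin n)}
    (hu : u ∈ (extChartAt (𝓡 n) x).target) : inChart x (chartLaplacian g f x h) u
      = lapOf (metricMatrix g x) (inChart x f) (inChart x h) u := by
  change lapOf _ _ _ (extChartAt (𝓡 n) x ((extChartAt (𝓡 n) x).symm u)) = _
  rw [(extChartAt (𝓡 n) x).right_inv hu]

theorem contDiffOn_flux (hf : ContMDiff (𝓡 n) 𝓘(ℝ, ℝ) 1 f) (hh : ContMDiff (𝓡 n) 𝓘(ℝ, ℝ) 2 h)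
    (x : M) (i : Fin n) : ContDiffOn ℝ 1 (fun v => chartDensity g f x v
      * gradOf (metricMatrix g x) (inChart x h) i v) (extChartAt (𝓡 n) x).target :=
  ((isMetricOn_metricMatrix g x).contDiffOn_dens ENat.LEInfty.out
    (contDiffOn_inChart hf ENat.LEInfty.out x)).mul
    ((isMetricOn_metricMatrix g x).contDiffOn_grad (contDiffOn_inChart hh ENat.LEInfty.out x)
      (by norm_num) ENat.LEInfty.out i)

theorem continuousOn_chartLaplacian (hf : ContMDiff (𝓡 n) 𝓘(ℝ, ℝ) 1 f)
    (hh : ContMDiff (𝓡 n) 𝓘(ℝ, ℝ) 2 h) (x : M) :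
    ContinuousOn (chartLaplacian g f x h) (extChartAt (𝓡 n) x).source := by
  refine ContinuousOn.comp (t := (extChartAt (𝓡 n) x).target)
    (g := lapOf (metricMatrix g x) (inChart x f) (inChart x h)) ?_
    (continuousOn_extChartAt x) (extChartAt (𝓡 n) x).mapsTo
  refine ContinuousOn.mul ((continuousOn_chartDensity hf.continuous x).inv₀
    fun u hu => (chartDensity_pos hu).ne') (continuousOn_finsetSum _ fun i _ => ?_)
  exact (contDiffOn_pd (m := 0) (isOpen_extChartAt_target x) (contDiffOn_flux hf hh x i)
    (by norm_num) i).continuousOn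

theorem contMDiff_carre {l m : WithTop ℕ∞} (hk : ContMDiff (𝓡 n) 𝓘(ℝ, ℝ) l k)
    (hh : ContMDiff (𝓡 n) 𝓘(ℝ, ℝ) l h) (hm : m + 1 ≤ l) (hl : l ≤ ∞) :
    ContMDiff (𝓡 n) 𝓘(ℝ, ℝ) m (carre g k h) := by
  have hm' : m ≤ ∞ := (le_self_add.trans hm).trans hl
  have hl0 : l ≠ 0 := fun h => by simp [h] at hm
  refine contMDiff_of_inChart hm' fun x => ?_
  refine ((isMetricOn_metricMatrix g x).contDiffOn_carre
    (contDiffOn_inChart hk hl x) (contDiffOn_inChart hh hl x) hm hm').congr fun u hu => ?_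
  exact carre_symm_chart g hu (hk.mdifferentiable hl0 _) (hh.mdifferentiable hl0 _)

theorem continuous_carre (hk : ContMDiff (𝓡 n) 𝓘(ℝ, ℝ) 1 k) (hh : ContMDiff (𝓡 n) 𝓘(ℝ, ℝ) 1 h) :
    Continuous (carre g k h) :=
  (contMDiff_carre (m := 0) hk hh (by norm_num) ENat.LEInfty.out).continuous

theorem mdifferentiableAt_of_one (hk : ContMDiff (𝓡 n) 𝓘(ℝ, ℝ) 1 k) (y : M) :
    MDifferentiableAt (𝓡 n) 𝓘(ℝ, ℝ) k y := hk.mdifferentiable one_ne_zero y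

theorem carre_mul_left {l : M → ℝ} (hk : ContMDiff (𝓡 n) 𝓘(ℝ, ℝ) 1 k)
    (hl : ContMDiff (𝓡 n) 𝓘(ℝ, ℝ) 1 l) (h : M → ℝ) (y : M) :
    carre g (fun z => k z * l z) h y = k y * carre g l h y + l y * carre g k h y := by
  rw [carre_symm, carre_symm g l, carre_symm g k, carre_eq_mvfderiv, carre_eq_mvfderiv,
    carre_eq_mvfderiv]
  have := mvfderiv_mul (I := 𝓡 n) (mdifferentiableAt_of_one hk y) (mdifferentiableAt_of_one hl y)
  rw [show (fun z => k z * l z) = k * l from rfl, this]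
  simp

variable [MeasurableSpace M] [BorelSpace M] [SecondCountableTopology M] [T2Space M]

/-- Integration by parts for a test function supported in the chart at `x`. -/
theorem integral_mul_chartLaplacian (hf : ContMDiff (𝓡 n) 𝓘(ℝ, ℝ) 1 f) (x : M)
    (hk : ContMDiff (𝓡 n) 𝓘(ℝ, ℝ) 1 k) (hkc : HasCompactSupport k)
    (hks : tsupport k ⊆ (extChartAt (𝓡 n) x).source) (hh : ContMDiff (𝓡 n) 𝓘(ℝ, ℝ) 2 h) :
    ∫ y, k y * chartLaplacian g f x h y ∂(weightedMeasure g f)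
      = -∫ y, carre g k h y ∂(weightedMeasure g f) := by
  have hh1 : ContMDiff (𝓡 n) 𝓘(ℝ, ℝ) 1 h := hh.of_le (by norm_num)
  have hT := isOpen_extChartAt_target (I := 𝓡 n) x
  have hlapc := continuousOn_chartLaplacian (g := g) hf hh x
  have e1 : ∫ y, k y * chartLaplacian g f x h y ∂(weightedMeasure g f)
      = ∫ y in (extChartAt (𝓡 n) x).source, k y * chartLaplacian g f x h y
        ∂(weightedMeasure g f) := by
    refine (setIntegral_eq_integral_of_forall_compl_eq_zero fun y hy => ?_).symm
    rw [image_eq_zero_of_notMem_tsupport fun h => hy (hks h), zero_mul]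
  have e2 : ∫ y, carre g k h y ∂(weightedMeasure g f)
      = ∫ y in (extChartAt (𝓡 n) x).source, carre g k h y ∂(weightedMeasure g f) := by
    refine (setIntegral_eq_integral_of_forall_compl_eq_zero fun y hy => ?_).symm
    exact carre_eq_zero_of_notMem_tsupport g h fun h => hy (hks h)
  rw [e1, e2, 
    setIntegral_weightedMeasure (F := fun y => k y * chartLaplacian g f x h y) hf.continuous x
      (hk.continuous.continuousOn.mul hlapc),
    setIntegral_weightedMeasure hf.continuous x (continuous_carre hk hh1).continuousOn]
  set K := extChartAt (𝓡 n) x '' tsupport k with hKdef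
  have hK : IsCompact K := IsCompact.image_of_continuousOn hkc
    ((continuousOn_extChartAt x).mono hks)
  have hKT : K ⊆ (extChartAt (𝓡 n) x).target := by
    rintro _ ⟨y, hy, rfl⟩
    exact (extChartAt (𝓡 n) x).map_source (hks hy)
  have hk0 : ∀ u ∈ (extChartAt (𝓡 n) x).target, u ∉ K → inChart x k u = 0 := by
    intro u hu huK
    refine image_eq_zero_of_notMem_tsupport (f := k) fun h => huK ⟨_, h, (extChartAt (𝓡 n) x).right_inv hu⟩
  have key := fun i : Fin n => setIntegral_mul_pd hT hK hKT
    (contDiffOn_inChart hk ENat.LEInfty.out x) hk0 (contDiffOn_flux (g := g) hf hh x i) i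
  -- The density of `μ` cancels the inverse density in the divergence and leaves `k ∂ᵢ(W Xⁱ)`, to
  -- which integration by parts applies in each coordinate direction.
  have e3 : ∫ u in (extChartAt (𝓡 n) x).target,
      inChart x (fun y => k y * chartLaplacian g f x h y) u * chartDensity g f x u
      = ∫ u in (extChartAt (𝓡 n) x).target, ∑ i, inChart x k u * pd i (fun v =>
        chartDensity g f x v * gradOf (metricMatrix g x) (inChart x h) i v) u := by
    refine setIntegral_congr_fun hT.measurableSet fun u hu => ?_
    have h1 : inChart x (fun y => k y * chartLaplacian g f x h y) u
        = inChart x k u * lapOf (metricMatrix g x) (inChart x f) (inChart x h) u := by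
      rw [← inChart_chartLaplacian x hu]
      rfl
    have h2 := (chartDensity_pos (g := g) (f := f) hu).ne'
    simp only [h1, lapOf, divOf, ← Finset.mul_sum]
    unfold chartDensity at h2 ⊢
    field_simp
  have e4 : ∫ u in (extChartAt (𝓡 n) x).target, inChart x (carre g k h) u * chartDensity g f x u
      = ∫ u in (extChartAt (𝓡 n) x).target, ∑ i, pd i (inChart x k) u *
        (chartDensity g f x u * gradOf (metricMatrix g x) (inChart x h) i u) := by
    refine setIntegral_congr_fun hT.measurableSet fun u hu => ?_
    have h1 : inChart x (carre g k h) u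
        = carreOf (metricMatrix g x) (inChart x h) (inChart x k) u := by
      rw [← carre_symm_chart g hu (hh1.mdifferentiable one_ne_zero _)
        (hk.mdifferentiable one_ne_zero _), carre_symm]
      rfl
    simp only [h1, carreOf, Finset.sum_mul]
    exact Finset.sum_congr rfl fun i _ => by ring
  rw [e3, e4, integral_finsetSum _ fun i _ => (key i).1, integral_finsetSum _ fun i _ => (key i).2.1,
    ← Finset.sum_neg_distrib]
  exact Finset.sum_congr rfl fun i _ => (key i).2.2

theorem continuous_mul_of_tsupport {S : Set M} (hS : IsOpen S) (hk : Continuous k)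
    (hks : tsupport k ⊆ S) {F : M → ℝ} (hF : ContinuousOn F S) : Continuous fun y => k y * F y := by
  rw [continuous_iff_continuousAt]
  intro y
  by_cases hy : y ∈ S
  · exact hk.continuousAt.mul (hF.continuousAt (hS.mem_nhds hy))
  · have h : k =ᶠ[𝓝 y] fun _ => 0 := notMem_tsupport_iff_eventuallyEq.1 fun h => hy (hks h)
    refine (continuousAt_const (y := (0 : ℝ))).congr ?_
    filter_upwards [h] with z hz
    rw [hz, zero_mul]

/-- The weighted Laplacian does not depend on the chart in which it is computed. -/
theorem chartLaplacian_eq (hf : ContMDiff (𝓡 n) 𝓘(ℝ, ℝ) 1 f) (hh : ContMDiff (𝓡 n) 𝓘(ℝ, ℝ) 2 h)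
    (x y : M) {p : M} (hx : p ∈ (extChartAt (𝓡 n) x).source)
    (hy : p ∈ (extChartAt (𝓡 n) y).source) :
    chartLaplacian g f x h p = chartLaplacian g f y h p := by
  have := ChartedSpace.locallyCompactSpace (EuclideanSpace ℝ (Fin n)) M
  have := isLocallyFiniteMeasure_weightedMeasure (g := g) hf.continuous
  have := isOpenPosMeasure_weightedMeasure (g := g) hf.continuous
  have hSx := isOpen_extChartAt_source (I := 𝓡 n) x
  have hSy := isOpen_extChartAt_source (I := 𝓡 n) y
  set U := (extChartAt (𝓡 n) x).source ∩ (extChartAt (𝓡 n) y).source with hU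
  have hUo : IsOpen U := hSx.inter hSy
  have hcx : ContinuousOn (chartLaplacian g f x h) U :=
    (continuousOn_chartLaplacian hf hh x).mono inter_subset_left
  have hcy : ContinuousOn (chartLaplacian g f y h) U :=
    (continuousOn_chartLaplacian hf hh y).mono inter_subset_right
  -- Against a test function `η` supported in both chart domains, each of the two expressions
  -- integrates to `-∫⟨∇η, ∇h⟩ dμ`, where no chart occurs. Hence they agree almost everywhere on
  -- `U`, and by continuity everywhere.
  have hae : ∀ᵐ z ∂(weightedMeasure g f), z ∈ U →
      chartLaplacian g f x h z - chartLaplacian g f y h z = 0 := by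
    refine hUo.ae_eq_zero_of_integral_contMDiff_smul_eq_zero (𝓡 n)
      ((hcx.sub hcy).locallyIntegrableOn hUo.measurableSet) fun η hη hηc hηU => ?_
    have hη1 : ContMDiff (𝓡 n) 𝓘(ℝ, ℝ) 1 η := hη.of_le ENat.LEInfty.out
    have hint : ∀ F : M → ℝ, ContinuousOn F U →
        Integrable (fun z => η z * F z) (weightedMeasure g f) := fun F hF =>
      (continuous_mul_of_tsupport hUo hη.continuous hηU hF).integrable_of_hasCompactSupport
        hηc.mul_right
    simp only [smul_eq_mul, mul_sub]
    rw [integral_sub (hint _ hcx) (hint _ hcy),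
      integral_mul_chartLaplacian hf x hη1 hηc (hηU.trans inter_subset_left) hh,
      integral_mul_chartLaplacian hf y hη1 hηc (hηU.trans inter_subset_right) hh, sub_self]
  have hae' : chartLaplacian g f x h =ᵐ[(weightedMeasure g f).restrict U]
      chartLaplacian g f y h := by
    rw [Filter.EventuallyEq, ae_restrict_iff' hUo.measurableSet]
    filter_upwards [hae] with z hz hzU
    exact sub_eq_zero.1 (hz hzU)
  exact Measure.eqOn_open_of_ae_eq hae' hUo hcx hcy ⟨hx, hy⟩

theorem wittenLaplacian_chart (hf : ContMDiff (𝓡 n) 𝓘(ℝ, ℝ) 1 f)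
    (hh : ContMDiff (𝓡 n) 𝓘(ℝ, ℝ) 2 h) (x : M) {p : M} (hx : p ∈ (extChartAt (𝓡 n) x).source) :
    wittenLaplacian g f h p = chartLaplacian g f x h p := by
  rw [chartLaplacian_eq hf hh x p hx (mem_extChartAt_source p),
    wittenLaplacian_eq g f (hh.of_le (by norm_num))]
  rfl

theorem inChart_wittenLaplacian (hf : ContMDiff (𝓡 n) 𝓘(ℝ, ℝ) 1 f)
    (hh : ContMDiff (𝓡 n) 𝓘(ℝ, ℝ) 2 h) (x : M) {u : EuclideanSpace ℝ (Fin n)}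
    (hu : u ∈ (extChartAt (𝓡 n) x).target) : inChart x (wittenLaplacian g f h) u
      = lapOf (metricMatrix g x) (inChart x f) (inChart x h) u := by
  rw [← inChart_chartLaplacian x hu]
  exact wittenLaplacian_chart hf hh x ((extChartAt (𝓡 n) x).map_target hu)

theorem continuous_wittenLaplacian (hf : ContMDiff (𝓡 n) 𝓘(ℝ, ℝ) 1 f)
    (hh : ContMDiff (𝓡 n) 𝓘(ℝ, ℝ) 2 h) : Continuous (wittenLaplacian g f h) := by
  rw [continuous_iff_continuousAt]
  intro x
  have hS := (isOpen_extChartAt_source (I := 𝓡 n) x).mem_nhds (mem_extChartAt_source x)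
  refine ((continuousOn_chartLaplacian (g := g) hf hh x).continuousAt hS).congr ?_
  filter_upwards [hS] with y hy
  exact (wittenLaplacian_chart hf hh x hy).symm

theorem mvfderiv_finset_sum {ι : Type*} (s : Finset ι) {A : ι → M → ℝ} {y : M}
    (hA : ∀ i ∈ s, MDifferentiableAt (𝓡 n) 𝓘(ℝ, ℝ) (A i) y) :
    mvfderiv (𝓡 n) (fun z => ∑ i ∈ s, A i z) y = ∑ i ∈ s, mvfderiv (𝓡 n) (A i) y := by
  classical
  suffices h : ∀ s' ⊆ s, MDifferentiableAt (𝓡 n) 𝓘(ℝ, ℝ) (fun z => ∑ i ∈ s', A i z) y ∧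
      mvfderiv (𝓡 n) (fun z => ∑ i ∈ s', A i z) y = ∑ i ∈ s', mvfderiv (𝓡 n) (A i) y from
    (h s subset_rfl).2
  intro s'
  induction s' using Finset.induction_on with
  | empty =>
    intro _
    simp only [Finset.sum_empty]
    exact ⟨mdifferentiableAt_const, mvfderiv_const _⟩
  | insert i s' hi IH =>
    intro hs
    obtain ⟨h1, h2⟩ := IH ((Finset.subset_insert i s').trans hs)
    have h3 := hA i (hs (Finset.mem_insert_self i s'))
    simp only [Finset.sum_insert hi]
    refine ⟨h3.add h1, ?_⟩
    rw [← h2]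
    exact mvfderiv_add h3 h1

/-- Integration by parts for the Witten Laplacian. -/
theorem integral_mul_wittenLaplacian (hf : ContMDiff (𝓡 n) 𝓘(ℝ, ℝ) 1 f)
    (hk : ContMDiff (𝓡 n) 𝓘(ℝ, ℝ) 1 k) (hkc : HasCompactSupport k)
    (hh : ContMDiff (𝓡 n) 𝓘(ℝ, ℝ) 2 h) :
    ∫ y, k y * wittenLaplacian g f h y ∂(weightedMeasure g f)
      = -∫ y, carre g k h y ∂(weightedMeasure g f) := by
  have := ChartedSpace.locallyCompactSpace (EuclideanSpace ℝ (Fin n)) M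
  have := isLocallyFiniteMeasure_weightedMeasure (g := g) hf.continuous
  have hh1 : ContMDiff (𝓡 n) 𝓘(ℝ, ℝ) 1 h := hh.of_le (by norm_num)
  -- The partition is indexed by the points of `M`, but by local finiteness only finitely many
  -- members meet the compact support of `k`; each piece lies in one chart domain.
  obtain ⟨χ, hχ⟩ := SmoothPartitionOfUnity.exists_isSubordinate (𝓡 n) isClosed_univ
    (fun x : M => (extChartAt (𝓡 n) x).source) (fun x => isOpen_extChartAt_source x)
    (fun x _ => mem_iUnion.2 ⟨x, mem_extChartAt_source x⟩)
  have hfin : {i | ((Function.support (χ i)) ∩ tsupport k).Nonempty}.Finite :=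
    χ.locallyFinite.finite_nonempty_inter_compact hkc
  set s := hfin.toFinset with hs
  have hsum : ∀ y, k y = ∑ i ∈ s, χ i y * k y := by
    intro y
    by_cases hy : y ∈ tsupport k
    · rw [← Finset.sum_mul]
      have h1 : ∑ᶠ i, χ i y = 1 := χ.sum_eq_one (mem_univ y)
      rw [finsum_eq_sum_of_support_subset (s := s)] at h1
      · rw [h1, one_mul]
      · intro i hi
        simp only [hs, Finite.coe_toFinset, mem_ofPred_eq]
        exact ⟨y, hi, hy⟩
    · rw [image_eq_zero_of_notMem_tsupport hy]
      simp
  have hχ1 : ∀ i, ContMDiff (𝓡 n) 𝓘(ℝ, ℝ) 1 (χ i) := fun i =>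
    (χ i).contMDiff.of_le ENat.LEInfty.out
  have hχk : ∀ i, ContMDiff (𝓡 n) 𝓘(ℝ, ℝ) 1 (fun y => χ i y * k y) := fun i => (hχ1 i).mul hk
  have hχkc : ∀ i, HasCompactSupport (fun y => χ i y * k y) := fun i => hkc.mul_left
  have hpiece : ∀ i, ∫ y, (χ i y * k y) * wittenLaplacian g f h y ∂(weightedMeasure g f)
      = -∫ y, carre g (fun z => χ i z * k z) h y ∂(weightedMeasure g f) := by
    intro i
    have hsub : tsupport (fun y => χ i y * k y) ⊆ (extChartAt (𝓡 n) i).source :=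
      (tsupport_mul_subset_left).trans (hχ i)
    rw [← integral_mul_chartLaplacian hf i (hχk i) (hχkc i) hsub hh]
    refine integral_congr_ae (Filter.Eventually.of_forall fun y => ?_)
    by_cases hy : y ∈ (extChartAt (𝓡 n) i).source
    · beta_reduce
      rw [wittenLaplacian_chart hf hh i hy]
    · have h0 : χ i y * k y = 0 :=
        image_eq_zero_of_notMem_tsupport (f := fun y => χ i y * k y) fun h => hy (hsub h)
      beta_reduce
      rw [h0, zero_mul, zero_mul]
  have hcarre : ∀ y, carre g k h y = ∑ i ∈ s, carre g (fun z => χ i z * k z) h y := by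
    intro y
    simp only [carre_symm g _ h, carre_eq_mvfderiv]
    conv_lhs => rw [show k = fun z => ∑ i ∈ s, χ i z * k z from funext hsum]
    rw [mvfderiv_finset_sum s fun i _ => mdifferentiableAt_of_one (hχk i) y, sum_apply]
  have hi1 : ∀ i ∈ s, Integrable (fun y => (χ i y * k y) * wittenLaplacian g f h y)
      (weightedMeasure g f) := fun i _ =>
    ((hχk i).continuous.mul (continuous_wittenLaplacian hf hh)).integrable_of_hasCompactSupport
      (hχkc i).mul_right
  have hi2 : ∀ i ∈ s, Integrable (carre g (fun z => χ i z * k z) h) (weightedMeasure g f) :=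
    fun i _ => (continuous_carre (hχk i) hh1).integrable_of_hasCompactSupport
      ((hχkc i).mono' fun y hy => by
        by_contra hc
        exact hy (carre_eq_zero_of_notMem_tsupport g h hc))
  calc ∫ y, k y * wittenLaplacian g f h y ∂(weightedMeasure g f)
      = ∫ y, ∑ i ∈ s, (χ i y * k y) * wittenLaplacian g f h y ∂(weightedMeasure g f) := by
        refine integral_congr_ae (Filter.Eventually.of_forall fun y => ?_)
        beta_reduce
        rw [← Finset.sum_mul, ← hsum y]
    _ = -∫ y, carre g k h y ∂(weightedMeasure g f) := by
        simp only [hcarre]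
        rw [integral_finsetSum _ hi1, integral_finsetSum _ hi2, ← Finset.sum_neg_distrib]
        exact Finset.sum_congr rfl fun i _ => hpiece i

/-- The divergence theorem with a cutoff function. -/
theorem integral_cutoff_mul (hf : ContMDiff (𝓡 n) 𝓘(ℝ, ℝ) 1 f) {χ : M → ℝ}
    (hχ : ContMDiff (𝓡 n) 𝓘(ℝ, ℝ) 1 χ) (hχc : HasCompactSupport χ)
    (hk : ContMDiff (𝓡 n) 𝓘(ℝ, ℝ) 1 k) (hh : ContMDiff (𝓡 n) 𝓘(ℝ, ℝ) 2 h) :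
    ∫ y, χ y * (k y * wittenLaplacian g f h y + carre g k h y) ∂(weightedMeasure g f)
      = -∫ y, k y * carre g χ h y ∂(weightedMeasure g f) := by
  have := ChartedSpace.locallyCompactSpace (EuclideanSpace ℝ (Fin n)) M
  have := isLocallyFiniteMeasure_weightedMeasure (g := g) hf.continuous
  have hh1 : ContMDiff (𝓡 n) 𝓘(ℝ, ℝ) 1 h := hh.of_le (by norm_num)
  have hi1 : Integrable (fun y => χ y * k y * wittenLaplacian g f h y) (weightedMeasure g f) :=
    ((hχ.continuous.mul hk.continuous).mul
      (continuous_wittenLaplacian hf hh)).integrable_of_hasCompactSupport hχc.mul_right.mul_right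
  have hi2 : Integrable (fun y => χ y * carre g k h y) (weightedMeasure g f) :=
    (hχ.continuous.mul (continuous_carre hk hh1)).integrable_of_hasCompactSupport hχc.mul_right
  have hi3 : Integrable (fun y => k y * carre g χ h y) (weightedMeasure g f) := by
    refine (hk.continuous.mul (continuous_carre hχ hh1)).integrable_of_hasCompactSupport
      (HasCompactSupport.mul_left ?_)
    refine hχc.mono' fun y hy => ?_
    by_contra hc
    exact hy (carre_eq_zero_of_notMem_tsupport g h hc)
  have h1 := integral_mul_wittenLaplacian (g := g) hf (hχ.mul hk) hχc.mul_right hh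
  have h2 : ∫ y, carre g (fun z => χ z * k z) h y ∂(weightedMeasure g f)
      = ∫ y, χ y * carre g k h y ∂(weightedMeasure g f)
        + ∫ y, k y * carre g χ h y ∂(weightedMeasure g f) := by
    simp only [carre_mul_left hχ hk]
    rw [integral_add hi2 hi3]
  simp only [mul_add, ← mul_assoc]
  rw [integral_add hi1 hi2]
  change ∫ y, χ y * k y * wittenLaplacian g f h y ∂(weightedMeasure g f)
    = -∫ y, carre g (fun z => χ z * k z) h y ∂(weightedMeasure g f) at h1
  rw [h1, h2]
  ring

/-- As `f` is only `C²` and its first derivatives enter `L`, just one derivative of `Lh` remains.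
This is what `⟨∇h, ∇Lh⟩` in the Bochner formula requires. -/
theorem contMDiff_wittenLaplacian (hf : ContMDiff (𝓡 n) 𝓘(ℝ, ℝ) 2 f)
    (hh : ContMDiff (𝓡 n) 𝓘(ℝ, ℝ) ∞ h) :
    ContMDiff (𝓡 n) 𝓘(ℝ, ℝ) 1 (wittenLaplacian g f h) := by
  have hf1 : ContMDiff (𝓡 n) 𝓘(ℝ, ℝ) 1 f := hf.of_le (by norm_num)
  have hh2 : ContMDiff (𝓡 n) 𝓘(ℝ, ℝ) 2 h := hh.of_le ENat.LEInfty.out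
  refine contMDiff_of_inChart ENat.LEInfty.out fun x => ?_
  have hG := isMetricOn_metricMatrix g x
  refine ContDiffOn.congr ?_ fun u hu => inChart_wittenLaplacian hf1 hh2 x hu
  have hW : ContDiffOn ℝ 2 (chartDensity g f x) (extChartAt (𝓡 n) x).target :=
    hG.contDiffOn_dens ENat.LEInfty.out (contDiffOn_inChart hf ENat.LEInfty.out x)
  refine ContDiffOn.mul ((hW.of_le (by norm_num)).inv fun u hu => (chartDensity_pos hu).ne')
    (ContDiffOn.sum fun i _ => contDiffOn_pd (k := 2) hG.isOpen (hW.mul ?_) (by norm_num) i)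
  exact (hG.contDiffOn_grad (m := ∞) (contDiffOn_inChart hh le_rfl x) (by simp) le_rfl i).of_le
    ENat.LEInfty.out

/-- The Bochner formula. -/
theorem bochner_manifold (hf : ContMDiff (𝓡 n) 𝓘(ℝ, ℝ) 2 f) (hh : ContMDiff (𝓡 n) 𝓘(ℝ, ℝ) ∞ h)
    (x : M) : wittenLaplacian g f (fun y => 1 / 2 * carre g h h y) x
        - carre g h (wittenLaplacian g f h) x
      = hessianHSSq g h x + bakryEmery g f x (grad g h x) := by
  have hf1 : ContMDiff (𝓡 n) 𝓘(ℝ, ℝ) 1 f := hf.of_le (by norm_num)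
  have hh2 : ContMDiff (𝓡 n) 𝓘(ℝ, ℝ) 2 h := hh.of_le ENat.LEInfty.out
  have hh1 : ContMDiff (𝓡 n) 𝓘(ℝ, ℝ) 1 h := hh.of_le ENat.LEInfty.out
  have hG := isMetricOn_metricMatrix g x
  have hx := mem_extChartAt_source (I := 𝓡 n) x
  have hc : ContMDiff (𝓡 n) 𝓘(ℝ, ℝ) ∞ (fun y => 1 / 2 * carre g h h y) :=
    contMDiff_const.mul (contMDiff_carre hh hh (by simp) le_rfl)
  rw [wittenLaplacian_eq g f (hc.of_le ENat.LEInfty.out),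
    IsMetricOn.lapOf_congr (h' := fun v => 1 / 2 * carreOf (metricMatrix g x) (inChart x h) (inChart x h) v)
      hG.isOpen (coord_mem x) fun v hv => by
        rw [← carre_symm_chart g hv (mdifferentiableAt_of_one hh1 _)
          (mdifferentiableAt_of_one hh1 _)]
        rfl,
    carre_chart g hx (mdifferentiableAt_of_one hh1 x)
      (mdifferentiableAt_of_one (contMDiff_wittenLaplacian hf hh) x),
    bakryEmery_grad g f (mdifferentiableAt_of_one hh1 x), hessianHSSq_eq,
    ← hG.bochner (coord_mem x) (contDiffOn_inChart hf ENat.LEInfty.out x)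
      (contDiffOn_inChart hh le_rfl x)]
  congr 1
  refine Finset.sum_congr rfl fun i _ => ?_
  -- Since `Lh` is differentiated, its expression in the chart at `x` is needed on a neighbourhood,
  -- and here independence of the chart is essential.
  rw [pd_congr i hG.isOpen ((extChartAt (𝓡 n) x).map_source hx)
    fun v hv => inChart_wittenLaplacian hf1 hh2 x hv]
  rfl

end IntegrationByParts

/-! ### Time derivatives in coordinates, up to the endpoints of the interval. -/

section TimeDependentCoordinates

variable {n : ℕ} {J : Set ℝ} {U : Set (EuclideanSpace ℝ (Fin n))} {u : EuclideanSpace ℝ (Fin n)}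
  {F : ℝ → EuclideanSpace ℝ (Fin n) → ℝ} {t : ℝ}

theorem interior_nonempty_of_ordConnected (hJ : J.OrdConnected) (hJ' : J.Nontrivial) :
    (interior J).Nonempty := by
  obtain ⟨a, ha, b, hb, hab⟩ := hJ'.exists_lt
  refine (nonempty_Ioo.2 hab).mono ?_
  rw [← interior_Icc]
  exact interior_mono (hJ.out ha hb)

theorem uniqueDiffOn_of_ordConnected (hJ : J.OrdConnected) (hJ' : J.Nontrivial) :
    UniqueDiffOn ℝ J :=
  uniqueDiffOn_convex hJ.convex (interior_nonempty_of_ordConnected hJ hJ')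

theorem subset_closure_interior_of_ordConnected (hJ : J.OrdConnected) (hJ' : J.Nontrivial) :
    J ⊆ closure (interior J) := by
  rw [Convex.closure_interior_eq_closure_of_nonempty_interior (𝕜 := ℝ) hJ.convex
    (interior_nonempty_of_ordConnected hJ hJ')]
  exact subset_closure

theorem hasDerivWithinAt_time (hF : ContDiffOn ℝ 1 (fun p : ℝ × _ => F p.1 p.2) (J ×ˢ U))
    (ht : t ∈ J) (hu : u ∈ U) : HasDerivWithinAt (fun s => F s u)
      (fderivWithin ℝ (fun p : ℝ × _ => F p.1 p.2) (J ×ˢ U) (t, u) (1, 0)) J t := by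
  have h1 := (hF.differentiableOn one_ne_zero (t, u) ⟨ht, hu⟩).hasFDerivWithinAt
  have h2 : HasDerivWithinAt (fun s : ℝ => (s, u)) ((1 : ℝ), (0 : EuclideanSpace ℝ (Fin n))) J t :=
    (hasDerivWithinAt_id t J).prodMk (hasDerivWithinAt_const t J u)
  exact h1.comp_hasDerivWithinAt (f := fun s => (s, u)) t h2 fun s hs => ⟨hs, hu⟩

/-- Expresses a space derivative at fixed time through the joint derivative within `J ×ˢ U`, so that
its joint regularity is inherited. -/
theorem pd_slice (hU : IsOpen U) (hF : ContDiffOn ℝ 1 (fun p : ℝ × _ => F p.1 p.2) (J ×ˢ U))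
    (i : Fin n) (ht : t ∈ J) (hu : u ∈ U) : pd i (F t) u
      = fderivWithin ℝ (fun p : ℝ × _ => F p.1 p.2) (J ×ˢ U) (t, u)
        (0, EuclideanSpace.single i 1) := by
  have h1 := (hF.differentiableOn one_ne_zero (t, u) ⟨ht, hu⟩).hasFDerivWithinAt
  have h2 : HasFDerivWithinAt (fun v : EuclideanSpace ℝ (Fin n) => (t, v))
      (ContinuousLinearMap.inr ℝ ℝ (EuclideanSpace ℝ (Fin n))) U u :=
    (hasFDerivAt_prodMk_right t u).hasFDerivWithinAt
  have h3 := (h1.comp u h2 fun v hv => ⟨ht, hv⟩).hasFDerivAt (hU.mem_nhds hu)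
  unfold pd
  rw [show F t = (fun p : ℝ × EuclideanSpace ℝ (Fin n) => F p.1 p.2) ∘ fun v => (t, v) from rfl,
    h3.fderiv]
  rfl

theorem contDiffOn_slice {k : WithTop ℕ∞}
    (hF : ContDiffOn ℝ k (fun p : ℝ × _ => F p.1 p.2) (J ×ˢ U)) (ht : t ∈ J) :
    ContDiffOn ℝ k (F t) U :=
  hF.comp (contDiff_const.prodMk contDiff_id).contDiffOn fun _ hv => ⟨ht, hv⟩

theorem continuousOn_pd_slice (hJ : UniqueDiffOn ℝ J) (hU : IsOpen U)
    (hF : ContDiffOn ℝ 1 (fun p : ℝ × _ => F p.1 p.2) (J ×ˢ U)) (i : Fin n) :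
    ContinuousOn (fun p : ℝ × _ => pd i (F p.1) p.2) (J ×ˢ U) :=
  ((hF.continuousOn_fderivWithin (hJ.prod hU.uniqueDiffOn) le_rfl).clm_apply
    continuousOn_const).congr fun _ hp => pd_slice hU hF i hp.1 hp.2

variable (hJ : UniqueDiffOn ℝ J) (hU : IsOpen U)
  (hF : ContDiffOn ℝ ∞ (fun p : ℝ × _ => F p.1 p.2) (J ×ˢ U))
include hJ hU hF

theorem contDiffOn_fderivWithin_apply (v : ℝ × EuclideanSpace ℝ (Fin n)) :
    ContDiffOn ℝ ∞ (fun p => fderivWithin ℝ (fun p : ℝ × _ => F p.1 p.2) (J ×ˢ U) p v)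
      (J ×ˢ U) :=
  (hF.fderivWithin (hJ.prod hU.uniqueDiffOn) (by simp)).clm_apply contDiffOn_const

theorem contDiffOn_pd_slice (i : Fin n) :
    ContDiffOn ℝ ∞ (fun p : ℝ × _ => pd i (F p.1) p.2) (J ×ˢ U) :=
  (contDiffOn_fderivWithin_apply hJ hU hF _).congr fun _ hp =>
    pd_slice hU (hF.of_le ENat.LEInfty.out) i hp.1 hp.2

theorem contDiffOn_derivWithin_time :
    ContDiffOn ℝ ∞ (fun p : ℝ × _ => derivWithin (fun s => F s p.2) J p.1) (J ×ˢ U) :=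
  (contDiffOn_fderivWithin_apply hJ hU hF (1, 0)).congr fun p hp =>
    (hasDerivWithinAt_time (hF.of_le ENat.LEInfty.out) hp.1 hp.2).derivWithin (hJ p.1 hp.1)

/-- The second derivative within `J ×ˢ U` is symmetric at points of the closure of the interior, and
`hJc` places even the endpoints of `J` there. -/
theorem hasDerivWithinAt_pd (hJc : J ⊆ closure (interior J)) (i : Fin n) (ht : t ∈ J)
    (hu : u ∈ U) : HasDerivWithinAt (fun s => pd i (F s) u)
      (pd i (fun v => derivWithin (fun s => F s v) J t) u) J t := by
  have hF1 : ContDiffOn ℝ 1 (fun p : ℝ × _ => F p.1 p.2) (J ×ˢ U) := hF.of_le ENat.LEInfty.out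
  have hS := hJ.prod hU.uniqueDiffOn
  have hp : (t, u) ∈ J ×ˢ U := ⟨ht, hu⟩
  have h1 := hasDerivWithinAt_time (F := fun t v => pd i (F t) v) ((contDiffOn_pd_slice hJ hU hF i).of_le ENat.LEInfty.out) ht hu
  have h2 := pd_slice (F := fun t v => derivWithin (fun s => F s v) J t) hU
    ((contDiffOn_derivWithin_time hJ hU hF).of_le ENat.LEInfty.out) i ht hu
  rw [h2]
  convert h1 using 1
  have hd : ∀ v w : ℝ × EuclideanSpace ℝ (Fin n),
      fderivWithin ℝ (fun p => fderivWithin ℝ (fun p : ℝ × _ => F p.1 p.2) (J ×ˢ U) p v)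
        (J ×ˢ U) (t, u) w
      = fderivWithin ℝ (fderivWithin ℝ (fun p : ℝ × _ => F p.1 p.2) (J ×ˢ U))
        (J ×ˢ U) (t, u) w v := fun v w => by
    have hdiff : DifferentiableWithinAt ℝ
        (fderivWithin ℝ (fun p : ℝ × _ => F p.1 p.2) (J ×ˢ U)) (J ×ˢ U) (t, u) :=
      (hF.fderivWithin (m := ∞) hS (by simp)).differentiableOn (by simp) _ hp
    rw [fderivWithin_clm_apply (hS _ hp) hdiff (differentiableWithinAt_const v)]
    simp
  have e1 : EqOn (fun p : ℝ × _ => derivWithin (fun s => F s p.2) J p.1) (fun p => fderivWithin ℝ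
      (fun p : ℝ × _ => F p.1 p.2) (J ×ˢ U) p (1, 0)) (J ×ˢ U) := fun p hp =>
    (hasDerivWithinAt_time hF1 hp.1 hp.2).derivWithin (hJ p.1 hp.1)
  have e2 : EqOn (fun p : ℝ × _ => pd i (F p.1) p.2) (fun p => fderivWithin ℝ
      (fun p : ℝ × _ => F p.1 p.2) (J ×ˢ U) p (0, EuclideanSpace.single i 1)) (J ×ˢ U) :=
    fun p hp => pd_slice hU hF1 i hp.1 hp.2
  rw [fderivWithin_congr e1 (e1 hp), fderivWithin_congr e2 (e2 hp), hd, hd]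
  refine (hF _ hp).isSymmSndFDerivWithinAt (by simpa using ENat.LEInfty.out) hS ?_ hp _ _
  rw [interior_prod_eq, closure_prod_eq, hU.interior_eq]
  exact ⟨hJc ht, subset_closure hu⟩

theorem IsMetricOn.contDiffOn_grad_time {G : EuclideanSpace ℝ (Fin n) → Matrix (Fin n) (Fin n) ℝ}
    (hG : IsMetricOn G U) (i : Fin n) :
    ContDiffOn ℝ ∞ (fun p : ℝ × _ => gradOf G (F p.1) i p.2) (J ×ˢ U) :=
  ContDiffOn.sum fun j _ => ((hG.contDiffOn_inv i j).comp contDiff_snd.contDiffOn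
    fun _ hp => hp.2).mul (contDiffOn_pd_slice hJ hU hF j)

theorem hasDerivWithinAt_gradOf
    {G : EuclideanSpace ℝ (Fin n) → Matrix (Fin n) (Fin n) ℝ}
    (hJc : J ⊆ closure (interior J)) (i : Fin n) (ht : t ∈ J) (hu : u ∈ U) :
    HasDerivWithinAt (fun s => gradOf G (F s) i u)
      (gradOf G (fun v => derivWithin (fun s => F s v) J t) i u) J t :=
  HasDerivWithinAt.fun_sum fun j _ => (hasDerivWithinAt_pd hJ hU hF hJc j ht hu).const_mul _

/-- In the non-divergence form `lapOf_eq` the weight occurs only through the first derivatives of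
`ψ`, which are `C¹`; all other factors are smooth. -/
theorem IsMetricOn.contDiffOn_lapOf_time
    {G : EuclideanSpace ℝ (Fin n) → Matrix (Fin n) (Fin n) ℝ}
    (hG : IsMetricOn G U) {ψ : EuclideanSpace ℝ (Fin n) → ℝ} (hψ : ContDiffOn ℝ 2 ψ U) :
    ContDiffOn ℝ 1 (fun p : ℝ × _ => lapOf G ψ (F p.1) p.2) (J ×ˢ U) := by
  have hc : ∀ {c : EuclideanSpace ℝ (Fin n) → ℝ}, ContDiffOn ℝ 1 c U →
      ContDiffOn ℝ 1 (fun p : ℝ × EuclideanSpace ℝ (Fin n) => c p.2) (J ×ˢ U) := fun hc =>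
    hc.comp contDiff_snd.contDiffOn fun _ hp => hp.2
  have hg := hG.contDiffOn_grad_time hJ hU hF
  refine ContDiffOn.congr (f := fun p : ℝ × _ => ∑ i, pd i (gradOf G (F p.1) i) p.2
      + ∑ i, ((∑ j, christoffelOf G j i j p.2) - pd i ψ p.2) * gradOf G (F p.1) i p.2) ?_
    fun p hp => hG.lapOf_eq hp.2 (hψ.of_le (by norm_num))
      ((contDiffOn_slice hF hp.1).of_le ENat.LEInfty.out)
  refine (ContDiffOn.sum fun i _ => ?_).add (ContDiffOn.sum fun i _ => ?_)
  · exact (contDiffOn_pd_slice (F := fun t v => gradOf G (F t) i v) hJ hU (hg i) i).of_le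
      ENat.LEInfty.out
  · refine ((hc (ContDiffOn.sum fun j _ => (hG.contDiffOn_christoffel j i j).of_le
      ENat.LEInfty.out)).sub (hc ?_)).mul ((hg i).of_le ENat.LEInfty.out)
    exact contDiffOn_pd (m := 1) hU hψ (by norm_num) i

theorem IsMetricOn.hasDerivWithinAt_lapOf
    {G : EuclideanSpace ℝ (Fin n) → Matrix (Fin n) (Fin n) ℝ}
    (hG : IsMetricOn G U) {ψ : EuclideanSpace ℝ (Fin n) → ℝ} (hψ : ContDiffOn ℝ 1 ψ U)
    (hJc : J ⊆ closure (interior J)) (ht : t ∈ J) (hu : u ∈ U) :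
    HasDerivWithinAt (fun s => lapOf G ψ (F s) u)
      (lapOf G ψ (fun v => derivWithin (fun s => F s v) J t) u) J t := by
  have hslice : ∀ s ∈ J, ContDiffOn ℝ 2 (F s) U := fun s hs =>
    (contDiffOn_slice hF hs).of_le ENat.LEInfty.out
  have hF' : ContDiffOn ℝ 2 (fun v => derivWithin (fun s => F s v) J t) U :=
    (contDiffOn_slice (F := fun t v => derivWithin (fun s => F s v) J t)
      (contDiffOn_derivWithin_time hJ hU hF) ht).of_le ENat.LEInfty.out
  have hg := hG.contDiffOn_grad_time hJ hU hF
  have hg' := fun (i : Fin n) {v} hv =>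
    hasDerivWithinAt_gradOf (G := G) (u := v) hJ hU hF hJc i ht hv
  rw [hG.lapOf_eq hu hψ hF']
  refine HasDerivWithinAt.congr (f := fun s => ∑ i, pd i (gradOf G (F s) i) u
      + ∑ i, ((∑ j, christoffelOf G j i j u) - pd i ψ u) * gradOf G (F s) i u) ?_
    (fun s hs => hG.lapOf_eq hu hψ (hslice s hs)) (hG.lapOf_eq hu hψ (hslice t ht))
  refine (HasDerivWithinAt.fun_sum fun i _ => ?_).add
    (HasDerivWithinAt.fun_sum fun i _ => (hg' i hu).const_mul _)
  -- Time and space derivatives are exchanged a second time, now on the components of the gradient.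
  rw [← pd_congr i hU hu fun v hv => (hg' i hv).derivWithin (hJ t ht)]
  exact hasDerivWithinAt_pd (F := fun t v => gradOf G (F t) i v) hJ hU (hg i) hJc i ht hu

end TimeDependentCoordinates

/-! ### Time-dependent functions on the manifold. -/

section TimeDependentFunctions

open Topology

variable {n : ℕ} {M : Type u} [TopologicalSpace M]
  [ChartedSpace (EuclideanSpace ℝ (Fin n)) M] [IsManifold (𝓡 n) ∞ M]

/-- `F` is smooth in `(t, x)`, `t ∈ J`, when written in each chart. -/
def TimeSmooth (n : ℕ) {M : Type u} [TopologicalSpace M]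
    [ChartedSpace (EuclideanSpace ℝ (Fin n)) M] (J : Set ℝ) (F : ℝ → M → ℝ) : Prop :=
  ∀ x : M, ContDiffOn ℝ ∞ (fun p : ℝ × EuclideanSpace ℝ (Fin n) => inChart x (F p.1) p.2)
    (J ×ˢ (extChartAt (𝓡 n) x).target)

/-- The time derivative on `J`. -/
def timeDeriv (J : Set ℝ) (F : ℝ → M → ℝ) (t : ℝ) (x : M) : ℝ := derivWithin (fun s => F s x) J t

variable {J : Set ℝ} {F K : ℝ → M → ℝ} {t : ℝ}

theorem continuousOn_of_inChart
    (hF : ∀ x : M, ContinuousOn (fun p : ℝ × EuclideanSpace ℝ (Fin n) => inChart x (F p.1) p.2)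
      (J ×ˢ (extChartAt (𝓡 n) x).target)) :
    ContinuousOn (fun p : ℝ × M => F p.1 p.2) (J ×ˢ univ) := by
  rintro ⟨t, x⟩ ⟨ht, -⟩
  have hS : univ ×ˢ (extChartAt (𝓡 n) x).source ∈ 𝓝 (t, x) :=
    prod_mem_nhds Filter.univ_mem (extChartAt_source_mem_nhds x)
  have h1 : ContinuousOn (fun p : ℝ × M => (p.1, extChartAt (𝓡 n) x p.2))
      (J ×ˢ (extChartAt (𝓡 n) x).source) :=
    continuous_fst.continuousOn.prodMk ((continuousOn_extChartAt x).comp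
      continuous_snd.continuousOn fun _ hp => hp.2)
  have h2 := (hF x).comp h1 fun p hp => ⟨hp.1, (extChartAt (𝓡 n) x).map_source hp.2⟩
  have h3 := (h2 (t, x) ⟨ht, mem_extChartAt_source x⟩).congr
    (g := fun p : ℝ × M => F p.1 p.2)
    (fun p hp => (inChart_chart hp.2 (F p.1)).symm)
    (inChart_chart (mem_extChartAt_source x) (F t)).symm
  refine h3.mono_of_mem_nhdsWithin ?_
  filter_upwards [self_mem_nhdsWithin, mem_nhdsWithin_of_mem_nhds hS] with p hp hp'
  exact ⟨hp.1, hp'.2⟩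

theorem timeSmooth_of_contMDiffOn (hF : ContMDiffOn (𝓘(ℝ, ℝ).prod (𝓡 n)) 𝓘(ℝ, ℝ) ∞
    (fun p : ℝ × M => F p.1 p.2) (J ×ˢ univ)) : TimeSmooth n J F := by
  intro x
  rw [← contMDiffOn_iff_contDiffOn, modelWithCornersSelf_prod, ← chartedSpaceSelf_prod]
  refine hF.comp (contMDiffOn_fst.prodMk ((contMDiffOn_extChartAt_symm x).comp contMDiffOn_snd
    fun _ hp => hp.2)) fun p hp => ⟨hp.1, mem_univ _⟩

namespace TimeSmooth

theorem continuousOn (hF : TimeSmooth n J F) :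
    ContinuousOn (fun p : ℝ × M => F p.1 p.2) (J ×ˢ univ) :=
  continuousOn_of_inChart (n := n) fun x => (hF x).continuousOn

theorem slice (hF : TimeSmooth n J F) (ht : t ∈ J) : ContMDiff (𝓡 n) 𝓘(ℝ, ℝ) ∞ (F t) :=
  contMDiff_of_inChart le_rfl fun x => contDiffOn_slice (F := fun t u => inChart x (F t) u) (hF x) ht

theorem slice_one (hF : TimeSmooth n J F) (ht : t ∈ J) : ContMDiff (𝓡 n) 𝓘(ℝ, ℝ) 1 (F t) :=
  (hF.slice ht).of_le ENat.LEInfty.out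

theorem slice_two (hF : TimeSmooth n J F) (ht : t ∈ J) : ContMDiff (𝓡 n) 𝓘(ℝ, ℝ) 2 (F t) :=
  (hF.slice ht).of_le ENat.LEInfty.out

theorem mul (hF : TimeSmooth n J F) (hK : TimeSmooth n J K) :
    TimeSmooth n J fun t x => F t x * K t x := fun x => (hF x).mul (hK x)

theorem rpow_const (hF : TimeSmooth n J F) (hpos : ∀ t ∈ J, ∀ x, 0 < F t x) (p : ℝ) :
    TimeSmooth n J fun t x => F t x ^ p := fun x =>
  (hF x).rpow_const_of_ne fun q hq => (hpos q.1 hq.1 _).ne'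

theorem carre (g : SmoothMetric n M) (hJ : UniqueDiffOn ℝ J) (hF : TimeSmooth n J F)
    (hK : TimeSmooth n J K) : TimeSmooth n J fun t => carre g (F t) (K t) := fun x => by
  refine ContDiffOn.congr (f := fun p : ℝ × EuclideanSpace ℝ (Fin n) =>
    carreOf (metricMatrix g x) (inChart x (F p.1)) (inChart x (K p.1)) p.2) ?_ fun p hp =>
    carre_symm_chart g hp.2 (mdifferentiableAt_of_one (hF.slice_one hp.1) _)
      (mdifferentiableAt_of_one (hK.slice_one hp.1) _)
  have hG := isMetricOn_metricMatrix g x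
  exact ContDiffOn.sum fun i _ =>
    (IsMetricOn.contDiffOn_grad_time (F := fun t => inChart x (F t)) hJ hG.isOpen (hF x) hG i).mul
      (contDiffOn_pd_slice (F := fun t => inChart x (K t)) hJ hG.isOpen (hK x) i)

theorem deriv (hJ : UniqueDiffOn ℝ J) (hF : TimeSmooth n J F) :
    TimeSmooth n J (timeDeriv J F) := fun x =>
  contDiffOn_derivWithin_time (F := fun t => inChart x (F t)) hJ (isOpen_extChartAt_target x) (hF x)

theorem hasDerivWithinAt (hF : TimeSmooth n J F) (ht : t ∈ J) (x : M) :
    HasDerivWithinAt (fun s => F s x) (timeDeriv J F t x) J t := by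
  have h := (hasDerivWithinAt_time (F := fun t => inChart x (F t)) ((hF x).of_le ENat.LEInfty.out) ht
    (coord_mem x)).differentiableWithinAt.hasDerivWithinAt
  simpa only [inChart_coord, timeDeriv] using h

variable {g : SmoothMetric n M} {f : M → ℝ} (hJ : UniqueDiffOn ℝ J)
include hJ

theorem hasDerivWithinAt_carre (hJc : J ⊆ closure (interior J)) (hF : TimeSmooth n J F)
    (hK : TimeSmooth n J K) (ht : t ∈ J) (x : M) :
    HasDerivWithinAt (fun s => LangevinRenyi.carre g (F s) (K s) x)
      (LangevinRenyi.carre g (timeDeriv J F t) (K t) x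
        + LangevinRenyi.carre g (F t) (timeDeriv J K t) x) J t := by
  have hx := mem_extChartAt_source (I := 𝓡 n) x
  have hU := isOpen_extChartAt_target (I := 𝓡 n) x
  have hu := coord_mem (n := n) x
  have hm : ∀ {A : ℝ → M → ℝ}, TimeSmooth n J A → ∀ s ∈ J,
      MDifferentiableAt (𝓡 n) 𝓘(ℝ, ℝ) (A s) x := fun hA s hs =>
    mdifferentiableAt_of_one (hA.slice_one hs) x
  rw [carre_chart g hx (hm (hF.deriv hJ) t ht) (hm hK t ht),
    carre_chart g hx (hm hF t ht) (hm (hK.deriv hJ) t ht)]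
  refine HasDerivWithinAt.congr (f := fun s => carreOf (metricMatrix g x) (inChart x (F s))
    (inChart x (K s)) (extChartAt (𝓡 n) x x)) ?_
    (fun s hs => carre_chart g hx (hm hF s hs) (hm hK s hs))
    (carre_chart g hx (hm hF t ht) (hm hK t ht))
  unfold carreOf
  rw [← Finset.sum_add_distrib]
  exact HasDerivWithinAt.fun_sum fun i _ =>
    (hasDerivWithinAt_gradOf (F := fun t => inChart x (F t)) hJ hU (hF x) hJc i ht hu).fun_mul
      (hasDerivWithinAt_pd (F := fun t => inChart x (K t)) hJ hU (hK x) hJc i ht hu)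

section Laplacian

variable [MeasurableSpace M] [BorelSpace M] [SecondCountableTopology M] [T2Space M]

theorem contDiffOn_wittenLaplacian (hf : ContMDiff (𝓡 n) 𝓘(ℝ, ℝ) 2 f) (hF : TimeSmooth n J F)
    (x : M) : ContDiffOn ℝ 1 (fun p : ℝ × EuclideanSpace ℝ (Fin n) =>
      inChart x (wittenLaplacian g f (F p.1)) p.2) (J ×ˢ (extChartAt (𝓡 n) x).target) :=
  (IsMetricOn.contDiffOn_lapOf_time (F := fun t => inChart x (F t)) hJ
    (isOpen_extChartAt_target x) (hF x) (isMetricOn_metricMatrix g x)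
    (contDiffOn_inChart hf ENat.LEInfty.out x)).congr fun p hp =>
      inChart_wittenLaplacian (hf.of_le (by norm_num)) (hF.slice_two hp.1) x hp.2

theorem continuousOn_wittenLaplacian (hf : ContMDiff (𝓡 n) 𝓘(ℝ, ℝ) 2 f) (hF : TimeSmooth n J F) :
    ContinuousOn (fun p : ℝ × M => wittenLaplacian g f (F p.1) p.2) (J ×ˢ univ) :=
  continuousOn_of_inChart (n := n) (F := fun t => wittenLaplacian g f (F t)) fun x =>
    (contDiffOn_wittenLaplacian hJ hf hF x).continuousOn

theorem continuousOn_carre_wittenLaplacian (hf : ContMDiff (𝓡 n) 𝓘(ℝ, ℝ) 2 f)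
    (hF : TimeSmooth n J F) : ContinuousOn (fun p : ℝ × M =>
      LangevinRenyi.carre g (F p.1) (wittenLaplacian g f (F p.1)) p.2) (J ×ˢ univ) := by
  refine continuousOn_of_inChart (n := n)
    (F := fun t => LangevinRenyi.carre g (F t) (wittenLaplacian g f (F t))) fun x => ?_
  have hG := isMetricOn_metricMatrix g x
  refine ContinuousOn.congr (f := fun p : ℝ × EuclideanSpace ℝ (Fin n) =>
    carreOf (metricMatrix g x) (inChart x (F p.1)) (inChart x (wittenLaplacian g f (F p.1))) p.2)
    (continuousOn_finsetSum _ fun i _ => ContinuousOn.mul ?_ ?_) fun p hp =>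
    carre_symm_chart g hp.2 (mdifferentiableAt_of_one (hF.slice_one hp.1) _)
      (mdifferentiableAt_of_one (contMDiff_wittenLaplacian hf (hF.slice hp.1)) _)
  · exact (IsMetricOn.contDiffOn_grad_time (F := fun t => inChart x (F t)) hJ hG.isOpen (hF x)
      hG i).continuousOn
  · exact continuousOn_pd_slice (F := fun t => inChart x (wittenLaplacian g f (F t))) hJ hG.isOpen
      (contDiffOn_wittenLaplacian hJ hf hF x) i

end Laplacian

theorem hasDerivWithinAt_wittenLaplacian (hf : ContMDiff (𝓡 n) 𝓘(ℝ, ℝ) 1 f)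
    (hJc : J ⊆ closure (interior J)) (hF : TimeSmooth n J F) (ht : t ∈ J) (x : M) :
    HasDerivWithinAt (fun s => wittenLaplacian g f (F s) x)
      (wittenLaplacian g f (timeDeriv J F t) x) J t := by
  rw [wittenLaplacian_eq g f ((hF.deriv hJ).slice_one ht)]
  exact (IsMetricOn.hasDerivWithinAt_lapOf (F := fun t => inChart x (F t)) hJ
    (isOpen_extChartAt_target x) (hF x) (isMetricOn_metricMatrix g x)
    (contDiffOn_inChart hf ENat.LEInfty.out x) hJc ht (coord_mem x)).congr
    (fun s hs => wittenLaplacian_eq g f (hF.slice_one hs) x)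
    (wittenLaplacian_eq g f (hF.slice_one ht) x)

end TimeSmooth

end TimeDependentFunctions

/-! ### Differentiation under the integral sign, with and without cutoffs. -/

section IntegralsDependingOnTime

open Topology Filter

variable {J : Set ℝ} {t : ℝ}

/-- If `t` is an endpoint of `J`, then one end of the interval is `t` itself. Bounds on compact
subintervals are thereby available on a relative neighbourhood of every time. -/
theorem exists_Icc_mem_nhdsWithin (ht : t ∈ J) :
    ∃ a ∈ J, ∃ b ∈ J, Icc a b ∈ 𝓝[J] t ∧ t ∈ Icc a b := by
  obtain ⟨a, ha, hat, hna⟩ : ∃ a ∈ J, a ≤ t ∧ Ici a ∈ 𝓝[J] t := by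
    by_cases h : ∃ a ∈ J, a < t
    · obtain ⟨a, ha, hat⟩ := h
      exact ⟨a, ha, hat.le, mem_nhdsWithin_of_mem_nhds (Ici_mem_nhds hat)⟩
    · push Not at h
      exact ⟨t, ht, le_rfl, mem_of_superset self_mem_nhdsWithin h⟩
  obtain ⟨b, hb, htb, hnb⟩ : ∃ b ∈ J, t ≤ b ∧ Iic b ∈ 𝓝[J] t := by
    by_cases h : ∃ b ∈ J, t < b
    · obtain ⟨b, hb, htb⟩ := h
      exact ⟨b, hb, htb.le, mem_nhdsWithin_of_mem_nhds (Iic_mem_nhds htb)⟩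
    · push Not at h
      exact ⟨t, ht, le_rfl, mem_of_superset self_mem_nhdsWithin h⟩
  exact ⟨a, ha, b, hb, inter_mem hna hnb, hat, htb⟩

theorem norm_sub_le_of_hasDerivWithinAt (hJ : J.OrdConnected) {φ φ' : ℝ → ℝ}
    (hφ : ∀ s ∈ J, HasDerivWithinAt φ (φ' s) J s) {a b C : ℝ} (ha : a ∈ J) (hb : b ∈ J)
    (hC : ∀ s ∈ Icc a b, |φ' s| ≤ C) {s r : ℝ} (hs : s ∈ Icc a b) (hr : r ∈ Icc a b) :
    |φ s - φ r| ≤ C * |s - r| :=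
  Convex.norm_image_sub_le_of_norm_hasDerivWithin_le (f' := φ')
    (fun x hx => (hφ x (hJ.out ha hb hx)).mono (hJ.out ha hb)) hC (convex_Icc a b) hr hs

variable {X : Type*} [TopologicalSpace X] [MeasurableSpace X] {μ : Measure X}
  {F G K D : ℝ → X → ℝ}

namespace LocallyUniformlyIntegrable

theorem mono (hJ : J.OrdConnected) (hF : LocallyUniformlyIntegrable μ J F)
    (h : ∀ t ∈ J, ∀ x, |K t x| ≤ F t x) : LocallyUniformlyIntegrable μ J K := by
  intro a ha b hb
  obtain ⟨B, hB, hFB⟩ := hF a ha b hb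
  exact ⟨B, hB, fun t ht x => (h t (hJ.out ha hb ht) x).trans
    ((le_abs_self _).trans (hFB t ht x))⟩

theorem congr (hJ : J.OrdConnected) (hF : LocallyUniformlyIntegrable μ J F)
    (h : ∀ t ∈ J, ∀ x, K t x = F t x) : LocallyUniformlyIntegrable μ J K := by
  intro a ha b hb
  obtain ⟨B, hB, hFB⟩ := hF a ha b hb
  refine ⟨B, hB, fun t ht x => ?_⟩
  rw [h t (hJ.out ha hb ht) x]
  exact hFB t ht x

theorem add (hF : LocallyUniformlyIntegrable μ J F) (hK : LocallyUniformlyIntegrable μ J K) :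
    LocallyUniformlyIntegrable μ J fun t x => F t x + K t x := by
  intro a ha b hb
  obtain ⟨B, hB, hFB⟩ := hF a ha b hb
  obtain ⟨C, hC, hKC⟩ := hK a ha b hb
  exact ⟨fun x => B x + C x, hB.add hC, fun t ht x =>
    (abs_add_le _ _).trans (add_le_add (hFB t ht x) (hKC t ht x))⟩

theorem const_mul (hF : LocallyUniformlyIntegrable μ J F) (c : ℝ) :
    LocallyUniformlyIntegrable μ J fun t x => c * F t x := by
  intro a ha b hb
  obtain ⟨B, hB, hFB⟩ := hF a ha b hb
  refine ⟨fun x => |c| * B x, hB.const_mul _, fun t ht x => ?_⟩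
  rw [abs_mul]
  exact mul_le_mul_of_nonneg_left (hFB t ht x) (abs_nonneg c)

theorem integrable (hF : LocallyUniformlyIntegrable μ J F) (ht : t ∈ J)
    (hm : AEStronglyMeasurable (F t) μ) : Integrable (F t) μ := by
  obtain ⟨B, hB, hFB⟩ := hF t ht t ht
  exact hB.mono' hm (Eventually.of_forall fun x => hFB t ⟨le_rfl, le_rfl⟩ x)

theorem of_continuousOn [IsFiniteMeasure μ] [CompactSpace X] (hJ : J.OrdConnected)
    (hF : ContinuousOn (fun p : ℝ × X => F p.1 p.2) (J ×ˢ univ)) :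
    LocallyUniformlyIntegrable μ J F := by
  intro a ha b hb
  obtain ⟨C, hC⟩ := (isCompact_Icc.prod isCompact_univ).exists_bound_of_continuousOn
    (hF.mono (prod_mono (hJ.out ha hb) subset_rfl))
  exact ⟨fun _ => C, integrable_const C, fun t ht x => hC (t, x) ⟨ht, mem_univ x⟩⟩

end LocallyUniformlyIntegrable

theorem continuous_slice (hF : ContinuousOn (fun p : ℝ × X => F p.1 p.2) (J ×ˢ univ))
    (ht : t ∈ J) : Continuous (F t) :=
  continuousOn_univ.1 (hF.comp (f := fun x => (t, x)) (by fun_prop) fun x _ => ⟨ht, mem_univ x⟩)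

theorem continuousOn_time (hF : ContinuousOn (fun p : ℝ × X => F p.1 p.2) (J ×ˢ univ)) (x : X) :
    ContinuousOn (fun s => F s x) J :=
  hF.comp (f := fun s => (s, x)) (by fun_prop) fun s hs => ⟨hs, mem_univ x⟩

theorem continuousWithinAt_integral
    (hG : LocallyUniformlyIntegrable μ J G) (hGm : ∀ t ∈ J, AEStronglyMeasurable (G t) μ)
    (hGc : ∀ x, ContinuousOn (fun s => G s x) J) (ht : t ∈ J) :
    ContinuousWithinAt (fun s => ∫ x, G s x ∂μ) J t := by
  obtain ⟨a, ha, b, hb, hab, -⟩ := exists_Icc_mem_nhdsWithin ht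
  obtain ⟨B, hB, hGB⟩ := hG a ha b hb
  refine continuousWithinAt_of_dominated (bound := B) ?_ ?_ hB
    (Eventually.of_forall fun x => hGc x t ht)
  · filter_upwards [self_mem_nhdsWithin] with s hs using hGm s hs
  · filter_upwards [hab] with s hs using Eventually.of_forall fun x => hGB s hs x

/-- Differentiation under the integral sign, within an interval. -/
theorem hasDerivWithinAt_integral_of_dominated (hJ : J.OrdConnected)
    (hF : ∀ t ∈ J, Integrable (F t) μ) (hG : LocallyUniformlyIntegrable μ J G)
    (hFG : ∀ t ∈ J, ∀ x, HasDerivWithinAt (fun s => F s x) (G t x) J t) (ht : t ∈ J) :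
    HasDerivWithinAt (fun s => ∫ x, F s x ∂μ) (∫ x, G t x ∂μ) J t := by
  obtain ⟨a, ha, b, hb, hab, htab⟩ := exists_Icc_mem_nhdsWithin ht
  obtain ⟨B, hB, hGB⟩ := hG a ha b hb
  have hmem : J ∩ Icc a b ∈ 𝓝[J \ {t}] t :=
    nhdsWithin_mono t sdiff_subset (inter_mem self_mem_nhdsWithin hab)
  rw [hasDerivWithinAt_iff_tendsto_slope]
  have h1 : Tendsto (fun s => ∫ x, slope (fun s => F s x) t s ∂μ) (𝓝[J \ {t}] t)
      (𝓝 (∫ x, G t x ∂μ)) := by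
    refine tendsto_integral_filter_of_dominated_convergence B ?_ ?_ hB
      (Eventually.of_forall fun x => hasDerivWithinAt_iff_tendsto_slope.1 (hFG t ht x))
    · filter_upwards [hmem] with s hs
      exact (((hF s hs.1).sub (hF t ht)).aestronglyMeasurable.const_smul ((s - t)⁻¹ : ℝ))
    · filter_upwards [hmem, self_mem_nhdsWithin] with s hs hst
      refine Eventually.of_forall fun x => ?_
      have h2 : s - t ≠ 0 := sub_ne_zero.2 hst.2
      -- By the mean value inequality the difference quotients inherit the integrable bound of the
      -- derivatives.
      have h3 := norm_sub_le_of_hasDerivWithinAt hJ (fun r hr => hFG r hr x) ha hb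
        (fun r hr => hGB r hr x) hs.2 htab
      rw [slope_def_field, Real.norm_eq_abs, abs_div, div_le_iff₀ (abs_pos.2 h2)]
      exact h3
  refine h1.congr' ?_
  filter_upwards [hmem] with s hs
  simp only [slope_def_field]
  rw [integral_div, integral_sub (hF s hs.1) (hF t ht)]

/-- Differentiation of an integral that is approximated by cut off integrals. -/
theorem hasDerivWithinAt_integral_of_cutoff (hJ : J.OrdConnected)
    {χ : ℕ → X → ℝ} (hχm : ∀ k, AEStronglyMeasurable (χ k) μ) (hχ0 : ∀ k x, 0 ≤ χ k x)
    (hχ1 : ∀ k x, χ k x ≤ 1) (hχ : ∀ x, Tendsto (fun k => χ k x) atTop (𝓝 1))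
    {ε : ℕ → ℝ} (hε0 : ∀ k, 0 ≤ ε k) (hε : Tendsto ε atTop (𝓝 0)) {E : ℕ → ℝ → X → ℝ}
    (hFm : ∀ t ∈ J, AEStronglyMeasurable (F t) μ) (hF : LocallyUniformlyIntegrable μ J F)
    (hGm : ∀ t ∈ J, AEStronglyMeasurable (G t) μ) (hG : LocallyUniformlyIntegrable μ J G)
    (hGc : ∀ x, ContinuousOn (fun s => G s x) J) (hD : LocallyUniformlyIntegrable μ J D)
    (hE : ∀ k, ∀ t ∈ J, ∀ x, |E k t x| ≤ ε k * D t x)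
    (hder : ∀ k, ∀ t ∈ J, HasDerivWithinAt (fun s => ∫ x, χ k x * F s x ∂μ)
      (∫ x, χ k x * G t x ∂μ + ∫ x, E k t x ∂μ) J t) (ht : t ∈ J) :
    HasDerivWithinAt (fun s => ∫ x, F s x ∂μ) (∫ x, G t x ∂μ) J t := by
  obtain ⟨a, ha, b, hb, hab, htab⟩ := exists_Icc_mem_nhdsWithin ht
  obtain ⟨B, hB, hGB⟩ := hG a ha b hb
  obtain ⟨C, hC, hDC⟩ := hD a ha b hb
  have hsub : Icc a b ⊆ J := hJ.out ha hb
  have habs : ∀ k x, |χ k x| ≤ 1 := fun k x => abs_le.2 ⟨by linarith [hχ0 k x], hχ1 k x⟩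
  have hχi : ∀ k {H : X → ℝ}, Integrable H μ → Integrable (fun x => χ k x * H x) μ :=
    fun k H hH => hH.bdd_mul (hχm k) (Eventually.of_forall fun x => habs k x)
  have hlim : ∀ {H : X → ℝ}, Integrable H μ →
      Tendsto (fun k => ∫ x, χ k x * H x ∂μ) atTop (𝓝 (∫ x, H x ∂μ)) := fun {H} hH => by
    refine tendsto_integral_of_dominated_convergence (fun x => ‖H x‖)
      (fun k => (hχi k hH).aestronglyMeasurable) hH.norm (fun k => Eventually.of_forall fun x => ?_)
      (Eventually.of_forall fun x => by simpa using (hχ x).mul_const (H x))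
    rw [norm_mul]
    exact mul_le_of_le_one_left (norm_nonneg _) (habs k x)
  -- `η k` bounds, uniformly on `[a, b]`, the distance from the derivative of the cut-off integral
  -- to `∫ G`: its first part is what the cutoff removes from the dominating function, its second
  -- part the error from the gradient of the cutoff.
  set η : ℕ → ℝ := fun k => (∫ x, B x ∂μ - ∫ x, χ k x * B x ∂μ) + ε k * ∫ x, C x ∂μ with hη
  have hη0 : Tendsto η atTop (𝓝 0) := by
    simpa using ((tendsto_const_nhds (x := ∫ x, B x ∂μ)).sub (hlim hB)).add (hε.mul_const (∫ x, C x ∂μ))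
  have hclose : ∀ k, ∀ s ∈ Icc a b,
      |(∫ x, χ k x * G s x ∂μ + ∫ x, E k s x ∂μ) - ∫ x, G s x ∂μ| ≤ η k := fun k s hs => by
    have hGi := hG.integrable (hsub hs) (hGm s (hsub hs))
    have h1 : |∫ x, χ k x * G s x ∂μ - ∫ x, G s x ∂μ|
        ≤ ∫ x, B x ∂μ - ∫ x, χ k x * B x ∂μ := by
      rw [← integral_sub (hχi k hGi) hGi, ← integral_sub hB (hχi k hB)]
      rw [← Real.norm_eq_abs]
      refine norm_integral_le_of_norm_le (hB.sub (hχi k hB)) (Eventually.of_forall fun x => ?_)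
      have e1 : χ k x * G s x - G s x = -((1 - χ k x) * G s x) := by ring
      have e2 : B x - χ k x * B x = (1 - χ k x) * B x := by ring
      rw [e1, e2, norm_neg, norm_mul, Real.norm_eq_abs, Real.norm_eq_abs,
        abs_of_nonneg (sub_nonneg.2 (hχ1 k x))]
      exact mul_le_mul_of_nonneg_left (hGB s hs x) (sub_nonneg.2 (hχ1 k x))
    have h2 : |∫ x, E k s x ∂μ| ≤ ε k * ∫ x, C x ∂μ := by
      rw [← integral_const_mul]
      rw [← Real.norm_eq_abs]
      refine norm_integral_le_of_norm_le (hC.const_mul _) (Eventually.of_forall fun x => ?_)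
      exact (hE k s (hsub hs) x).trans
        (mul_le_mul_of_nonneg_left ((le_abs_self _).trans (hDC s hs x)) (hε0 k))
    calc _ = |(∫ x, χ k x * G s x ∂μ - ∫ x, G s x ∂μ) + ∫ x, E k s x ∂μ| := by ring_nf
      _ ≤ _ := (abs_add_le _ _).trans (add_le_add h1 h2)
  rw [hasDerivWithinAt_iff_isLittleO, Asymptotics.isLittleO_iff]
  intro δ hδ
  have hcont := continuousWithinAt_integral hG hGm hGc ht
  obtain ⟨r, hr, hball⟩ := Metric.mem_nhdsWithin_iff.1
    (inter_mem hab (hcont (Metric.closedBall_mem_nhds _ hδ)))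
  filter_upwards [self_mem_nhdsWithin, mem_nhdsWithin_of_mem_nhds (Metric.ball_mem_nhds t hr)]
    with s hs hsr
  have hconv : Convex ℝ (Metric.ball t r ∩ J) := (convex_ball t r).inter hJ.convex
  -- The mean value inequality is applied to the cut-off integral minus its expected linear part. As
  -- `k → ∞` the cutoff and `η k` disappear and the bound `δ |s - t|` remains, on a neighbourhood
  -- that was chosen independently of `k`.
  have key : ∀ k, |(∫ x, χ k x * F s x ∂μ - s * ∫ x, G t x ∂μ)
      - (∫ x, χ k x * F t x ∂μ - t * ∫ x, G t x ∂μ)| ≤ (η k + δ) * |s - t| := fun k => by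
    refine Convex.norm_image_sub_le_of_norm_hasDerivWithin_le (s := Metric.ball t r ∩ J)
      (f := fun s => ∫ x, χ k x * F s x ∂μ - s * ∫ x, G t x ∂μ)
      (f' := fun s => (∫ x, χ k x * G s x ∂μ + ∫ x, E k s x ∂μ) - 1 * ∫ x, G t x ∂μ)
      (fun q hq => ?_) (fun q hq => ?_) hconv ⟨Metric.mem_ball_self hr, ht⟩ ⟨hsr, hs⟩
    · exact ((hder k q hq.2).sub ((hasDerivWithinAt_id q J).mul_const _)).mono inter_subset_right
    · have h1 := hclose k q (hball hq).1
      have h2 : |∫ x, G q x ∂μ - ∫ x, G t x ∂μ| ≤ δ := by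
        have := (hball hq).2
        rwa [mem_preimage, Metric.mem_closedBall, Real.dist_eq] at this
      rw [one_mul, Real.norm_eq_abs]
      calc _ = |((∫ x, χ k x * G q x ∂μ + ∫ x, E k q x ∂μ) - ∫ x, G q x ∂μ)
            + (∫ x, G q x ∂μ - ∫ x, G t x ∂μ)| := by ring_nf
        _ ≤ _ := (abs_add_le _ _).trans (add_le_add h1 h2)
  have hL := (((hlim (hF.integrable hs (hFm s hs))).sub_const (s * ∫ x, G t x ∂μ)).sub
    ((hlim (hF.integrable ht (hFm t ht))).sub_const (t * ∫ x, G t x ∂μ))).abs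
  have hR := (hη0.add_const δ).mul_const |s - t|
  have hfin := le_of_tendsto_of_tendsto' hL hR key
  rw [zero_add] at hfin
  rw [Real.norm_eq_abs, Real.norm_eq_abs, smul_eq_mul]
  calc _ = _ := by ring_nf
    _ ≤ _ := hfin

end IntegralsDependingOnTime

/-! ### Cauchy–Schwarz and cutoff functions. -/

section Cutoff

open Topology Filter

variable {n : ℕ} {M : Type u} [TopologicalSpace M]
  [ChartedSpace (EuclideanSpace ℝ (Fin n)) M] [IsManifold (𝓡 n) ∞ M]

theorem normSq_nonneg (g : SmoothMetric n M) {x : M} (v : TangentSpace (𝓡 n) x) :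
    0 ≤ normSq g v := by
  by_cases hv : v = 0
  · simp [normSq, hv]
  · exact (g.pos x v hv).le

theorem carre_self_nonneg (g : SmoothMetric n M) (h : M → ℝ) (x : M) : 0 ≤ carre g h h x :=
  normSq_nonneg g _

/-- Cauchy–Schwarz, from the nonnegativity of the squared length of `|w|² v - ⟨v, w⟩ w`. -/
theorem inner_sq_le (g : SmoothMetric n M) {x : M} (v w : TangentSpace (𝓡 n) x) :
    g.inner x v w ^ 2 ≤ normSq g v * normSq g w := by
  by_cases hw : w = 0
  · simp [normSq, hw]
  have hpos : 0 < normSq g w := g.pos x w hw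
  have h1 := normSq_nonneg g (normSq g w • v - g.inner x v w • w)
  have h2 : normSq g (normSq g w • v - g.inner x v w • w)
      = normSq g w * (normSq g v * normSq g w - g.inner x v w ^ 2) := by
    simp only [normSq, map_sub, map_smul, sub_apply, smul_apply, smul_eq_mul]
    rw [g.symm x w v]
    ring
  rw [h2] at h1
  linarith [nonneg_of_mul_nonneg_right h1 hpos]

theorem abs_carre_le (g : SmoothMetric n M) (k h : M → ℝ) (x : M) :
    |carre g k h x| ≤ Real.sqrt (carre g k k x) * Real.sqrt (carre g h h x) := by
  rw [← Real.sqrt_mul (carre_self_nonneg g k x)]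
  exact Real.abs_le_sqrt (inner_sq_le g (grad g k x) (grad g h x))

/-- A sequence of cutoff functions whose gradients tend to zero uniformly. -/
structure IsCutoffSequence (g : SmoothMetric n M) (χ : ℕ → M → ℝ) (ε : ℕ → ℝ) : Prop where
  smooth : ∀ k, ContMDiff (𝓡 n) 𝓘(ℝ, ℝ) 1 (χ k)
  compact : ∀ k, HasCompactSupport (χ k)
  nonneg : ∀ k x, 0 ≤ χ k x
  le_one : ∀ k x, χ k x ≤ 1
  tendsto_one : ∀ x, Tendsto (fun k => χ k x) atTop (𝓝 1)
  sqrt_carre_le : ∀ k x, Real.sqrt (carre g (χ k) (χ k) x) ≤ ε k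
  tendsto_zero : Tendsto ε atTop (𝓝 0)

/-- The constant function `1` already has compact support and zero gradient. -/
theorem exists_isCutoffSequence_of_compact [CompactSpace M] (g : SmoothMetric n M) :
    ∃ χ ε, IsCutoffSequence g χ ε := by
  refine ⟨fun _ _ => 1, fun _ => 0, fun _ => contMDiff_const,
    fun _ => HasCompactSupport.of_compactSpace _, fun _ _ => zero_le_one, fun _ _ => le_rfl,
    fun _ => tendsto_const_nhds, fun _ x => ?_, tendsto_const_nhds⟩
  rw [carre_eq_mvfderiv, mvfderiv_const]
  simp

theorem mvfderiv_fun_comp_apply {Ψ : M → EuclideanSpace ℝ (Fin n)}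
    {θ : EuclideanSpace ℝ (Fin n) → ℝ} {x : M}
    (hΨ : MDifferentiableAt (𝓡 n) (𝓡 n) Ψ x) (hθ : DifferentiableAt ℝ θ (Ψ x))
    (v : TangentSpace (𝓡 n) x) :
    mvfderiv (𝓡 n) (fun y => θ (Ψ y)) x v = fderiv ℝ θ (Ψ x) (mvfderiv (𝓡 n) Ψ x v) := by
  have h := (hθ.hasFDerivAt.hasMFDerivAt.comp x hΨ.hasMFDerivAt).mfderiv
  unfold mvfderiv
  rw [show (fun y => θ (Ψ y)) = θ ∘ Ψ from rfl, h]
  rfl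

/-- Dilating one bump function by the factor `k + 1` divides its gradient by that factor, and
pulling back by an isometry does not change lengths. -/
theorem exists_isCutoffSequence_of_isEuclidean {g : SmoothMetric n M} (hg : IsEuclidean g) :
    ∃ χ ε, IsCutoffSequence g χ ε := by
  obtain ⟨Ψ, hΨ⟩ := hg
  have hΨm : ∀ x, MDifferentiableAt (𝓡 n) (𝓡 n) Ψ x := fun x =>
    Ψ.contMDiff.mdifferentiable (by simp) x
  let b : ContDiffBump (0 : EuclideanSpace ℝ (Fin n)) := ⟨1, 2, one_pos, one_lt_two⟩
  have hb : ContDiff ℝ ∞ b := b.contDiff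
  obtain ⟨C, hC⟩ := (b.hasCompactSupport.fderiv (𝕜 := ℝ)).exists_bound_of_continuous
    (hb.continuous_fderiv (by simp))
  let θ : ℕ → EuclideanSpace ℝ (Fin n) → ℝ := fun k v => b (((k : ℝ) + 1)⁻¹ • v)
  have hk : ∀ k : ℕ, (0 : ℝ) < ((k : ℝ) + 1)⁻¹ := fun k => by positivity
  have hθ : ∀ k, ContDiff ℝ ∞ (θ k) := fun k => hb.comp (contDiff_const_smul _)
  have hθ' : ∀ k v w, |fderiv ℝ (θ k) v w| ≤ C * ((k : ℝ) + 1)⁻¹ * ‖w‖ := fun k v w => by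
    have h1 : HasFDerivAt (θ k) ((fderiv ℝ b (((k : ℝ) + 1)⁻¹ • v)).comp
        (((k : ℝ) + 1)⁻¹ • ContinuousLinearMap.id ℝ (EuclideanSpace ℝ (Fin n)))) v :=
      (hb.differentiable (by simp) _).hasFDerivAt.comp v
        ((hasFDerivAt_id v).const_smul (((k : ℝ) + 1)⁻¹))
    rw [h1.fderiv]
    have h2 := (fderiv ℝ b (((k : ℝ) + 1)⁻¹ • v)).le_of_opNorm_le (hC _) (((k : ℝ) + 1)⁻¹ • w)
    rw [norm_smul, Real.norm_eq_abs, Real.norm_eq_abs, abs_of_pos (hk k), ← mul_assoc] at h2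
    exact h2
  refine ⟨fun k x => θ k (Ψ x), fun k => C * ((k : ℝ) + 1)⁻¹, fun k => ?_, fun k => ?_,
    fun k x => b.nonneg, fun k x => b.le_one, fun x => ?_, fun k x => ?_, ?_⟩
  · exact ((hθ k).contMDiff.comp Ψ.contMDiff).of_le ENat.LEInfty.out
  · have h1 : HasCompactSupport (θ k) :=
      b.hasCompactSupport.comp_homeomorph (Homeomorph.smulOfNeZero _ (hk k).ne')
    exact h1.comp_homeomorph Ψ.toHomeomorph
  · refine tendsto_const_nhds.congr' ?_
    obtain ⟨N, hN⟩ := exists_nat_ge ‖Ψ x‖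
    filter_upwards [eventually_ge_atTop N] with k hkN
    refine (b.one_of_mem_closedBall ?_).symm
    rw [mem_closedBall_zero_iff, norm_smul, Real.norm_eq_abs, abs_of_pos (hk k),
      inv_mul_le_iff₀ (by positivity)]
    have : (N : ℝ) ≤ k := by exact_mod_cast hkN
    change ‖Ψ x‖ ≤ ((k : ℝ) + 1) * 1
    linarith
  · set χ : M → ℝ := fun x => θ k (Ψ x)
    -- Here `|∇χ|² = dχ(∇χ)` is estimated by the chain rule, `dΨ` preserving the length of `∇χ`;
    -- dividing by `|∇χ|`, if it is not zero, bounds the gradient.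
    have h1 : carre g χ χ x ≤ C * ((k : ℝ) + 1)⁻¹ * Real.sqrt (carre g χ χ x) := by
      have h2 : ‖mvfderiv (𝓡 n) Ψ x (grad g χ x)‖ = Real.sqrt (carre g χ χ x) := by
        rw [← Real.sqrt_sq (norm_nonneg _), ← real_inner_self_eq_norm_sq, hΨ]
        rfl
      rw [← h2]
      conv_lhs => rw [carre_eq_mvfderiv]
      rw [mvfderiv_fun_comp_apply (hΨm x) ((hθ k).differentiable (by simp) _)]
      exact (le_abs_self _).trans (hθ' k _ _)
    by_cases h0 : Real.sqrt (carre g χ χ x) = 0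
    · rw [h0]
      exact mul_nonneg ((norm_nonneg _).trans (hC 0)) (hk k).le
    · have hpos := lt_of_le_of_ne (Real.sqrt_nonneg _) (Ne.symm h0)
      rw [← Real.mul_self_sqrt (carre_self_nonneg g χ x)] at h1
      simp only [Real.sqrt_mul_self (Real.sqrt_nonneg _)] at h1
      exact le_of_mul_le_mul_right h1 hpos
  · have := (tendsto_one_div_add_atTop_nhds_zero_nat (𝕜 := ℝ)).const_mul C
    simpa using this

end Cutoff

/-! ### Discarding divergences at infinity. -/

section DivergenceTerms

open Topology Filter

variable {n : ℕ} {M : Type u} [TopologicalSpace M]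
  [ChartedSpace (EuclideanSpace ℝ (Fin n)) M] [IsManifold (𝓡 n) ∞ M]
  [MeasurableSpace M] [BorelSpace M] [SecondCountableTopology M] [T2Space M]
  {g : SmoothMetric n M} {f : M → ℝ} {χ : ℕ → M → ℝ} {ε : ℕ → ℝ}

/-- `∇·(k ∇h)` with respect to the weighted measure. -/
def divTerm (g : SmoothMetric n M) (f k h : M → ℝ) (x : M) : ℝ :=
  k x * wittenLaplacian g f h x + carre g k h x

theorem IsCutoffSequence.abs_mul_carre_le (hχ : IsCutoffSequence g χ ε) (j : ℕ) (k h : M → ℝ)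
    (x : M) : |k x * carre g (χ j) h x| ≤ ε j * (|k x| * Real.sqrt (carre g h h x)) := by
  rw [abs_mul]
  calc |k x| * |carre g (χ j) h x|
      ≤ |k x| * (ε j * Real.sqrt (carre g h h x)) :=
        mul_le_mul_of_nonneg_left ((abs_carre_le g (χ j) h x).trans
          (mul_le_mul_of_nonneg_right (hχ.sqrt_carre_le j x) (Real.sqrt_nonneg _))) (abs_nonneg _)
    _ = _ := by ring

theorem IsCutoffSequence.eps_nonneg [Nonempty M] (hχ : IsCutoffSequence g χ ε) (j : ℕ) :
    0 ≤ ε j :=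
  (Real.sqrt_nonneg _).trans (hχ.sqrt_carre_le j (Classical.arbitrary M))

variable {k h : M → ℝ}

theorem continuous_divTerm (hf : ContMDiff (𝓡 n) 𝓘(ℝ, ℝ) 1 f)
    (hk : ContMDiff (𝓡 n) 𝓘(ℝ, ℝ) 1 k) (hh : ContMDiff (𝓡 n) 𝓘(ℝ, ℝ) 2 h) :
    Continuous (divTerm g f k h) :=
  (hk.continuous.mul (continuous_wittenLaplacian hf hh)).add
    (continuous_carre hk (hh.of_le (by norm_num)))

/-- The divergence theorem for fluxes that are small at infinity. -/
theorem integral_divTerm_eq_zero (hf : ContMDiff (𝓡 n) 𝓘(ℝ, ℝ) 1 f)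
    (hχ : IsCutoffSequence g χ ε)
    (hk : ContMDiff (𝓡 n) 𝓘(ℝ, ℝ) 1 k) (hh : ContMDiff (𝓡 n) 𝓘(ℝ, ℝ) 2 h)
    (hi : Integrable (divTerm g f k h) (weightedMeasure g f))
    {D : M → ℝ} (hD : Integrable D (weightedMeasure g f))
    (hkD : ∀ x, |k x| * Real.sqrt (carre g h h x) ≤ D x) :
    ∫ x, divTerm g f k h x ∂(weightedMeasure g f) = 0 := by
  -- The nonnegativity of `ε j` comes from evaluating a gradient bound at a point, so the empty
  -- manifold is treated apart.
  rcases isEmpty_or_nonempty M with hM | hM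
  · rw [Measure.eq_zero_of_isEmpty (weightedMeasure g f), integral_zero_measure]
  have h1 : Tendsto (fun j => ∫ x, χ j x * divTerm g f k h x ∂(weightedMeasure g f)) atTop
      (𝓝 (∫ x, divTerm g f k h x ∂(weightedMeasure g f))) := by
    refine tendsto_integral_of_dominated_convergence (fun x => ‖divTerm g f k h x‖)
      (fun j => ((hχ.smooth j).continuous.mul (continuous_divTerm hf hk hh)).aestronglyMeasurable)
      hi.norm (fun j => Eventually.of_forall fun x => ?_)
      (Eventually.of_forall fun x => by simpa using (hχ.tendsto_one x).mul_const _)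
    rw [norm_mul, Real.norm_eq_abs, abs_of_nonneg (hχ.nonneg j x)]
    exact mul_le_of_le_one_left (norm_nonneg _) (hχ.le_one j x)
  have h2 : Tendsto (fun j => ∫ x, χ j x * divTerm g f k h x ∂(weightedMeasure g f)) atTop
      (𝓝 0) := by
    refine squeeze_zero_norm (fun j => ?_)
      (by simpa using hχ.tendsto_zero.mul_const (∫ x, D x ∂(weightedMeasure g f)))
    rw [show (∫ x, χ j x * divTerm g f k h x ∂(weightedMeasure g f)) = _ from
      integral_cutoff_mul hf (hχ.smooth j) (hχ.compact j) hk hh, norm_neg, ← integral_const_mul]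
    refine norm_integral_le_of_norm_le (hD.const_mul _) (Eventually.of_forall fun x => ?_)
    exact (hχ.abs_mul_carre_le j k h x).trans
      (mul_le_mul_of_nonneg_left (hkD x) (hχ.eps_nonneg j))
  exact tendsto_nhds_unique h1 h2

/-- The time derivative of an integral whose integrand changes, up to divergences, at the
rate `G`. -/
theorem hasDerivWithinAt_integral_of_divTerm {J : Set ℝ} (hf : ContMDiff (𝓡 n) 𝓘(ℝ, ℝ) 1 f)
    (hχ : IsCutoffSequence g χ ε) (hJ : J.OrdConnected) {F F' G D k₁ h₁ k₂ h₂ : ℝ → M → ℝ}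
    (hFc : ContinuousOn (fun p : ℝ × M => F p.1 p.2) (J ×ˢ univ))
    (hF'c : ContinuousOn (fun p : ℝ × M => F' p.1 p.2) (J ×ˢ univ))
    (hFF' : ∀ t ∈ J, ∀ x, HasDerivWithinAt (fun s => F s x) (F' t x) J t)
    (hGc : ContinuousOn (fun p : ℝ × M => G p.1 p.2) (J ×ˢ univ))
    (hF : LocallyUniformlyIntegrable (weightedMeasure g f) J F)
    (hG : LocallyUniformlyIntegrable (weightedMeasure g f) J G)
    (hD : LocallyUniformlyIntegrable (weightedMeasure g f) J D)
    (hk₁ : ∀ t ∈ J, ContMDiff (𝓡 n) 𝓘(ℝ, ℝ) 1 (k₁ t))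
    (hh₁ : ∀ t ∈ J, ContMDiff (𝓡 n) 𝓘(ℝ, ℝ) 2 (h₁ t))
    (hk₂ : ∀ t ∈ J, ContMDiff (𝓡 n) 𝓘(ℝ, ℝ) 1 (k₂ t))
    (hh₂ : ∀ t ∈ J, ContMDiff (𝓡 n) 𝓘(ℝ, ℝ) 2 (h₂ t))
    (hbd : ∀ t ∈ J, ∀ x, |k₁ t x| * Real.sqrt (carre g (h₁ t) (h₁ t) x)
      + |k₂ t x| * Real.sqrt (carre g (h₂ t) (h₂ t) x) ≤ D t x)
    (hdec : ∀ t ∈ J, ∀ x, F' t x = G t x + divTerm g f (k₁ t) (h₁ t) x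
      + divTerm g f (k₂ t) (h₂ t) x) {t : ℝ} (ht : t ∈ J) :
    HasDerivWithinAt (fun s => ∫ x, F s x ∂(weightedMeasure g f))
      (∫ x, G t x ∂(weightedMeasure g f)) J t := by
  have := ChartedSpace.locallyCompactSpace (EuclideanSpace ℝ (Fin n)) M
  have := isLocallyFiniteMeasure_weightedMeasure (g := g) hf.continuous
  rcases isEmpty_or_nonempty M with hM | hM
  · simpa [Measure.eq_zero_of_isEmpty (weightedMeasure g f)] using
      hasDerivWithinAt_const t J (0 : ℝ)
  refine hasDerivWithinAt_integral_of_cutoff (χ := χ) (ε := ε) (D := D)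
    (E := fun j t x => -(k₁ t x * carre g (χ j) (h₁ t) x) - k₂ t x * carre g (χ j) (h₂ t) x) hJ
    (fun j => (hχ.smooth j).continuous.aestronglyMeasurable) hχ.nonneg hχ.le_one hχ.tendsto_one
    hχ.eps_nonneg hχ.tendsto_zero (fun s hs => (continuous_slice hFc hs).aestronglyMeasurable) hF
    (fun s hs => (continuous_slice hGc hs).aestronglyMeasurable) hG (continuousOn_time hGc) hD
    (fun j s hs x => ?_) (fun j s hs => ?_) ht
  · refine (abs_sub _ _).trans ?_
    rw [abs_neg]
    refine (add_le_add (hχ.abs_mul_carre_le j _ _ x) (hχ.abs_mul_carre_le j _ _ x)).trans ?_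
    rw [← mul_add]
    exact mul_le_mul_of_nonneg_left (hbd s hs x) (hχ.eps_nonneg j)
  · have hχi : ∀ {H : M → ℝ}, Continuous H →
        Integrable (fun x => χ j x * H x) (weightedMeasure g f) := fun hH =>
      ((hχ.smooth j).continuous.mul hH).integrable_of_hasCompactSupport (hχ.compact j).mul_right
    have hflux : ∀ {k h : M → ℝ}, ContMDiff (𝓡 n) 𝓘(ℝ, ℝ) 1 k → ContMDiff (𝓡 n) 𝓘(ℝ, ℝ) 2 h →
        Integrable (fun x => k x * carre g (χ j) h x) (weightedMeasure g f) := fun {k h} hk hh => by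
      refine (hk.continuous.mul (continuous_carre (hχ.smooth j)
        (hh.of_le (by norm_num)))).integrable_of_hasCompactSupport (HasCompactSupport.mul_left ?_)
      refine (hχ.compact j).mono' fun y hy => ?_
      by_contra hc
      exact hy (carre_eq_zero_of_notMem_tsupport g h hc)
    have hder := hasDerivWithinAt_integral_of_dominated (F := fun s x => χ j x * F s x)
      (G := fun s x => χ j x * F' s x) (μ := weightedMeasure g f) hJ
      (fun s hs => hχi (continuous_slice hFc hs)) (fun a ha b hb => ?_)
      (fun s hs x => (hFF' s hs x).const_mul _) hs
    · convert hder using 1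
      have e : (fun x => χ j x * F' s x) = fun x => χ j x * G s x
          + χ j x * divTerm g f (k₁ s) (h₁ s) x + χ j x * divTerm g f (k₂ s) (h₂ s) x := by
        ext x
        rw [hdec s hs x]
        ring
      have hG1 := hχi (continuous_slice hGc hs)
      have hd1 := hχi (continuous_divTerm (g := g) hf (hk₁ s hs) (hh₁ s hs))
      have hd2 := hχi (continuous_divTerm (g := g) hf (hk₂ s hs) (hh₂ s hs))
      have i1 : ∫ x, χ j x * divTerm g f (k₁ s) (h₁ s) x ∂(weightedMeasure g f)
          = -∫ x, k₁ s x * carre g (χ j) (h₁ s) x ∂(weightedMeasure g f) :=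
        integral_cutoff_mul hf (hχ.smooth j) (hχ.compact j) (hk₁ s hs) (hh₁ s hs)
      have i2 : ∫ x, χ j x * divTerm g f (k₂ s) (h₂ s) x ∂(weightedMeasure g f)
          = -∫ x, k₂ s x * carre g (χ j) (h₂ s) x ∂(weightedMeasure g f) :=
        integral_cutoff_mul hf (hχ.smooth j) (hχ.compact j) (hk₂ s hs) (hh₂ s hs)
      have i3 := (integral_add (hG1.add hd1) hd2).trans
        (congrArg (· + _) (integral_add hG1 hd1))
      rw [e]
      refine Eq.trans ?_ i3.symm
      have i4 := (integral_sub (hflux (hk₁ s hs) (hh₁ s hs)).neg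
        (hflux (hk₂ s hs) (hh₂ s hs))).trans (congrArg (· - _) (integral_neg _))
      refine (congrArg (_ + ·) i4).trans ?_
      rw [i1, i2]
      ring
    -- For a fixed cutoff the continuous function `F'` is bounded on the compact set `[a, b] ×
    -- tsupport (χ j)`, so no integrable bound on `F'` over the whole space is required.
    · obtain ⟨C, hC⟩ := (isCompact_Icc.prod (hχ.compact j).isCompact).exists_bound_of_continuousOn
        (hF'c.mono (prod_mono (hJ.out ha hb) (subset_univ (tsupport (χ j)))))
      refine ⟨fun x => χ j x * C, hχi continuous_const, fun s hs x => ?_⟩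
      by_cases hx : x ∈ tsupport (χ j)
      · rw [abs_mul, abs_of_nonneg (hχ.nonneg j x)]
        exact mul_le_mul_of_nonneg_left (hC (s, x) ⟨hs, hx⟩) (hχ.nonneg j x)
      · simp [image_eq_zero_of_notMem_tsupport hx]

end DivergenceTerms

/-! ### Chain rule and linearity for gradients and Laplacians. -/

section GradientCalculus

open Topology

variable {n : ℕ} {M : Type u} [TopologicalSpace M]
  [ChartedSpace (EuclideanSpace ℝ (Fin n)) M] [IsManifold (𝓡 n) ∞ M]
  {h k l : M → ℝ} {x : M}

theorem grad_rpow (g : SmoothMetric n M) (hh : MDifferentiableAt (𝓡 n) 𝓘(ℝ, ℝ) h x)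
    (hx : 0 < h x) (a : ℝ) :
    grad g (fun y => h y ^ a) x = (a * h x ^ (a - 1)) • grad g h x := by
  have h1 := (((Real.hasDerivAt_rpow_const (p := a) (Or.inl hx.ne')).hasFDerivAt.hasMFDerivAt).comp
    x hh.hasMFDerivAt).mfderiv
  have h2 : mvfderiv (𝓡 n) (fun y => h y ^ a) x
      = (a * h x ^ (a - 1)) • mvfderiv (𝓡 n) h x := by
    ext v
    refine (congrArg (fun L => L v) h1).trans ?_
    exact mul_comm (mvfderiv (𝓡 n) h x v : ℝ) _
  unfold grad
  rw [h2, map_smul]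

theorem grad_linear (g : SmoothMetric n M) (hh : MDifferentiableAt (𝓡 n) 𝓘(ℝ, ℝ) h x)
    (hk : MDifferentiableAt (𝓡 n) 𝓘(ℝ, ℝ) k x) (a b : ℝ) :
    grad g (fun y => a * h y + b * k y) x = a • grad g h x + b • grad g k x := by
  have hc : ∀ c : ℝ, MDifferentiableAt (𝓡 n) 𝓘(ℝ, ℝ) (fun _ : M => c) x :=
    fun c => mdifferentiableAt_const
  have hs : ∀ (c : ℝ) {u : M → ℝ}, MDifferentiableAt (𝓡 n) 𝓘(ℝ, ℝ) u x →
      mvfderiv (𝓡 n) (fun y => c * u y) x = c • mvfderiv (𝓡 n) u x := fun c u hu => by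
    rw [show (fun y => c * u y) = (fun _ => c) * u from rfl, mvfderiv_mul (hc c) hu,
      mvfderiv_const, smul_zero, add_zero]
  have h1 : MDifferentiableAt (𝓡 n) 𝓘(ℝ, ℝ) (fun y => a * h y) x := (hc a).mul hh
  have h2 : MDifferentiableAt (𝓡 n) 𝓘(ℝ, ℝ) (fun y => b * k y) x := (hc b).mul hk
  unfold grad
  rw [show (fun y => a * h y + b * k y) = (fun y => a * h y) + fun y => b * k y from rfl,
    mvfderiv_add h1 h2, hs a hh, hs b hk, map_add, map_smul, map_smul]

theorem carre_rpow_left (g : SmoothMetric n M) (hh : MDifferentiableAt (𝓡 n) 𝓘(ℝ, ℝ) h x)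
    (hx : 0 < h x) (a : ℝ) :
    carre g (fun y => h y ^ a) k x = a * h x ^ (a - 1) * carre g h k x := by
  unfold carre
  rw [grad_rpow g hh hx, map_smul]
  rfl

theorem carre_rpow_right (g : SmoothMetric n M) (hh : MDifferentiableAt (𝓡 n) 𝓘(ℝ, ℝ) h x)
    (hx : 0 < h x) (a : ℝ) :
    carre g k (fun y => h y ^ a) x = a * h x ^ (a - 1) * carre g k h x := by
  rw [carre_symm, carre_rpow_left g hh hx, carre_symm]

theorem carre_linear_right (g : SmoothMetric n M) (hh : MDifferentiableAt (𝓡 n) 𝓘(ℝ, ℝ) h x)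
    (hk : MDifferentiableAt (𝓡 n) 𝓘(ℝ, ℝ) k x) (a b : ℝ) :
    carre g l (fun y => a * h y + b * k y) x = a * carre g l h x + b * carre g l k x := by
  unfold carre
  rw [grad_linear g hh hk, map_add, map_smul, map_smul]
  rfl

theorem carre_const_mul_left (g : SmoothMetric n M) (hh : MDifferentiableAt (𝓡 n) 𝓘(ℝ, ℝ) h x)
    (a : ℝ) : carre g (fun y => a * h y) k x = a * carre g h k x := by
  have := carre_linear_right (l := k) g hh hh a 0
  simp only [zero_mul, add_zero] at this
  rw [carre_symm, this, carre_symm]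

theorem wittenLaplacian_linear (g : SmoothMetric n M) {f : M → ℝ}
    (hf : ContMDiff (𝓡 n) 𝓘(ℝ, ℝ) 1 f) (hh : ContMDiff (𝓡 n) 𝓘(ℝ, ℝ) 2 h)
    (hk : ContMDiff (𝓡 n) 𝓘(ℝ, ℝ) 2 k) (a b : ℝ) (x : M) :
    wittenLaplacian g f (fun y => a * h y + b * k y) x
      = a * wittenLaplacian g f h x + b * wittenLaplacian g f k x := by
  have hG := isMetricOn_metricMatrix g x
  have hu := coord_mem (n := n) x
  have hψ := contDiffOn_inChart hf ENat.LEInfty.out x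
  have h1 := contDiffOn_inChart hh ENat.LEInfty.out x
  have h2 := contDiffOn_inChart hk ENat.LEInfty.out x
  have h3 : ContMDiff (𝓡 n) 𝓘(ℝ, ℝ) 2 (fun y => a * h y + b * k y) :=
    (contMDiff_const.mul hh).add (contMDiff_const.mul hk)
  have hd := fun {u : EuclideanSpace ℝ (Fin n) → ℝ}
    (hu' : ContDiffOn ℝ 2 u (extChartAt (𝓡 n) x).target) {v} hv =>
    hu'.diffAt (u := v) hG.isOpen (by norm_num) hv
  have hgrad : ∀ i, ∀ v ∈ (extChartAt (𝓡 n) x).target,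
      gradOf (metricMatrix g x) (inChart x fun y => a * h y + b * k y) i v
        = a * gradOf (metricMatrix g x) (inChart x h) i v
          + b * gradOf (metricMatrix g x) (inChart x k) i v := fun i v hv => by
    unfold gradOf
    rw [Finset.mul_sum, Finset.mul_sum, ← Finset.sum_add_distrib]
    refine Finset.sum_congr rfl fun j _ => ?_
    rw [show (inChart x fun y => a * h y + b * k y)
      = fun v => a * inChart x h v + b * inChart x k v from rfl,
      pd_add j ((hd h1 hv).const_mul a) ((hd h2 hv).const_mul b), pd_const_mul j a (hd h1 hv),
      pd_const_mul j b (hd h2 hv)]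
    ring
  have hgd := fun {u : EuclideanSpace ℝ (Fin n) → ℝ}
    (hu' : ContDiffOn ℝ 2 u (extChartAt (𝓡 n) x).target) (i : Fin n) =>
    (hG.contDiffOn_grad (m := 1) hu' (by norm_num) (by simp) i).diffAt hG.isOpen (by simp) hu
  rw [wittenLaplacian_eq g f (h3.of_le (by norm_num)), wittenLaplacian_eq g f (hh.of_le (by norm_num)),
    wittenLaplacian_eq g f (hk.of_le (by norm_num)), hG.lapOf_eq hu hψ h1, hG.lapOf_eq hu hψ h2,
    hG.lapOf_eq hu hψ (contDiffOn_inChart h3 ENat.LEInfty.out x), mul_add, mul_add,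
    Finset.mul_sum, Finset.mul_sum, Finset.mul_sum, Finset.mul_sum]
  simp only [← Finset.sum_add_distrib]
  refine Finset.sum_congr rfl fun i _ => ?_
  rw [hgrad i _ hu, pd_congr i hG.isOpen hu (hgrad i), pd_add i ((hgd h1 i).const_mul a)
    ((hgd h2 i).const_mul b), pd_const_mul i a (hgd h1 i), pd_const_mul i b (hgd h2 i)]
  ring

variable [MeasurableSpace M] [BorelSpace M] [SecondCountableTopology M] [T2Space M]

theorem divTerm_const_mul (g : SmoothMetric n M) (f : M → ℝ)
    (hk : MDifferentiableAt (𝓡 n) 𝓘(ℝ, ℝ) k x) (a : ℝ) :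
    divTerm g f (fun y => a * k y) h x = a * divTerm g f k h x := by
  unfold divTerm
  rw [carre_const_mul_left g hk]
  ring

theorem divTerm_zero (g : SmoothMetric n M) (f k : M → ℝ) (x : M) :
    divTerm g f (fun _ => 0) k x = 0 := by
  have h1 := divTerm_const_mul (h := k) g f (k := fun _ => 0) (x := x) mdifferentiableAt_const 0
  simpa using h1

end GradientCalculus

/-! ### Pointwise evolution along a solution. -/

section Evolution

open Topology

variable {n : ℕ} {M : Type u} [TopologicalSpace M]
  [ChartedSpace (EuclideanSpace ℝ (Fin n)) M] [IsManifold (𝓡 n) ∞ M]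

/-- A smooth solution with its equations solved for the time derivatives. -/
structure IsRegularSolution (g : SmoothMetric n M) (f : M → ℝ) (c γ : ℝ) (J : Set ℝ)
    (ρ φ : ℝ → M → ℝ) : Prop where
  smooth_weight : ContMDiff (𝓡 n) 𝓘(ℝ, ℝ) 2 f
  one_lt : 1 < γ
  ordConnected : J.OrdConnected
  nontrivial : J.Nontrivial
  density : TimeSmooth n J ρ
  potential : TimeSmooth n J φ
  pos : ∀ t ∈ J, ∀ x, 0 < ρ t x
  density_eq : ∀ t ∈ J, ∀ x, timeDeriv J ρ t x = -divTerm g f (ρ t) (φ t) x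
  potential_eq : ∀ t ∈ J, ∀ x, timeDeriv J φ t x = -(c ^ 2)⁻¹ * φ t x
    + 1 * ((c ^ 2)⁻¹ * (γ / (γ - 1)) * ρ t x ^ (γ - 1)
      + -1 * (1 / 2 * carre g (φ t) (φ t) x))

theorem IsSmoothLangevinSolution.isRegularSolution {g : SmoothMetric n M} {f : M → ℝ} {c γ : ℝ}
    {J : Set ℝ} {ρ φ : ℝ → M → ℝ} (h : IsSmoothLangevinSolution g f c γ J ρ φ)
    (hf : ContMDiff (𝓡 n) 𝓘(ℝ, ℝ) 2 f) (hc : 0 < c) (hγ : 1 < γ)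
    (hJ : J.OrdConnected) (hJ' : J.Nontrivial) : IsRegularSolution g f c γ J ρ φ := by
  have hρ := timeSmooth_of_contMDiffOn h.smooth_density
  have hφ := timeSmooth_of_contMDiffOn h.smooth_potential
  refine ⟨hf, hγ, hJ, hJ', hρ, hφ, h.density_pos, fun t ht x => ?_, fun t ht x => ?_⟩
  · have h1 := h.continuity_eq t ht x
    rw [nablaMuStar_smul_grad g (hf.of_le (by norm_num)) (hρ.slice_one ht) (hφ.slice_two ht)] at h1
    exact sub_eq_zero.1 h1
  · have h1 := h.hamilton_jacobi_eq t ht x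
    rw [normSq_grad] at h1
    have hc2 : c ^ 2 ≠ 0 := (pow_pos hc 2).ne'
    have hγ' : γ - 1 ≠ 0 := (sub_pos.2 hγ).ne'
    change derivWithin (fun s => φ s x) J t = _
    rw [← mul_right_inj' hc2]
    linear_combination (exp := 1) h1 + (φ t x - γ / (γ - 1) * ρ t x ^ (γ - 1)) * mul_inv_cancel₀ hc2

namespace IsRegularSolution

variable {g : SmoothMetric n M} {f : M → ℝ} {c γ : ℝ} {J : Set ℝ} {ρ φ : ℝ → M → ℝ}
  (h : IsRegularSolution g f c γ J ρ φ) {t : ℝ}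
include h

theorem uniqueDiffOn : UniqueDiffOn ℝ J := uniqueDiffOn_of_ordConnected h.ordConnected h.nontrivial

theorem subset_closure : J ⊆ closure (interior J) :=
  subset_closure_interior_of_ordConnected h.ordConnected h.nontrivial

theorem smooth_weight_one : ContMDiff (𝓡 n) 𝓘(ℝ, ℝ) 1 f := h.smooth_weight.of_le (by norm_num)

theorem power (a : ℝ) : TimeSmooth n J fun t x => ρ t x ^ a := h.density.rpow_const h.pos a

theorem energy : TimeSmooth n J fun t => carre g (φ t) (φ t) :=
  TimeSmooth.carre g h.uniqueDiffOn h.potential h.potential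

theorem mdiff_density (ht : t ∈ J) (x : M) : MDifferentiableAt (𝓡 n) 𝓘(ℝ, ℝ) (ρ t) x :=
  mdifferentiableAt_of_one (h.density.slice_one ht) x

theorem mdiff_potential (ht : t ∈ J) (x : M) : MDifferentiableAt (𝓡 n) 𝓘(ℝ, ℝ) (φ t) x :=
  mdifferentiableAt_of_one (h.potential.slice_one ht) x

theorem contMDiff_half_energy (ht : t ∈ J) :
    ContMDiff (𝓡 n) 𝓘(ℝ, ℝ) 2 (fun y => 1 / 2 * carre g (φ t) (φ t) y) :=
  contMDiff_const.mul (h.energy.slice_two ht)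

theorem contMDiff_source (ht : t ∈ J) :
    ContMDiff (𝓡 n) 𝓘(ℝ, ℝ) 2 (fun y => (c ^ 2)⁻¹ * (γ / (γ - 1)) * ρ t y ^ (γ - 1)
      + -1 * (1 / 2 * carre g (φ t) (φ t) y)) :=
  (contMDiff_const.mul ((h.power (γ - 1)).slice_two ht)).add
    (contMDiff_const.mul (h.contMDiff_half_energy ht))

/-- The explicit coefficients `1` and `-1` give the right-hand side the nested shape `a * h + b * k`
to which `carre_linear_right` and `wittenLaplacian_linear` apply. -/
theorem timeDeriv_potential (ht : t ∈ J) : timeDeriv J φ t = fun x => -(c ^ 2)⁻¹ * φ t x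
    + 1 * ((c ^ 2)⁻¹ * (γ / (γ - 1)) * ρ t x ^ (γ - 1)
      + -1 * (1 / 2 * carre g (φ t) (φ t) x)) := funext fun x => h.potential_eq t ht x

/-- The real powers of `ρ` are reduced to integer powers times `ρ^(γ-2)`, after which they can be
compared by ring identities. -/
theorem rpow_sub_one (ht : t ∈ J) (x : M) : ρ t x ^ (γ - 1) = ρ t x * ρ t x ^ (γ - 2) := by
  rw [show γ - 1 = 1 + (γ - 2) by ring, Real.rpow_add (h.pos t ht x), Real.rpow_one]

theorem rpow_self (ht : t ∈ J) (x : M) : ρ t x ^ γ = ρ t x ^ 2 * ρ t x ^ (γ - 2) := by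
  have h1 := h.rpow_sub_one ht x
  have h2 : ρ t x ^ γ = ρ t x * ρ t x ^ (γ - 1) := by
    rw [show ρ t x ^ γ = ρ t x ^ (1 + (γ - 1)) by ring_nf, Real.rpow_add (h.pos t ht x),
      Real.rpow_one]
  rw [h2, h1]
  ring

theorem carre_power (a : ℝ) (ht : t ∈ J) (k : M → ℝ) (x : M) :
    carre g (fun y => ρ t y ^ a) k x = a * ρ t x ^ (a - 1) * carre g (ρ t) k x :=
  carre_rpow_left g (h.mdiff_density ht x) (h.pos t ht x) a

/-- The chain rule gives `-γρ^γ Lφ - ⟨∇ρ^γ, ∇φ⟩`; completing the first term to a divergence changes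
the coefficient of the second from `-1` to `γ - 1`. -/
theorem hasDerivWithinAt_power (ht : t ∈ J) (x : M) :
    HasDerivWithinAt (fun s => ρ s x ^ γ)
      ((γ - 1) * carre g (fun y => ρ t y ^ γ) (φ t) x
        - γ * divTerm g f (fun y => ρ t y ^ γ) (φ t) x) J t := by
  have h1 := (h.density.hasDerivWithinAt ht x).rpow_const (p := γ) (Or.inl (h.pos t ht x).ne')
  refine h1.congr_deriv ?_
  rw [h.density_eq t ht x]
  unfold divTerm
  beta_reduce
  rw [h.carre_power γ ht, h.rpow_self ht, h.rpow_sub_one ht]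
  ring

/-- The gradient of the Hamilton–Jacobi equation, paired with `∇φ`. The pressure term contributes
`γρ^(γ-2)∇ρ`, the field with which `∇φ` is compared in the final formula. -/
theorem carre_potential_timeDeriv (ht : t ∈ J) (x : M) :
    carre g (φ t) (timeDeriv J φ t) x = (c ^ 2)⁻¹ * (γ * ρ t x ^ (γ - 2) * carre g (ρ t) (φ t) x
        - carre g (φ t) (φ t) x) - 1 / 2 * carre g (carre g (φ t) (φ t)) (φ t) x := by
  have hm := mdifferentiableAt_of_one (h.energy.slice_one ht) x
  have hm2 := mdifferentiableAt_of_one ((h.contMDiff_half_energy ht).of_le (by norm_num)) x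
  have hm3 := mdifferentiableAt_of_one ((h.contMDiff_source ht).of_le (by norm_num)) x
  have hm4 := mdifferentiableAt_of_one ((h.power (γ - 1)).slice_one ht) x
  have hγ : γ / (γ - 1) * (γ - 1) = γ := div_mul_cancel₀ _ (sub_pos.2 h.one_lt).ne'
  rw [h.timeDeriv_potential ht, carre_linear_right g (h.mdiff_potential ht x) hm3,
    carre_linear_right g hm4 hm2, carre_symm g (φ t) (fun y => 1 / 2 * carre g (φ t) (φ t) y),
    carre_const_mul_left g hm, carre_rpow_right g (h.mdiff_density ht x) (h.pos t ht x),
    carre_symm g (φ t) (ρ t), show γ - 1 - 1 = γ - 2 by ring]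
  linear_combination (c ^ 2)⁻¹ * ρ t x ^ (γ - 2) * carre g (ρ t) (φ t) x * hγ

/-- The transport term `-⟨∇|∇φ|², ∇φ⟩ρ` and `|∇φ|² ∂ₜρ` combine to a single divergence; only the
relaxation term of order `c⁻²` survives integration. -/
theorem hasDerivWithinAt_kinetic (ht : t ∈ J) (x : M) :
    HasDerivWithinAt (fun s => carre g (φ s) (φ s) x * ρ s x)
      (2 * (c ^ 2)⁻¹ * (carre g (fun y => ρ t y ^ γ) (φ t) x - carre g (φ t) (φ t) x * ρ t x)
        - divTerm g f (fun y => carre g (φ t) (φ t) y * ρ t y) (φ t) x) J t := by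
  have h1 := (TimeSmooth.hasDerivWithinAt_carre (g := g) h.uniqueDiffOn h.subset_closure
    h.potential h.potential ht x).fun_mul (h.density.hasDerivWithinAt ht x)
  refine h1.congr_deriv ?_
  rw [h.density_eq t ht x, carre_symm g (timeDeriv J φ t), h.carre_potential_timeDeriv ht,
    h.carre_power γ ht, h.rpow_sub_one ht]
  unfold divTerm
  beta_reduce
  rw [carre_mul_left (h.energy.slice_one ht) (h.density.slice_one ht)]
  ring

theorem wittenLaplacian_timeDeriv (ht : t ∈ J) (x : M) :
    wittenLaplacian g f (timeDeriv J φ t) x = -(c ^ 2)⁻¹ * wittenLaplacian g f (φ t) x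
      + (c ^ 2)⁻¹ * (γ / (γ - 1)) * wittenLaplacian g f (fun y => ρ t y ^ (γ - 1)) x
      - wittenLaplacian g f (fun y => 1 / 2 * carre g (φ t) (φ t) y) x := by
  rw [h.timeDeriv_potential ht, wittenLaplacian_linear g h.smooth_weight_one
    (h.potential.slice_two ht) (h.contMDiff_source ht), wittenLaplacian_linear g
    h.smooth_weight_one ((h.power (γ - 1)).slice_two ht) (h.contMDiff_half_energy ht)]
  ring

variable [MeasurableSpace M] [BorelSpace M] [SecondCountableTopology M] [T2Space M]

theorem bochner (ht : t ∈ J) (x : M) :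
    wittenLaplacian g f (fun y => 1 / 2 * carre g (φ t) (φ t) y) x
      = carre g (φ t) (wittenLaplacian g f (φ t)) x
        + (hessianHSSq g (φ t) x + bakryEmery g f x (grad g (φ t) x)) := by
  rw [← bochner_manifold h.smooth_weight (h.potential.slice ht)]
  ring

theorem contMDiff_laplacian (ht : t ∈ J) :
    ContMDiff (𝓡 n) 𝓘(ℝ, ℝ) 1 (wittenLaplacian g f (φ t)) :=
  contMDiff_wittenLaplacian h.smooth_weight (h.potential.slice ht)

/-- The derivative of `-ρ^γ Lφ`. -/
theorem divTerm_decomposition (ht : t ∈ J) (x : M) :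
    -(timeDeriv J (fun s y => ρ s y ^ γ) t x * wittenLaplacian g f (φ t) x
        + ρ t x ^ γ * wittenLaplacian g f (timeDeriv J φ t) x)
      = ((hessianHSSq g (φ t) x + bakryEmery g f x (grad g (φ t) x)
          + (γ - 1) * wittenLaplacian g f (φ t) x ^ 2) * ρ t x ^ γ
        + (c ^ 2)⁻¹ * (ρ t x ^ γ * wittenLaplacian g f (φ t) x)
        + (c ^ 2)⁻¹ * (carre g (fun y => ρ t y ^ γ) (fun y => ρ t y ^ γ) x / ρ t x))
        + divTerm g f (fun y => ρ t y ^ γ * wittenLaplacian g f (φ t) y) (φ t) x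
        + divTerm g f (fun y => -((c ^ 2)⁻¹ * (γ / (γ - 1))) * ρ t y ^ γ)
          (fun y => ρ t y ^ (γ - 1)) x := by
  have hγ : γ / (γ - 1) * (γ - 1) = γ := div_mul_cancel₀ _ (sub_pos.2 h.one_lt).ne'
  have hpos := h.pos t ht x
  have hd : timeDeriv J (fun s y => ρ s y ^ γ) t x = _ :=
    (h.hasDerivWithinAt_power ht x).derivWithin (h.uniqueDiffOn t ht)
  have hfisher : carre g (fun y => ρ t y ^ γ) (fun y => ρ t y ^ γ) x / ρ t x
      = γ ^ 2 * ρ t x * (ρ t x ^ (γ - 2)) ^ 2 * carre g (ρ t) (ρ t) x := by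
    rw [h.carre_power γ ht, carre_symm, h.carre_power γ ht, h.rpow_sub_one ht]
    field_simp
  -- One of the `γ` copies of `ρ^γ (Lφ)²` and the Bochner term `ρ^γ⟨∇φ, ∇Lφ⟩` are absorbed into the
  -- divergence of `ρ^γ Lφ ∇φ`. The pressure leaves, besides a divergence, a multiple of `⟨∇ρ^γ,
  -- ∇ρ^(γ-1)⟩`, which is the term `c⁻²|∇ρ^γ|²/ρ`.
  rw [hd, h.wittenLaplacian_timeDeriv ht, h.bochner ht, hfisher,
    divTerm_const_mul g f (mdifferentiableAt_of_one ((h.power γ).slice_one ht) x)]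
  unfold divTerm
  beta_reduce
  rw [carre_mul_left ((h.power γ).slice_one ht) (h.contMDiff_laplacian ht),
    h.carre_power γ ht (φ t), carre_symm g (wittenLaplacian g f (φ t)) (φ t),
    h.carre_power γ ht (fun y => ρ t y ^ (γ - 1)),
    carre_rpow_right g (h.mdiff_density ht x) hpos, h.rpow_self ht, h.rpow_sub_one ht,
    show γ - 1 - 1 = γ - 2 by ring]
  linear_combination ((c ^ 2)⁻¹ * γ * ρ t x * (ρ t x ^ (γ - 2)) ^ 2 * carre g (ρ t) (ρ t) x) * hγ

end IsRegularSolution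

end Evolution

/-! ### Integrable bounds and differentiation of the integrals. -/

section UniformBounds

open Topology

variable {n : ℕ} {M : Type u} [TopologicalSpace M]
  [ChartedSpace (EuclideanSpace ℝ (Fin n)) M] [IsManifold (𝓡 n) ∞ M]
  [MeasurableSpace M]

/-- The functions that occur in the evolution of the energies have common integrable bounds. -/
structure HasUniformBounds (g : SmoothMetric n M) (f : M → ℝ) (γ : ℝ) (J : Set ℝ)
    (ρ φ : ℝ → M → ℝ) : Prop where
  kinetic : LocallyUniformlyIntegrable (weightedMeasure g f) J
    fun t x => carre g (φ t) (φ t) x * ρ t x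
  kinetic_flux : LocallyUniformlyIntegrable (weightedMeasure g f) J
    fun t x => Real.sqrt (carre g (φ t) (φ t) x) ^ 3 * ρ t x
  entropy : LocallyUniformlyIntegrable (weightedMeasure g f) J fun t x => ρ t x ^ γ
  entropy_sq : LocallyUniformlyIntegrable (weightedMeasure g f) J
    fun t x => ρ t x ^ (2 * γ - 1)
  fisher : LocallyUniformlyIntegrable (weightedMeasure g f) J
    fun t x => carre g (fun y => ρ t y ^ γ) (fun y => ρ t y ^ γ) x / ρ t x
  gradient : LocallyUniformlyIntegrable (weightedMeasure g f) J
    fun t x => carre g (φ t) (φ t) x * ρ t x ^ γ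
  laplacian : LocallyUniformlyIntegrable (weightedMeasure g f) J
    fun t x => wittenLaplacian g f (φ t) x ^ 2 * ρ t x ^ γ
  curvature : LocallyUniformlyIntegrable (weightedMeasure g f) J
    fun t x => (hessianHSSq g (φ t) x + bakryEmery g f x (grad g (φ t) x)) * ρ t x ^ γ

variable {g : SmoothMetric n M} {f : M → ℝ} {c γ : ℝ} {J : Set ℝ} {ρ φ : ℝ → M → ℝ}

theorem GrowthCondition.hasUniformBounds (h : GrowthCondition g f γ J ρ φ) :
    HasUniformBounds g f γ J ρ φ where
  kinetic := h.kinetic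
  kinetic_flux := h.kinetic_flux
  entropy := h.entropy
  entropy_sq := h.entropy_sq
  fisher := h.fisher
  gradient := h.gradient
  laplacian := h.laplacian
  curvature := by
    simp only [add_mul]
    exact h.hessian.add h.curvature

namespace IsRegularSolution

variable [BorelSpace M] [SecondCountableTopology M] [T2Space M]
  (h : IsRegularSolution g f c γ J ρ φ) {t : ℝ}
include h

theorem continuousOn_laplacian :
    ContinuousOn (fun p : ℝ × M => wittenLaplacian g f (φ p.1) p.2) (J ×ˢ univ) :=
  h.potential.continuousOn_wittenLaplacian h.uniqueDiffOn h.smooth_weight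

/-- The Hessian and Ricci terms are defined in a chart that varies with the point, so their
continuity is not apparent. The Bochner formula expresses their sum by Laplacians and gradients,
which are jointly continuous; for this reason the two terms are kept together. -/
theorem continuousOn_curvature : ContinuousOn (fun p : ℝ × M =>
    (hessianHSSq g (φ p.1) p.2 + bakryEmery g f p.2 (grad g (φ p.1) p.2)) * ρ p.1 p.2 ^ γ)
    (J ×ˢ univ) := by
  have hE : TimeSmooth n J fun t y => 1 / 2 * carre g (φ t) (φ t) y :=
    fun x => contDiffOn_const.mul (h.energy x)
  refine (((hE.continuousOn_wittenLaplacian (g := g) h.uniqueDiffOn h.smooth_weight).sub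
    (h.potential.continuousOn_carre_wittenLaplacian (g := g) h.uniqueDiffOn h.smooth_weight)).mul
    (h.power γ).continuousOn).congr fun p hp => ?_
  simp only [Pi.mul_apply, Pi.sub_apply]
  rw [h.bochner hp.1]
  ring

theorem continuousOn_fisher : ContinuousOn (fun p : ℝ × M =>
    carre g (fun y => ρ p.1 y ^ γ) (fun y => ρ p.1 y ^ γ) p.2 / ρ p.1 p.2) (J ×ˢ univ) :=
  (TimeSmooth.carre g h.uniqueDiffOn (h.power γ) (h.power γ)).continuousOn.div
    h.density.continuousOn fun p hp => (h.pos p.1 hp.1 p.2).ne'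

/-- Joint continuity on `[a, b] × M` gives constant bounds, and constants are integrable for the
finite measure `μ`. -/
theorem hasUniformBounds_of_compact [CompactSpace M] : HasUniformBounds g f γ J ρ φ := by
  have := ChartedSpace.locallyCompactSpace (EuclideanSpace ℝ (Fin n)) M
  have := isLocallyFiniteMeasure_weightedMeasure (g := g) h.smooth_weight.continuous
  have hJ := h.ordConnected
  have hL := h.continuousOn_laplacian
  have hP := (h.power γ).continuousOn
  refine ⟨.of_continuousOn hJ (h.energy.mul h.density).continuousOn, .of_continuousOn hJ ?_,
    .of_continuousOn hJ hP, .of_continuousOn hJ (h.power _).continuousOn,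
    .of_continuousOn hJ h.continuousOn_fisher,
    .of_continuousOn hJ (h.energy.mul (h.power γ)).continuousOn,
    .of_continuousOn hJ ((hL.pow 2).mul hP), .of_continuousOn hJ h.continuousOn_curvature⟩
  exact (h.energy.continuousOn.sqrt.pow 3).mul h.density.continuousOn

theorem continuousOn_cross : ContinuousOn (fun p : ℝ × M =>
    carre g (fun y => ρ p.1 y ^ γ) (φ p.1) p.2) (J ×ˢ univ) :=
  (TimeSmooth.carre g h.uniqueDiffOn (h.power γ) h.potential).continuousOn

variable (hb : HasUniformBounds g f γ J ρ φ)
include hb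

/-- By Cauchy–Schwarz and AM–GM, `|∇ρ^γ||∇φ| ≤ ½(|∇ρ^γ|²/ρ + |∇φ|²ρ)`. -/
theorem uniform_cross : LocallyUniformlyIntegrable (weightedMeasure g f) J
    fun t x => carre g (fun y => ρ t y ^ γ) (φ t) x := by
  refine ((hb.fisher.add hb.kinetic).const_mul (1 / 2)).mono h.ordConnected fun t ht x => ?_
  have hpos := h.pos t ht x
  refine (abs_carre_le g _ _ x).trans ?_
  set s := Real.sqrt (carre g (fun y => ρ t y ^ γ) (fun y => ρ t y ^ γ) x)
  set m := Real.sqrt (carre g (φ t) (φ t) x)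
  have hs : carre g (fun y => ρ t y ^ γ) (fun y => ρ t y ^ γ) x = s ^ 2 :=
    (Real.sq_sqrt (carre_self_nonneg g _ x)).symm
  have hm : carre g (φ t) (φ t) x = m ^ 2 := (Real.sq_sqrt (carre_self_nonneg g _ x)).symm
  rw [hs, hm]
  have h1 : 1 / 2 * (s ^ 2 / ρ t x + m ^ 2 * ρ t x) - s * m
      = 1 / 2 * ((s - m * ρ t x) ^ 2 / ρ t x) := by
    field_simp
    ring
  have h2 : 0 ≤ 1 / 2 * ((s - m * ρ t x) ^ 2 / ρ t x) := by positivity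
  linarith

/-- The inequality `2|Lφ| ≤ 1 + (Lφ)²`, multiplied by `ρ^γ`. -/
theorem uniform_dissipation : LocallyUniformlyIntegrable (weightedMeasure g f) J
    fun t x => ρ t x ^ γ * wittenLaplacian g f (φ t) x := by
  refine ((hb.entropy.add hb.laplacian).const_mul (1 / 2)).mono h.ordConnected fun t ht x => ?_
  have hpos : 0 < ρ t x ^ γ := Real.rpow_pos_of_pos (h.pos t ht x) _
  rw [abs_mul, abs_of_pos hpos, ← sq_abs (wittenLaplacian g f (φ t) x)]
  nlinarith [mul_nonneg hpos.le (sq_nonneg (|wittenLaplacian g f (φ t) x| - 1))]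

variable {χ : ℕ → M → ℝ} {ε : ℕ → ℝ}

/-- The only flux is `|∇φ|²ρ∇φ`, of size `|∇φ|³ρ`; the second slot of the general statement is
filled with zero. -/
theorem hasDerivWithinAt_integral_kinetic (hχ : IsCutoffSequence g χ ε) (ht : t ∈ J) :
    HasDerivWithinAt (fun s => ∫ x, carre g (φ s) (φ s) x * ρ s x ∂(weightedMeasure g f))
      (∫ x, 2 * (c ^ 2)⁻¹ * (carre g (fun y => ρ t y ^ γ) (φ t) x
        - carre g (φ t) (φ t) x * ρ t x) ∂(weightedMeasure g f)) J t := by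
  have hF := h.energy.mul h.density
  refine hasDerivWithinAt_integral_of_divTerm h.smooth_weight_one hχ h.ordConnected
    (F := fun t x => carre g (φ t) (φ t) x * ρ t x) (F' := timeDeriv J _)
    (G := fun t x => 2 * (c ^ 2)⁻¹ * (carre g (fun y => ρ t y ^ γ) (φ t) x
        - carre g (φ t) (φ t) x * ρ t x))
    (k₁ := fun t y => -1 * (carre g (φ t) (φ t) y * ρ t y)) (h₁ := φ) (k₂ := fun _ _ => 0)
    (h₂ := φ) hF.continuousOn (hF.deriv h.uniqueDiffOn).continuousOn
    (fun s hs x => hF.hasDerivWithinAt hs x)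
    (continuousOn_const.mul (h.continuousOn_cross.sub hF.continuousOn)) hb.kinetic ?_
    hb.kinetic_flux (fun s hs => contMDiff_const.mul (hF.slice_one hs))
    (fun s hs => h.potential.slice_two hs) (fun s hs => contMDiff_const)
    (fun s hs => h.potential.slice_two hs) (fun s hs x => ?_) (fun s hs x => ?_) ht
  · refine (((h.uniform_cross hb).add (hb.kinetic.const_mul (-1))).const_mul
      (2 * (c ^ 2)⁻¹)).congr h.ordConnected fun t ht x => ?_
    ring
  · have hm : carre g (φ s) (φ s) x = Real.sqrt (carre g (φ s) (φ s) x) ^ 2 :=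
      (Real.sq_sqrt (carre_self_nonneg g _ x)).symm
    have h1 : 0 ≤ carre g (φ s) (φ s) x * ρ s x :=
      mul_nonneg (carre_self_nonneg g _ x) (h.pos s hs x).le
    rw [abs_zero, zero_mul, add_zero, neg_one_mul, abs_neg, abs_of_nonneg h1]
    conv_lhs => rw [hm, Real.sqrt_sq (Real.sqrt_nonneg _)]
    exact le_of_eq (by ring)
  · rw [divTerm_const_mul g f (mdifferentiableAt_of_one (hF.slice_one hs) x), divTerm_zero]
    refine ((h.hasDerivWithinAt_kinetic hs x).derivWithin (h.uniqueDiffOn s hs)).trans ?_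
    ring

/-- The flux `γρ^γ∇φ` is controlled by AM–GM through `ρ^γ` and `|∇φ|²ρ^γ`. -/
theorem hasDerivWithinAt_integral_entropy (hχ : IsCutoffSequence g χ ε) (ht : t ∈ J) :
    HasDerivWithinAt (fun s => ∫ x, ρ s x ^ γ ∂(weightedMeasure g f))
      (∫ x, (γ - 1) * carre g (fun y => ρ t y ^ γ) (φ t) x ∂(weightedMeasure g f)) J t := by
  have hF := h.power γ
  refine hasDerivWithinAt_integral_of_divTerm h.smooth_weight_one hχ h.ordConnected
    (F := fun t x => ρ t x ^ γ) (F' := timeDeriv J _)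
    (G := fun t x => (γ - 1) * carre g (fun y => ρ t y ^ γ) (φ t) x)
    (k₁ := fun t y => -γ * ρ t y ^ γ) (h₁ := φ) (k₂ := fun _ _ => 0)
    (h₂ := φ) hF.continuousOn (hF.deriv h.uniqueDiffOn).continuousOn
    (fun s hs x => hF.hasDerivWithinAt hs x)
    (continuousOn_const.mul h.continuousOn_cross) hb.entropy ((h.uniform_cross hb).const_mul _)
    ((hb.entropy.add hb.gradient).const_mul (γ * (1 / 2)))
    (fun s hs => contMDiff_const.mul (hF.slice_one hs))
    (fun s hs => h.potential.slice_two hs) (fun s hs => contMDiff_const)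
    (fun s hs => h.potential.slice_two hs) (fun s hs x => ?_) (fun s hs x => ?_) ht
  · have hγ : 0 < γ := one_pos.trans h.one_lt
    have hp : 0 < ρ s x ^ γ := Real.rpow_pos_of_pos (h.pos s hs x) _
    have hm : carre g (φ s) (φ s) x = Real.sqrt (carre g (φ s) (φ s) x) ^ 2 :=
      (Real.sq_sqrt (carre_self_nonneg g _ x)).symm
    rw [abs_zero, zero_mul, add_zero, neg_mul, abs_neg, abs_of_pos (mul_pos hγ hp)]
    conv_rhs => rw [hm]
    nlinarith [mul_nonneg (mul_pos hγ hp).le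
      (sq_nonneg (Real.sqrt (carre g (φ s) (φ s) x) - 1))]
  · rw [divTerm_const_mul g f (mdifferentiableAt_of_one (hF.slice_one hs) x), divTerm_zero]
    refine ((h.hasDerivWithinAt_power hs x).derivWithin (h.uniqueDiffOn s hs)).trans ?_
    ring

/-- `Q` is differentiated in this form because `L∂ₜφ` gives access to the Bochner formula. Two
fluxes have to vanish at infinity, `ρ^γ Lφ ∇φ` and a multiple of `ρ^γ∇ρ^(γ-1)`. -/
theorem hasDerivWithinAt_integral_dissipation (hχ : IsCutoffSequence g χ ε) (ht : t ∈ J) :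
    HasDerivWithinAt
      (fun s => ∫ x, -(ρ s x ^ γ * wittenLaplacian g f (φ s) x) ∂(weightedMeasure g f))
      (∫ x, ((hessianHSSq g (φ t) x + bakryEmery g f x (grad g (φ t) x)
          + (γ - 1) * wittenLaplacian g f (φ t) x ^ 2) * ρ t x ^ γ
        + (c ^ 2)⁻¹ * (ρ t x ^ γ * wittenLaplacian g f (φ t) x)
        + (c ^ 2)⁻¹ * (carre g (fun y => ρ t y ^ γ) (fun y => ρ t y ^ γ) x / ρ t x))
        ∂(weightedMeasure g f)) J t := by
  have hP := h.power γ
  have hL := h.continuousOn_laplacian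
  refine hasDerivWithinAt_integral_of_divTerm h.smooth_weight_one hχ h.ordConnected
    (F := fun t x => -(ρ t x ^ γ * wittenLaplacian g f (φ t) x))
    (F' := fun t x => -(timeDeriv J (fun s y => ρ s y ^ γ) t x * wittenLaplacian g f (φ t) x
        + ρ t x ^ γ * wittenLaplacian g f (timeDeriv J φ t) x))
    (G := fun t x => (hessianHSSq g (φ t) x + bakryEmery g f x (grad g (φ t) x)
          + (γ - 1) * wittenLaplacian g f (φ t) x ^ 2) * ρ t x ^ γ
        + (c ^ 2)⁻¹ * (ρ t x ^ γ * wittenLaplacian g f (φ t) x)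
        + (c ^ 2)⁻¹ * (carre g (fun y => ρ t y ^ γ) (fun y => ρ t y ^ γ) x / ρ t x))
    (k₁ := fun t y => ρ t y ^ γ * wittenLaplacian g f (φ t) y) (h₁ := φ)
    (k₂ := fun t y => -((c ^ 2)⁻¹ * (γ / (γ - 1))) * ρ t y ^ γ)
    (h₂ := fun t y => ρ t y ^ (γ - 1)) (hP.continuousOn.mul hL).neg
    (((hP.deriv h.uniqueDiffOn).continuousOn.mul hL).add (hP.continuousOn.mul
      ((h.potential.deriv h.uniqueDiffOn).continuousOn_wittenLaplacian h.uniqueDiffOn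
        h.smooth_weight))).neg
    (fun s hs x => ((hP.hasDerivWithinAt hs x).fun_mul
      (h.potential.hasDerivWithinAt_wittenLaplacian h.uniqueDiffOn h.smooth_weight_one
        h.subset_closure hs x)).fun_neg) ?_ ?_ ?_
    (((hb.gradient.add hb.laplacian).const_mul (1 / 2)).add
      ((hb.entropy_sq.add hb.fisher).const_mul ((c ^ 2)⁻¹ * (1 / 2))))
    (fun s hs => (hP.slice_one hs).mul (h.contMDiff_laplacian hs))
    (fun s hs => h.potential.slice_two hs) (fun s hs => contMDiff_const.mul (hP.slice_one hs))
    (fun s hs => (h.power (γ - 1)).slice_two hs) (fun s hs x => add_le_add ?_ ?_)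
    (fun s hs x => h.divTerm_decomposition hs x) ht
  · refine (((h.continuousOn_curvature.add ((continuousOn_const (c := γ - 1)).mul
      ((hL.pow 2).mul hP.continuousOn))).add ((continuousOn_const (c := (c ^ 2)⁻¹)).mul
      (hP.continuousOn.mul hL))).add ((continuousOn_const (c := (c ^ 2)⁻¹)).mul
      h.continuousOn_fisher)).congr fun p _ => ?_
    simp only [Pi.add_apply, Pi.mul_apply, Pi.pow_apply]
    ring
  · refine ((h.uniform_dissipation hb).const_mul (-1)).congr h.ordConnected fun t ht x => ?_
    ring
  · refine (((hb.curvature.add (hb.laplacian.const_mul (γ - 1))).add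
      ((h.uniform_dissipation hb).const_mul (c ^ 2)⁻¹)).add
      (hb.fisher.const_mul (c ^ 2)⁻¹)).congr h.ordConnected fun t ht x => ?_
    ring
  · have hp : 0 < ρ s x ^ γ := Real.rpow_pos_of_pos (h.pos s hs x) _
    have hm : carre g (φ s) (φ s) x = Real.sqrt (carre g (φ s) (φ s) x) ^ 2 :=
      (Real.sq_sqrt (carre_self_nonneg g _ x)).symm
    rw [abs_mul, abs_of_pos hp, ← sq_abs (wittenLaplacian g f (φ s) x)]
    conv_rhs => rw [hm]
    nlinarith [mul_nonneg hp.le (sq_nonneg (Real.sqrt (carre g (φ s) (φ s) x)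
      - |wittenLaplacian g f (φ s) x|))]
  -- With `q = |∇ρ|` and `b = ρ^(γ-2)` the second flux has size `c⁻²γρ²b²q`. AM–GM for `ρ` and `γq`
  -- bounds it by half of `c⁻²(ρ^(2γ-1) + |∇ρ^γ|²/ρ)`, the defect being the square in `e4`.
  · have hpos := h.pos s hs x
    have hγ1 : 0 < γ - 1 := sub_pos.2 h.one_lt
    have hγ0 : 0 < γ := one_pos.trans h.one_lt
    have hc : 0 ≤ (c ^ 2)⁻¹ := inv_nonneg.2 (sq_nonneg c)
    have hR : carre g (ρ s) (ρ s) x = Real.sqrt (carre g (ρ s) (ρ s) x) ^ 2 :=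
      (Real.sq_sqrt (carre_self_nonneg g _ x)).symm
    set q := Real.sqrt (carre g (ρ s) (ρ s) x) with hq
    have hq0 : 0 ≤ q := Real.sqrt_nonneg _
    set b := ρ s x ^ (γ - 2) with hbdef
    have hb0 : 0 < b := Real.rpow_pos_of_pos hpos _
    have e1 : Real.sqrt (carre g (fun y => ρ s y ^ (γ - 1)) (fun y => ρ s y ^ (γ - 1)) x)
        = (γ - 1) * b * q := by
      rw [h.carre_power (γ - 1) hs, carre_symm, h.carre_power (γ - 1) hs,
        show γ - 1 - 1 = γ - 2 by ring, hR, ← hbdef,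
        show (γ - 1) * b * ((γ - 1) * b * q ^ 2) = ((γ - 1) * b * q) ^ 2 by ring]
      exact Real.sqrt_sq (by positivity)
    have e2 : carre g (fun y => ρ s y ^ γ) (fun y => ρ s y ^ γ) x / ρ s x
        = γ ^ 2 * ρ s x * b ^ 2 * q ^ 2 := by
      rw [h.carre_power γ hs, carre_symm, h.carre_power γ hs, h.rpow_sub_one hs, hR, ← hbdef]
      field_simp
    have e3 : ρ s x ^ (2 * γ - 1) = ρ s x ^ 3 * b ^ 2 := by
      rw [show 2 * γ - 1 = γ + (γ - 1) by ring, Real.rpow_add hpos, h.rpow_self hs,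
        h.rpow_sub_one hs]
      ring
    have hk : 0 ≤ (c ^ 2)⁻¹ * (γ / (γ - 1)) * (ρ s x ^ 2 * b) := by positivity
    rw [e1, e2, e3, h.rpow_self hs, ← hbdef, neg_mul, abs_neg, abs_of_nonneg hk]
    have e4 : (c ^ 2)⁻¹ * (1 / 2) * (ρ s x ^ 3 * b ^ 2 + γ ^ 2 * ρ s x * b ^ 2 * q ^ 2)
        - (c ^ 2)⁻¹ * (γ / (γ - 1)) * (ρ s x ^ 2 * b) * ((γ - 1) * b * q)
        = (c ^ 2)⁻¹ * (1 / 2) * (ρ s x * b ^ 2) * (ρ s x - γ * q) ^ 2 := by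
      field_simp
      ring
    have e5 : 0 ≤ (c ^ 2)⁻¹ * (1 / 2) * (ρ s x * b ^ 2) * (ρ s x - γ * q) ^ 2 := by positivity
    linarith

/-- The divergence theorem for the flux `ρ^γ∇φ`, which has an integrable bound. -/
theorem integral_cross (hχ : IsCutoffSequence g χ ε) (ht : t ∈ J) :
    ∫ x, -(ρ t x ^ γ * wittenLaplacian g f (φ t) x) ∂(weightedMeasure g f)
      = ∫ x, carre g (fun y => ρ t y ^ γ) (φ t) x ∂(weightedMeasure g f) := by
  have hP := h.power γ
  have hi1 : Integrable (fun x => ρ t x ^ γ * wittenLaplacian g f (φ t) x)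
      (weightedMeasure g f) := (h.uniform_dissipation hb).integrable ht
    (continuous_slice (F := fun t x => ρ t x ^ γ * wittenLaplacian g f (φ t) x)
      (hP.continuousOn.mul h.continuousOn_laplacian) ht).aestronglyMeasurable
  have hi2 : Integrable (fun x => carre g (fun y => ρ t y ^ γ) (φ t) x)
      (weightedMeasure g f) := (h.uniform_cross hb).integrable ht
    (continuous_slice (F := fun t x => carre g (fun y => ρ t y ^ γ) (φ t) x)
      h.continuousOn_cross ht).aestronglyMeasurable
  obtain ⟨D, hD, hDb⟩ := (hb.entropy.add hb.gradient).const_mul (1 / 2) t ht t ht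
  have h0 := integral_divTerm_eq_zero h.smooth_weight_one hχ (hP.slice_one ht)
    (h.potential.slice_two ht) (hi1.add hi2) hD fun x => by
      refine le_trans ?_ ((le_abs_self _).trans (hDb t ⟨le_rfl, le_rfl⟩ x))
      have hp : 0 < ρ t x ^ γ := Real.rpow_pos_of_pos (h.pos t ht x) _
      have hm : carre g (φ t) (φ t) x = Real.sqrt (carre g (φ t) (φ t) x) ^ 2 :=
        (Real.sq_sqrt (carre_self_nonneg g _ x)).symm
      rw [abs_of_pos hp]
      beta_reduce
      conv_rhs => rw [hm]
      nlinarith [mul_nonneg hp.le (sq_nonneg (Real.sqrt (carre g (φ t) (φ t) x) - 1))]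
  have h1 := (integral_add hi1 hi2).symm.trans h0
  rw [integral_neg]
  linarith

end IsRegularSolution

end UniformBounds

/-! ### Derivatives of the Hamiltonian and the Lagrangian. -/

section Energies

variable {n : ℕ} {M : Type u} [TopologicalSpace M]
  [ChartedSpace (EuclideanSpace ℝ (Fin n)) M] [IsManifold (𝓡 n) ∞ M]
  [MeasurableSpace M] [BorelSpace M] [SecondCountableTopology M] [T2Space M]
  {g : SmoothMetric n M} {f : M → ℝ} {c γ : ℝ} {J : Set ℝ} {ρ φ : ℝ → M → ℝ}

namespace IsRegularSolution

variable (h : IsRegularSolution g f c γ J ρ φ) (hb : HasUniformBounds g f γ J ρ φ)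
  {χ : ℕ → M → ℝ} {ε : ℕ → ℝ} (hχ : IsCutoffSequence g χ ε) {t : ℝ} (ht : t ∈ J)
include h ht

/-- Expansion of the square, with `ρ · γρ^(γ-2)∇ρ = ∇ρ^γ`. -/
theorem discrepancy_eq (x : M) :
    (c ^ 2)⁻¹ * normSq g (grad g (φ t) x - (γ * ρ t x ^ (γ - 2)) • grad g (ρ t) x) * ρ t x
      = (c ^ 2)⁻¹ * (carre g (φ t) (φ t) x * ρ t x - 2 * carre g (fun y => ρ t y ^ γ) (φ t) x
        + carre g (fun y => ρ t y ^ γ) (fun y => ρ t y ^ γ) x / ρ t x) := by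
  have hpos := h.pos t ht x
  have h1 : normSq g (grad g (φ t) x - (γ * ρ t x ^ (γ - 2)) • grad g (ρ t) x)
      = carre g (φ t) (φ t) x - 2 * (γ * ρ t x ^ (γ - 2)) * carre g (ρ t) (φ t) x
        + (γ * ρ t x ^ (γ - 2)) ^ 2 * carre g (ρ t) (ρ t) x := by
    simp only [normSq, carre, map_sub, map_smul, sub_apply, smul_apply, smul_eq_mul]
    rw [g.symm x (grad g (φ t) x) (grad g (ρ t) x)]
    ring
  have h2 : carre g (fun y => ρ t y ^ γ) (fun y => ρ t y ^ γ) x / ρ t x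
      = γ ^ 2 * ρ t x * (ρ t x ^ (γ - 2)) ^ 2 * carre g (ρ t) (ρ t) x := by
    rw [h.carre_power γ ht, carre_symm, h.carre_power γ ht, h.rpow_sub_one ht]
    field_simp
  rw [h1, h2, h.carre_power γ ht, h.rpow_sub_one ht]
  ring

include hb

theorem integrable_kinetic :
    Integrable (fun x => carre g (φ t) (φ t) x * ρ t x) (weightedMeasure g f) :=
  hb.kinetic.integrable ht ((h.energy.mul h.density).slice ht).continuous.aestronglyMeasurable

theorem integrable_entropy : Integrable (fun x => ρ t x ^ γ) (weightedMeasure g f) :=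
  hb.entropy.integrable ht ((h.power γ).slice ht).continuous.aestronglyMeasurable

theorem integrable_cross :
    Integrable (fun x => carre g (fun y => ρ t y ^ γ) (φ t) x) (weightedMeasure g f) :=
  (h.uniform_cross hb).integrable ht (continuous_slice
    (F := fun t x => carre g (fun y => ρ t y ^ γ) (φ t) x) h.continuousOn_cross
    ht).aestronglyMeasurable

theorem integrable_fisher : Integrable (fun x =>
    carre g (fun y => ρ t y ^ γ) (fun y => ρ t y ^ γ) x / ρ t x) (weightedMeasure g f) :=
  hb.fisher.integrable ht (continuous_slice
    (F := fun t x => carre g (fun y => ρ t y ^ γ) (fun y => ρ t y ^ γ) x / ρ t x)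
    h.continuousOn_fisher ht).aestronglyMeasurable

theorem integrable_dissipation :
    Integrable (fun x => ρ t x ^ γ * wittenLaplacian g f (φ t) x) (weightedMeasure g f) :=
  (h.uniform_dissipation hb).integrable ht (continuous_slice
    (F := fun t x => ρ t x ^ γ * wittenLaplacian g f (φ t) x)
    ((h.power γ).continuousOn.mul h.continuousOn_laplacian) ht).aestronglyMeasurable

theorem integrable_curvature : Integrable (fun x => (hessianHSSq g (φ t) x
    + bakryEmery g f x (grad g (φ t) x) + (γ - 1) * wittenLaplacian g f (φ t) x ^ 2)
      * ρ t x ^ γ) (weightedMeasure g f) := by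
  have h1 := hb.curvature.integrable ht (continuous_slice (F := fun t x =>
    (hessianHSSq g (φ t) x + bakryEmery g f x (grad g (φ t) x)) * ρ t x ^ γ)
    h.continuousOn_curvature ht).aestronglyMeasurable
  have h2 := hb.laplacian.integrable ht (continuous_slice (F := fun t x =>
    wittenLaplacian g f (φ t) x ^ 2 * ρ t x ^ γ)
    ((h.continuousOn_laplacian.pow 2).mul (h.power γ).continuousOn) ht).aestronglyMeasurable
  refine (h1.add (h2.const_mul (γ - 1))).congr (Filter.Eventually.of_forall fun x => ?_)
  simp only [Pi.add_apply]
  ring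

theorem integrable_discrepancy : Integrable (fun x => (c ^ 2)⁻¹
    * normSq g (grad g (φ t) x - (γ * ρ t x ^ (γ - 2)) • grad g (ρ t) x) * ρ t x)
    (weightedMeasure g f) := by
  simp only [h.discrepancy_eq ht]
  exact ((((h.integrable_kinetic hb ht).sub ((h.integrable_cross hb ht).const_mul 2)).add
    (h.integrable_fisher hb ht)).const_mul _)

theorem integral_discrepancy : ∫ x, (c ^ 2)⁻¹
    * normSq g (grad g (φ t) x - (γ * ρ t x ^ (γ - 2)) • grad g (ρ t) x) * ρ t x
      ∂(weightedMeasure g f)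
    = (c ^ 2)⁻¹ * (∫ x, carre g (φ t) (φ t) x * ρ t x ∂(weightedMeasure g f)
      - 2 * ∫ x, carre g (fun y => ρ t y ^ γ) (φ t) x ∂(weightedMeasure g f)
      + ∫ x, carre g (fun y => ρ t y ^ γ) (fun y => ρ t y ^ γ) x / ρ t x
        ∂(weightedMeasure g f)) := by
  have hK := h.integrable_kinetic hb ht
  have hQ := (h.integrable_cross hb ht).const_mul 2
  simp only [h.discrepancy_eq ht]
  rw [integral_const_mul]
  refine congrArg _ ((integral_add (hK.sub hQ) (h.integrable_fisher hb ht)).trans ?_)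
  refine congrArg (· + _) ((integral_sub hK hQ).trans ?_)
  rw [integral_const_mul]

include hχ

theorem hasDerivWithinAt_kinetic_energy :
    HasDerivWithinAt (fun s => ∫ x, carre g (φ s) (φ s) x * ρ s x ∂(weightedMeasure g f))
      (2 * (c ^ 2)⁻¹ * (∫ x, carre g (fun y => ρ t y ^ γ) (φ t) x ∂(weightedMeasure g f)
        - ∫ x, carre g (φ t) (φ t) x * ρ t x ∂(weightedMeasure g f))) J t := by
  rw [← integral_sub (h.integrable_cross hb ht) (h.integrable_kinetic hb ht),
    ← integral_const_mul]
  exact h.hasDerivWithinAt_integral_kinetic hb hχ ht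

theorem hasDerivWithinAt_entropy :
    HasDerivWithinAt (fun s => ∫ x, ρ s x ^ γ ∂(weightedMeasure g f))
      ((γ - 1) * ∫ x, carre g (fun y => ρ t y ^ γ) (φ t) x ∂(weightedMeasure g f)) J t := by
  rw [← integral_const_mul]
  exact h.hasDerivWithinAt_integral_entropy hb hχ ht

/-- By `integral_cross`, valid at every time of `J`, this is the derivative of `-∫ρ^γ Lφ dμ`; the
term linear in `Lφ` is turned back into `-c⁻²Q`. -/
theorem hasDerivWithinAt_cross :
    HasDerivWithinAt (fun s => ∫ x, carre g (fun y => ρ s y ^ γ) (φ s) x ∂(weightedMeasure g f))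
      (∫ x, (hessianHSSq g (φ t) x + bakryEmery g f x (grad g (φ t) x)
          + (γ - 1) * wittenLaplacian g f (φ t) x ^ 2) * ρ t x ^ γ ∂(weightedMeasure g f)
        - (c ^ 2)⁻¹ * ∫ x, carre g (fun y => ρ t y ^ γ) (φ t) x ∂(weightedMeasure g f)
        + (c ^ 2)⁻¹ * ∫ x, carre g (fun y => ρ t y ^ γ) (fun y => ρ t y ^ γ) x / ρ t x
          ∂(weightedMeasure g f)) J t := by
  have h1 := h.hasDerivWithinAt_integral_dissipation hb hχ ht
  have hS := h.integrable_curvature hb ht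
  have hL := (h.integrable_dissipation hb ht).const_mul (c ^ 2)⁻¹
  have hF := (h.integrable_fisher hb ht).const_mul (c ^ 2)⁻¹
  refine (h1.congr (fun s hs => (h.integral_cross hb hχ hs).symm)
    (h.integral_cross hb hχ ht).symm).congr_deriv ?_
  refine (integral_add (hS.add hL) hF).trans ?_
  rw [integral_const_mul]
  refine congrArg (· + _) ((integral_add hS hL).trans ?_)
  rw [integral_const_mul, ← h.integral_cross hb hχ ht, integral_neg]
  ring

/-- From `K' = 2c⁻²(Q - K)` and `E' = (γ-1)Q`: the factors `c²/2` and `1/(γ-1)` make the two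
contributions of `Q` cancel. -/
theorem hasDerivWithinAt_hamiltonian (hc : 0 < c) :
    HasDerivWithinAt (fun s => hamiltonian g f c γ (ρ s) (φ s))
      (-∫ x, normSq g (grad g (φ t) x) * ρ t x ∂(weightedMeasure g f)) J t := by
  have hγ : γ - 1 ≠ 0 := (sub_pos.2 h.one_lt).ne'
  refine (((h.hasDerivWithinAt_kinetic_energy hb hχ ht).const_mul (c ^ 2 / 2)).sub
    ((h.hasDerivWithinAt_entropy hb hχ ht).const_mul (1 / (γ - 1)))).congr_deriv ?_
  simp only [normSq_grad]
  field_simp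
  ring

theorem hasDerivWithinAt_lagrangian (hc : 0 < c) :
    HasDerivWithinAt (fun s => lagrangian g f c γ (ρ s) (φ s))
      (2 * ∫ x, carre g (fun y => ρ t y ^ γ) (φ t) x ∂(weightedMeasure g f)
        - ∫ x, carre g (φ t) (φ t) x * ρ t x ∂(weightedMeasure g f)) J t := by
  have hγ : γ - 1 ≠ 0 := (sub_pos.2 h.one_lt).ne'
  refine (((h.hasDerivWithinAt_kinetic_energy hb hχ ht).const_mul (c ^ 2 / 2)).add
    ((h.hasDerivWithinAt_entropy hb hχ ht).const_mul (1 / (γ - 1)))).congr_deriv ?_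
  field_simp
  ring

/-- In the derivative of `2Q - K` the terms of order `c⁻²` are `2c⁻²(K - 2Q + F)`, which is the
integrated square of `integral_discrepancy`. -/
theorem hasDerivWithinAt_derivWithin_lagrangian (hc : 0 < c) :
    HasDerivWithinAt (derivWithin (fun s => lagrangian g f c γ (ρ s) (φ s)) J)
      (2 * ∫ x, (c ^ 2)⁻¹ *
          normSq g (grad g (φ t) x - (γ * ρ t x ^ (γ - 2)) • grad g (ρ t) x) * ρ t x
          ∂(weightedMeasure g f)
        + 2 * ∫ x, (hessianHSSq g (φ t) x + bakryEmery g f x (grad g (φ t) x)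
          + (γ - 1) * wittenLaplacian g f (φ t) x ^ 2) * ρ t x ^ γ ∂(weightedMeasure g f))
      J t := by
  have hd : ∀ s ∈ J, derivWithin (fun s => lagrangian g f c γ (ρ s) (φ s)) J s
      = 2 * ∫ x, carre g (fun y => ρ s y ^ γ) (φ s) x ∂(weightedMeasure g f)
        - ∫ x, carre g (φ s) (φ s) x * ρ s x ∂(weightedMeasure g f) := fun s hs =>
    (h.hasDerivWithinAt_lagrangian hb hχ hs hc).derivWithin (h.uniqueDiffOn s hs)
  refine ((((h.hasDerivWithinAt_cross hb hχ ht).const_mul 2).sub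
    (h.hasDerivWithinAt_kinetic_energy hb hχ ht)).congr hd (hd t ht)).congr_deriv ?_
  rw [h.integral_discrepancy hb ht]
  ring

end IsRegularSolution

end Energies

end LangevinRenyi

end

/-! ### The compact and the Euclidean case together. -/

theorem theorem1p2 {n : ℕ} {M : Type*} [TopologicalSpace M] [T2Space M]
    [SecondCountableTopology M] [ChartedSpace (EuclideanSpace ℝ (Fin n)) M]
    [IsManifold (𝓡 n) ∞ M] [MeasurableSpace M] [BorelSpace M]
    (g : SmoothMetric n M) (f : M → ℝ) (hf : ContMDiff (𝓡 n) 𝓘(ℝ, ℝ) 2 f)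
    (c γ : ℝ) (hc : 0 < c) (hγ : 1 < γ)
    (J : Set ℝ) (hJ : J.OrdConnected) (hJ' : J.Nontrivial) (ρ φ : ℝ → M → ℝ)
    (hsol : IsSmoothLangevinSolution g f c γ J ρ φ)
    (hM : CompactSpace M ∨ (IsEuclidean g ∧ GrowthCondition g f γ J ρ φ)) :
    -- all the integrals below converge
    (∀ t ∈ J,
      Integrable (fun x => normSq g (grad g (φ t) x) * ρ t x) (weightedMeasure g f) ∧
      Integrable (fun x => ρ t x ^ γ) (weightedMeasure g f) ∧
      Integrable (fun x => (c ^ 2)⁻¹ *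
        normSq g (grad g (φ t) x - (γ * ρ t x ^ (γ - 2)) • grad g (ρ t) x) * ρ t x)
        (weightedMeasure g f) ∧
      Integrable (fun x => (hessianHSSq g (φ t) x + bakryEmery g f x (grad g (φ t) x)
        + (γ - 1) * wittenLaplacian g f (φ t) x ^ 2) * ρ t x ^ γ) (weightedMeasure g f)) ∧
    -- the first derivative of the Hamiltonian
    (∀ t ∈ J, HasDerivWithinAt (fun s => hamiltonian g f c γ (ρ s) (φ s))
      (-∫ x, normSq g (grad g (φ t) x) * ρ t x ∂(weightedMeasure g f)) J t) ∧
    -- the second derivative of the Lagrangian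
    DifferentiableOn ℝ (fun s => lagrangian g f c γ (ρ s) (φ s)) J ∧
    (∀ t ∈ J, HasDerivWithinAt
      (derivWithin (fun s => lagrangian g f c γ (ρ s) (φ s)) J)
      (2 * ∫ x, (c ^ 2)⁻¹ *
          normSq g (grad g (φ t) x - (γ * ρ t x ^ (γ - 2)) • grad g (ρ t) x) * ρ t x
          ∂(weightedMeasure g f)
        + 2 * ∫ x, (hessianHSSq g (φ t) x + bakryEmery g f x (grad g (φ t) x)
          + (γ - 1) * wittenLaplacian g f (φ t) x ^ 2) * ρ t x ^ γ ∂(weightedMeasure g f)) J t) ∧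
    -- monotonicity and convexity
    AntitoneOn (fun t => hamiltonian g f c γ (ρ t) (φ t)) J ∧
    (CDZeroInfty g f → ConvexOn ℝ J (fun t => lagrangian g f c γ (ρ t) (φ t))) := by
  have h := hsol.isRegularSolution hf hc hγ hJ hJ'
  -- The two cases differ only in the origin of the cutoffs and of the integrable bounds.
  obtain ⟨⟨χ, ε, hχ⟩, hb⟩ :
      (∃ χ ε, IsCutoffSequence g χ ε) ∧ HasUniformBounds g f γ J ρ φ := by
    rcases hM with hM | ⟨hE, hG⟩
    · exact ⟨exists_isCutoffSequence_of_compact g, h.hasUniformBounds_of_compact⟩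
    · exact ⟨exists_isCutoffSequence_of_isEuclidean hE, hG.hasUniformBounds⟩
  have hH := fun t ht => h.hasDerivWithinAt_hamiltonian hb hχ (t := t) ht hc
  have hL := fun t ht => h.hasDerivWithinAt_lagrangian hb hχ (t := t) ht hc
  have hL' := fun t ht => h.hasDerivWithinAt_derivWithin_lagrangian hb hχ (t := t) ht hc
  refine ⟨fun t ht => ⟨h.integrable_kinetic hb ht, h.integrable_entropy hb ht,
    h.integrable_discrepancy hb ht, h.integrable_curvature hb ht⟩, hH,
    fun t ht => (hL t ht).differentiableWithinAt, hL', ?_, fun hCD => ?_⟩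
  · refine antitoneOn_of_hasDerivWithinAt_nonpos hJ.convex
      (fun t ht => (hH t ht).continuousWithinAt)
      (fun t ht => (hH t (interior_subset ht)).mono interior_subset) fun t ht => ?_
    exact neg_nonpos.2 (integral_nonneg fun x =>
      mul_nonneg (normSq_nonneg g _) (hsol.density_pos t (interior_subset ht) x).le)
  · refine convexOn_of_hasDerivWithinAt2_nonneg hJ.convex
      (fun t ht => (hL t ht).continuousWithinAt)
      (fun t ht => ((hL t (interior_subset ht)).differentiableWithinAt.hasDerivWithinAt).mono
        interior_subset)
      (fun t ht => (hL' t (interior_subset ht)).mono interior_subset) fun t ht => ?_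
    have hpos := hsol.density_pos t (interior_subset ht)
    have h1 : 0 ≤ γ - 1 := (sub_pos.2 hγ).le
    refine add_nonneg (mul_nonneg zero_le_two (integral_nonneg fun x => ?_))
      (mul_nonneg zero_le_two (integral_nonneg fun x => ?_))
    · exact mul_nonneg (mul_nonneg (inv_nonneg.2 (sq_nonneg c)) (normSq_nonneg g _)) (hpos x).le
    · exact mul_nonneg (add_nonneg (add_nonneg (hessianHSSq_nonneg g _ x) (hCD x _))
        (mul_nonneg h1 (sq_nonneg _))) (Real.rpow_pos_of_pos (hpos x) _).le
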